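/- Setting. Let $\mathbf t=(t_1,\dots,t_d)$ be indeterminates, $\mathbb C(\mathbf t):=\mathbb C[\mathbf t,\mathbf t^{-1}]$ the ring of Laurent polynomials, $\mathbb F$ its field of fractions and $K\supseteq\mathbb F$ a field extension. Let $\mathbf L$ be a $k\times n$ matrix and $\mathbf R$ an $n\times k$ matrix with entries in $K$ such that no maximal minor of $\mathbf R$ vanishes, $\mathbf L$ has no null column, and for every $k$-subset $\mathcal I$ of $[n]$ the product $h(\mathcal I):=\Delta_{\mathbf L}(\mathcal I)\,\Delta_{\mathbf R}(\mathcal I)$ of maximal minors is of the form $g\,\mathbf t^{\mathbf e}$ with $g\in\mathbb C$ (possibly $0$) and $\mathbf e\in\mathbb Z^d$. For a $k$-subset $\mathcal I$, distinct $i,j\in\mathcal I$ and distinct $\alpha,\beta\notin\mathcal I$, write $\mathcal I^{i}_{\alpha}=\mathcal I\setminus\{i\}\cup\{\alpha\}$, $\mathcal I^{ij}_{\alpha\beta}=\mathcal I\setminus\{i,j\}\cup\{\alpha,\beta\}$, and put $$\vec\chi(\mathcal I|^{ij}_{\alpha\beta})=\big(h(\mathcal I)h(\mathcal I^{ij}_{\alpha\beta}),\;h(\mathcal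 I^i_\alpha)h(\mathcal I^j_\beta),\;h(\mathcal I^i_\beta)h(\mathcal I^j_\alpha)\big),$$ $$Y(\mathcal I)^{ij}_{\alpha\beta}=-\operatorname{sign}[(i-\alpha)(i-\beta)(j-\alpha)(j-\beta)]\cdot\frac{\Delta_{\mathbf R}(\mathcal I^i_\alpha)\,\Delta_{\mathbf R}(\mathcal I^j_\beta)}{\Delta_{\mathbf R}(\mathcal I^i_\beta)\,\Delta_{\mathbf R}(\mathcal I^j_\alpha)}.$$ Call $Y(\mathcal I)^{ij}_{\alpha\beta}$ a radical term if no component of $\vec\chi(\mathcal I|^{ij}_{\alpha\beta})$ vanishes and $Y(\mathcal I)^{ij}_{\alpha\beta}\notin\mathbb F$. Put $B(x,y,z)=(x-y-z)^2-4yz$ and let $B^{ij}_{\alpha\beta}$ be the value of $B$ at $\vec\chi(\mathcal I|^{ij}_{\alpha\beta})$. A squarefree part of an element $b$ is a squarefree $D\in\mathbb C(\mathbf t)$ with $b=Q^2D$ for some $Q\in\mathbb C(\mathbf t)$. A triple $(E_1,E_2,E_3)$ of units of $\mathbb C(\mathbf t)$ (nonzero monomials), taken up to a common unit factor, is called a monomial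 configuration. A triple defines $y$ if $y$ is a root of $E_3X^2-(E_1-E_2-E_3)X+E_2$. Theorem. Let $Y=Y(\mathcal I)^{ij}_{\alpha\beta}$ be a radical term. Then $B^{ij}_{\alpha\beta}$ has a squarefree part. For every squarefree part $D$ of $B^{ij}_{\alpha\beta}$, let $N_D$ be the number of monomial configurations $(E_1,E_2,E_3)$ such that $B(E_1,E_2,E_3)=Q^2D$ for some nonzero $Q\in\mathbb C(\mathbf t)$. Then: 1. $N_D$ is finite. 2. These configurations are recovered from $Y$ alone: they are exactly the monomial configurations that define some element of $\mathbb F(Y)\setminus\mathbb F$. 3. They account for all radical terms: for every radical term $Y(\mathcal J)^{ml}_{\gamma\delta}$, with any basis and indices, $\vec\chi(\mathcal J|^{ml}_{\gamma\delta})$ represents one of these $N_D$ configurations and defines $Y(\mathcal J)^{ml}_{\gamma\delta}$. 4. $n-k\le 2N_D+2$; in other words, there are no radical terms if $n-k>2N_D+2$. -/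

import Mathlib

namespace RadicalTerms

/-- The ring of Laurent polynomials over `ℂ` in `d` indeterminates; the monomial with coefficient `c`
and exponent vector `e` is `AddMonoidAlgebra.single e c`. -/
abbrev Laurent (d : ℕ) : Type := AddMonoidAlgebra ℂ (Fin d → ℤ)

/-- The field of fractions of the Laurent polynomial ring. -/
abbrev LaurentField (d : ℕ) : Type := FractionRing (Laurent d)

/-- Laurent polynomials, seen in an extension `K` of their field of fractions. -/
noncomputable def toExt {d : ℕ} (K : Type*) [Field K] [Algebra (LaurentField d) K] :
    Laurent d →+* K :=
  (algebraMap (LaurentField d) K).comp (algebraMap (Laurent d) (LaurentField d))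

/-- `I` with `i` replaced by `α`. -/
def exch {n : ℕ} (I : Finset (Fin n)) (i α : Fin n) : Finset (Fin n) :=
  insert α (I.erase i)

/-- `I` with `i, j` replaced by `α, β`. -/
def exchTwo {n : ℕ} (I : Finset (Fin n)) (i j α β : Fin n) : Finset (Fin n) :=
  insert α (insert β ((I.erase i).erase j))

/-- The maximal minor of a `k × n` matrix on the columns in `I`, taken in increasing order.
The value for sets of the wrong cardinality is never used. -/
noncomputable def minor {K : Type*} [Field K] {k n : ℕ} (A : Matrix (Fin k) (Fin n) K)
    (I : Finset (Fin n)) : K :=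
  if hI : I.card = k then (A.submatrix id (I.orderEmbOfFin hI)).det else 0

/-- The term indexed by `I` in the Cauchy-Binet expansion of `det (L * R)`. -/
noncomputable def term {K : Type*} [Field K] {k n : ℕ} (L : Matrix (Fin k) (Fin n) K)
    (R : Matrix (Fin n) (Fin k) K) (I : Finset (Fin n)) : K :=
  minor L I * minor R.transpose I

/-- The three products attached to the basis `I`, to `i, j ∈ I` and to `α, β ∉ I`. -/
noncomputable def chi {K : Type*} [Field K] {k n : ℕ} (L : Matrix (Fin k) (Fin n) K)
    (R : Matrix (Fin n) (Fin k) K) (I : Finset (Fin n)) (i j α β : Fin n) : Fin 3 → K :=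
  ![term L R I * term L R (exchTwo I i j α β),
    term L R (exch I i α) * term L R (exch I j β),
    term L R (exch I i β) * term L R (exch I j α)]

/-- The first sign in the three-term Plücker relation for `i, j, α, β`. -/
def signOne {n : ℕ} (i j α β : Fin n) : ℤ :=
  Int.sign (((i.val : ℤ) - j.val) * ((α.val : ℤ) - β.val) * ((i.val : ℤ) - β.val) * ((α.val : ℤ) - j.val))

/-- The second sign in the three-term Plücker relation for `i, j, α, β`. -/
def signTwo {n : ℕ} (i j α β : Fin n) : ℤ :=
  Int.sign (((i.val : ℤ) - j.val) * ((α.val : ℤ) - β.val) * ((i.val : ℤ) - α.val) * ((j.val : ℤ) - β.val))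

/-- The `Y`-term (signed cross-ratio of maximal minors of `R`). -/
noncomputable def yTerm {K : Type*} [Field K] {k n : ℕ} (R : Matrix (Fin n) (Fin k) K)
    (I : Finset (Fin n)) (i j α β : Fin n) : K :=
  ((signOne i j α β * signTwo i j α β : ℤ) : K) *
    (minor R.transpose (exch I i α) / minor R.transpose (exch I i β)) *
    (minor R.transpose (exch I j β) / minor R.transpose (exch I j α))

/-- The discriminant `B(x, y, z) = (x - y - z)² - 4yz`. -/
def bFun {S : Type*} [CommRing S] (x y z : S) : S := (x - y - z) ^ 2 - 4 * y * z

/-- The `B`-term of the indices. -/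
noncomputable def bTerm {K : Type*} [Field K] {k n : ℕ} (L : Matrix (Fin k) (Fin n) K)
    (R : Matrix (Fin n) (Fin k) K) (I : Finset (Fin n)) (i j α β : Fin n) : K :=
  bFun (chi L R I i j α β 0) (chi L R I i j α β 1) (chi L R I i j α β 2)

/-- `Y` is a radical term: none of the three products vanishes, and `Y` does not lie in the field
of fractions of the Laurent polynomial ring. -/
structure IsRadicalTerm (d : ℕ) {K : Type*} [Field K] [Algebra (LaurentField d) K] {k n : ℕ}
    (L : Matrix (Fin k) (Fin n) K) (R : Matrix (Fin n) (Fin k) K)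
    (I : Finset (Fin n)) (i j α β : Fin n) : Prop where
  card_eq : I.card = k
  mem_i : i ∈ I
  mem_j : j ∈ I
  ne_ij : i ≠ j
  not_mem_α : α ∉ I
  not_mem_β : β ∉ I
  ne_αβ : α ≠ β
  chi_ne_zero : ∀ s, chi L R I i j α β s ≠ 0
  not_mem_field : yTerm R I i j α β ∉ Set.range (algebraMap (LaurentField d) K)

/-- `D` is a squarefree part of `b`: it is squarefree and `b = Q² D` for a Laurent polynomial `Q`. -/
def IsSquarefreePart {d : ℕ} {K : Type*} [Field K] [Algebra (LaurentField d) K]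
    (D : Laurent d) (b : K) : Prop :=
  Squarefree D ∧ ∃ Q : Laurent d, b = toExt K (Q ^ 2 * D)

/-- Ordered triples `(E₁, E₂, E₃)` of invertible Laurent monomials, up to a common invertible
factor. -/
abbrev Configuration (d : ℕ) : Type :=
  MulAction.orbitRel.Quotient (Laurent d)ˣ (Fin 3 → (Laurent d)ˣ)

/-- The configuration of a triple. -/
noncomputable def Configuration.mk {d : ℕ} (E : Fin 3 → (Laurent d)ˣ) : Configuration d :=
  Quotient.mk (MulAction.orbitRel (Laurent d)ˣ (Fin 3 → (Laurent d)ˣ)) E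

/-- The configurations of the triples whose discriminant is `D` up to a nonzero square factor.
The condition does not depend on the triple that represents the configuration. -/
def configurations {d : ℕ} (D : Laurent d) : Set (Configuration d) :=
  Configuration.mk '' {E | ∃ Q : Laurent d, Q ≠ 0 ∧
    bFun (E 0 : Laurent d) (E 1 : Laurent d) (E 2 : Laurent d) = Q ^ 2 * D}

/-- The triple `(E₁, E₂, E₃)` defines `y`: `y` is a root of `E₃ X² - (E₁ - E₂ - E₃) X + E₂`. -/
def Defines {d : ℕ} {K : Type*} [Field K] [Algebra (LaurentField d) K]
    (E : Fin 3 → (Laurent d)ˣ) (y : K) : Prop :=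
  toExt K (E 2 : Laurent d) * y ^ 2
    - toExt K ((E 0 : Laurent d) - (E 1 : Laurent d) - (E 2 : Laurent d)) * y
    + toExt K (E 1 : Laurent d) = 0

end RadicalTerms

open RadicalTerms

namespace RadicalTerms

/-! ### Laurent polynomials -/

/-! Normalise both matrices so that the columns of the given basis form an identity block (`chart`).
The entries and 2 × 2 minors of the two charts are then quotients of maximal minors, and the
negative of a cross-ratio of the chart of R is a root of a quadratic whose three monomials are, up
to a common factor, the components of χ (`MonomialPair.quadratic`). Its discriminant is B, so F(Y) =
F(√B) = F(√D). A configuration defines an irrational element of this field exactly when its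
discriminant is D times a nonzero square, and squarefreeness of D makes that square a square of a
Laurent polynomial (`Defines.mk_mem_configurations`, `Defines.exists_mem_adjoin`).

Finiteness concerns B(E₁, E₂, E₃) = Q²D with D not a square up to squares. If Q is a unit, the
exponents and coefficients of D leave finitely many choices for the ratios of the monomials
(`exists_monomialRel`). If Q is not a unit, B factors formally as the product of √x ± √y ± √z with
signs, and vanishing to second order along Q = 0 also gives a derivative relation. Together they fix
√x : √y : √z in terms of the degrees of the monomials, so Q divides binomials
(`dvd_binomial_of_sq_dvd`). Comparing Newton widths then bounds the exponents by the width of D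
(`sub_le_width_of_sq_dvd`). The binomials give one multiplicative relation between the coefficients,
the vanishing of D at a point gives another, and both together have finitely many solutions
(`finite_coeffs_of_not_isUnit`).

All radical terms lie in one quadratic field. If y₁ is irrational and y₂, y₁y₂ satisfy quadratics
over F, eliminating the square of y₂ expresses it through y₁, provided its trace is nonzero
(`mem_of_quadratic`); trace zero forces a monomial quadratic to have rational roots. Hence every row
of the chart of L is zero or has no zero entry, and the cross-ratios in the nonzero rows lie in F(Y)
(`MonomialPair.row_dichotomy`). Up to scaling rows and columns, the relevant part of the chart of R
has entries in F(Y), and the scalings cancel in every radical term (`MonomialTerms.minorRatio_mem`).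

For the bound on n - k, fix two rows and a base column. The columns that have an irrational
cross-ratio with the base column define distinct configurations (`MonomialPair.column_eq_of_mk_eq`),
and two base columns suffice to reach all columns. -/

theorem single_mul_single' {d : ℕ} (e e' : Fin d → ℤ) (a b : ℂ) :
    (AddMonoidAlgebra.single e a : Laurent d) * AddMonoidAlgebra.single e' b =
      AddMonoidAlgebra.single (e + e') (a * b) :=
  AddMonoidAlgebra.single_mul_single ..

theorem isUnit_single {d : ℕ} (e : Fin d → ℤ) {c : ℂ} (hc : c ≠ 0) :
    IsUnit (AddMonoidAlgebra.single e c : Laurent d) := by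
  refine IsUnit.of_mul_eq_one (AddMonoidAlgebra.single (-e) c⁻¹) ?_
  rw [single_mul_single', AddMonoidAlgebra.one_def, mul_inv_cancel₀ hc, add_neg_cancel]

/-- The inclusion of the exponents of polynomials into those of Laurent polynomials. -/
noncomputable def natExponents (d : ℕ) : (Fin d →₀ ℕ) →+ (Fin d → ℤ) where
  toFun e l := e l
  map_zero' := by ext; simp
  map_add' := by intros; ext; simp

/-- The inclusion of polynomials into Laurent polynomials. -/
noncomputable def polyToLaurent (d : ℕ) : MvPolynomial (Fin d) ℂ →+* Laurent d :=
  AddMonoidAlgebra.mapDomainRingHom ℂ (natExponents d)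

theorem polyToLaurent_monomial {d : ℕ} (e : Fin d →₀ ℕ) (c : ℂ) :
    polyToLaurent d (MvPolynomial.monomial e c) =
      AddMonoidAlgebra.single (natExponents d e) c := by
  unfold polyToLaurent
  exact AddMonoidAlgebra.mapDomain_single

theorem polyToLaurent_injective (d : ℕ) : Function.Injective (polyToLaurent d) := by
  apply AddMonoidAlgebra.mapDomain_injective
  intro a b h
  ext l
  have := congrFun h l
  simpa [natExponents] using this

theorem exists_monomial_mul_eq_polyToLaurent {d : ℕ} (f : Laurent d) :
    ∃ (e : Fin d →₀ ℕ) (p : MvPolynomial (Fin d) ℂ),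
      f * polyToLaurent d (MvPolynomial.monomial e 1) = polyToLaurent d p := by
  induction f using AddMonoidAlgebra.induction_linear with
  | zero => exact ⟨0, 0, by simp⟩
  | add f g hf hg =>
    obtain ⟨e, p, hp⟩ := hf
    obtain ⟨e', p', hp'⟩ := hg
    refine ⟨e + e', p * MvPolynomial.monomial e' 1 + p' * MvPolynomial.monomial e 1, ?_⟩
    rw [map_add, map_mul, map_mul, ← hp, ← hp',
      show (MvPolynomial.monomial (e + e') (1 : ℂ)) =
        MvPolynomial.monomial e 1 * MvPolynomial.monomial e' 1 by
        rw [MvPolynomial.monomial_mul, one_mul], map_mul]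
    ring
  | single e c =>
    refine ⟨Finsupp.equivFunOnFinite.symm fun l => (-e l).toNat,
      MvPolynomial.monomial (Finsupp.equivFunOnFinite.symm fun l => (e l).toNat) c, ?_⟩
    rw [polyToLaurent_monomial, polyToLaurent_monomial, single_mul_single', mul_one]
    congr 1
    ext l
    simp only [natExponents, AddMonoidHom.coe_mk, ZeroHom.coe_mk, Pi.add_apply,
      Finsupp.equivFunOnFinite_symm_apply_apply]
    omega

/-- Multiplying by a monomial clears negative exponents, so the Laurent ring is the localization of
the polynomial ring at the polynomials that become units, and unique factorization passes to
localizations. -/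
instance uniqueFactorizationMonoid_laurent (d : ℕ) : UniqueFactorizationMonoid (Laurent d) := by
  let _ : Algebra (MvPolynomial (Fin d) ℂ) (Laurent d) := (polyToLaurent d).toAlgebra
  let S : Submonoid (MvPolynomial (Fin d) ℂ) :=
    (IsUnit.submonoid (Laurent d)).comap (polyToLaurent d)
  have : IsLocalization S (Laurent d) :=
    { map_units := fun y => y.2
      surj := fun z => by
        obtain ⟨e, p, h⟩ := exists_monomial_mul_eq_polyToLaurent z
        refine ⟨(p, ⟨MvPolynomial.monomial e 1, ?_⟩), h⟩
        change IsUnit (polyToLaurent d _)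
        rw [polyToLaurent_monomial]
        exact isUnit_single _ one_ne_zero
      exists_of_eq := fun {x y} h => ⟨1, by rw [polyToLaurent_injective d h]⟩ }
  exact UniqueFactorizationMonoid.of_isLocalization S (Laurent d)

/-! ### Degrees along a direction -/

/-- The Laurent polynomial with the summand at the exponent `e` in degree `v e`. -/
noncomputable def gradeHom {d : ℕ} (v : (Fin d → ℤ) →+ ℤ) :
    Laurent d →+* AddMonoidAlgebra (Laurent d) ℤ :=
  AddMonoidAlgebra.liftNCRingHom
    ((AddMonoidAlgebra.singleZeroRingHom).comp AddMonoidAlgebra.singleZeroRingHom)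
    { toFun := fun e => AddMonoidAlgebra.single (v e.toAdd) (AddMonoidAlgebra.single e.toAdd 1)
      map_one' := by
        simp only [toAdd_one, map_zero]; rfl
      map_mul' := fun a b => by
        rw [AddMonoidAlgebra.single_mul_single, single_mul_single', toAdd_mul, map_add, one_mul] }
    (fun _ _ => Commute.all _ _)

theorem gradeHom_single {d : ℕ} (v : (Fin d → ℤ) →+ ℤ) (e : Fin d → ℤ) (c : ℂ) :
    gradeHom v (AddMonoidAlgebra.single e c) =
      AddMonoidAlgebra.single (v e) (AddMonoidAlgebra.single e c) := by
  unfold gradeHom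
  erw [AddMonoidAlgebra.liftNC_single]
  change AddMonoidAlgebra.single 0 (AddMonoidAlgebra.single 0 c) *
    AddMonoidAlgebra.single (v e) (AddMonoidAlgebra.single e 1) = _
  rw [AddMonoidAlgebra.single_mul_single, single_mul_single', zero_add, zero_add, mul_one]

theorem coeff_gradeHom {d : ℕ} (v : (Fin d → ℤ) →+ ℤ) (f : Laurent d) (m : ℤ) (e : Fin d → ℤ) :
    ((gradeHom v f).coeff m).coeff e = if v e = m then f.coeff e else 0 := by
  classical
  induction f using AddMonoidAlgebra.induction_linear with
  | zero => simp
  | add f g hf hg =>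
    rw [map_add, AddMonoidAlgebra.coeff_add, Finsupp.add_apply, AddMonoidAlgebra.coeff_add,
      Finsupp.add_apply, hf, hg, AddMonoidAlgebra.coeff_add, Finsupp.add_apply]
    split_ifs <;> simp
  | single a c =>
    rw [gradeHom_single, AddMonoidAlgebra.coeff_single, Finsupp.single_apply,
      AddMonoidAlgebra.coeff_single, Finsupp.single_apply]
    by_cases h : v a = m
    · rw [if_pos h, AddMonoidAlgebra.coeff_single, Finsupp.single_apply]
      by_cases h' : a = e
      · subst h'; simp [h]
      · simp [h']
    · rw [if_neg h]
      by_cases h' : a = e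
      · subst h'; simp [h]
      · simp [h']

/-- The largest value of `v` on the exponents of a Laurent polynomial. -/
noncomputable def topDegree {d : ℕ} (v : (Fin d → ℤ) →+ ℤ) (f : Laurent d) : WithBot ℤ :=
  f.coeff.support.sup fun e => (v e : WithBot ℤ)

theorem topDegree_eq {d : ℕ} (v : (Fin d → ℤ) →+ ℤ) (f : Laurent d) :
    topDegree v f = (gradeHom v f).supDegree (fun m : ℤ => (m : WithBot ℤ)) := by
  apply le_antisymm
  · refine Finset.sup_le fun e he => ?_
    refine Finset.le_sup (f := fun m : ℤ => (m : WithBot ℤ)) ?_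
    rw [Finsupp.mem_support_iff] at he ⊢
    intro h
    apply he
    have := coeff_gradeHom v f (v e) e
    rw [h] at this
    simpa using this.symm
  · refine Finset.sup_le fun m hm => ?_
    rw [Finsupp.mem_support_iff] at hm
    obtain ⟨e, he⟩ : ∃ e, ((gradeHom v f).coeff m).coeff e ≠ 0 := by
      by_contra! h
      exact hm (by ext e; simpa using h e)
    rw [coeff_gradeHom] at he
    have hv : v e = m := by by_contra h; simp [h] at he
    rw [if_pos hv] at he
    rw [← hv]
    exact Finset.le_sup (f := fun e => (v e : WithBot ℤ)) (Finsupp.mem_support_iff.2 he)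

theorem gradeHom_ne_zero {d : ℕ} (v : (Fin d → ℤ) →+ ℤ) {f : Laurent d} (hf : f ≠ 0) :
    gradeHom v f ≠ 0 := by
  intro h
  apply hf
  ext e
  have := coeff_gradeHom v f (v e) e
  rw [h] at this
  simpa using this.symm

/-- The part of top degree along v may have several terms. Once the ring is graded by ℤ, the two top
parts are the only pair that reaches the top degree of the product, and their product is nonzero
because Laurent polynomials form a domain. -/
theorem topDegree_mul {d : ℕ} (v : (Fin d → ℤ) →+ ℤ) {f g : Laurent d} (hf : f ≠ 0)
    (hg : g ≠ 0) : topDegree v (f * g) = topDegree v f + topDegree v g := by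
  have hne : ∀ {f : Laurent d}, f ≠ 0 → (gradeHom v f).coeff.support.Nonempty := fun hf => by
    rw [Finsupp.support_nonempty_iff]
    simpa using gradeHom_ne_zero v hf
  apply le_antisymm
  · rw [topDegree_eq, topDegree_eq, topDegree_eq, map_mul]
    exact AddMonoidAlgebra.supDegree_mul_le fun _ _ => by simp
  obtain ⟨a, ha, hamax⟩ := Finset.exists_max_image _ id (hne hf)
  obtain ⟨b, hb, hbmax⟩ := Finset.exists_max_image _ id (hne hg)
  have hle : ∀ {f : Laurent d} {a : ℤ}, (∀ x ∈ (gradeHom v f).coeff.support, x ≤ a) →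
      topDegree v f ≤ a := fun h => by
    rw [topDegree_eq]
    exact Finset.sup_le fun x hx => by simpa using h x hx
  refine (add_le_add (hle hamax) (hle hbmax)).trans ?_
  rw [topDegree_eq, map_mul, ← WithBot.coe_add]
  refine Finset.le_sup (f := fun m : ℤ => (m : WithBot ℤ)) ?_
  rw [Finsupp.mem_support_iff, AddMonoidAlgebra.coeff_mul_add_of_uniqueAdd]
  · exact mul_ne_zero (Finsupp.mem_support_iff.1 ha) (Finsupp.mem_support_iff.1 hb)
  · intro x y hx hy hxy
    have := hamax x hx
    have := hbmax y hy
    simp only [id] at *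
    constructor <;> omega

/-- The difference between the largest and the smallest value of `v` on the exponents of `f`. -/
noncomputable def width {d : ℕ} (v : (Fin d → ℤ) →+ ℤ) (f : Laurent d) : ℤ :=
  (topDegree v f).unbotD 0 + (topDegree (-v) f).unbotD 0

theorem exists_topDegree {d : ℕ} (v : (Fin d → ℤ) →+ ℤ) {f : Laurent d} (hf : f ≠ 0) :
    ∃ e, f.coeff e ≠ 0 ∧ topDegree v f = v e ∧ ∀ e', f.coeff e' ≠ 0 → v e' ≤ v e := by
  have hne : f.coeff.support.Nonempty := by
    rw [Finsupp.support_nonempty_iff]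
    simpa using hf
  obtain ⟨e, he, hmax⟩ := Finset.exists_max_image f.coeff.support (fun e => v e) hne
  refine ⟨e, Finsupp.mem_support_iff.1 he, ?_, fun e' he' =>
    hmax e' (Finsupp.mem_support_iff.2 he')⟩
  apply le_antisymm
  · exact Finset.sup_le fun e' he' => by simpa using hmax e' he'
  · exact Finset.le_sup (f := fun e => (v e : WithBot ℤ)) he

theorem width_mul {d : ℕ} (v : (Fin d → ℤ) →+ ℤ) {f g : Laurent d} (hf : f ≠ 0)
    (hg : g ≠ 0) : width v (f * g) = width v f + width v g := by
  unfold width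
  rw [topDegree_mul v hf hg, topDegree_mul (-v) hf hg]
  obtain ⟨a, -, ha, -⟩ := exists_topDegree v hf
  obtain ⟨b, -, hb, -⟩ := exists_topDegree v hg
  obtain ⟨a', -, ha', -⟩ := exists_topDegree (-v) hf
  obtain ⟨b', -, hb', -⟩ := exists_topDegree (-v) hg
  rw [ha, hb, ha', hb', ← WithBot.coe_add, ← WithBot.coe_add]
  simp only [WithBot.unbotD_coe]
  ring

theorem exists_width {d : ℕ} (v : (Fin d → ℤ) →+ ℤ) {f : Laurent d} (hf : f ≠ 0) :
    ∃ a b, f.coeff a ≠ 0 ∧ f.coeff b ≠ 0 ∧ width v f = v a - v b := by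
  obtain ⟨a, ha0, ha, -⟩ := exists_topDegree v hf
  obtain ⟨b, hb0, hb, -⟩ := exists_topDegree (-v) hf
  refine ⟨a, b, ha0, hb0, ?_⟩
  unfold width
  rw [ha, hb]
  simp [sub_eq_add_neg]

theorem sub_le_width {d : ℕ} (v : (Fin d → ℤ) →+ ℤ) {f : Laurent d} {a b : Fin d → ℤ}
    (ha : f.coeff a ≠ 0) (hb : f.coeff b ≠ 0) : v a - v b ≤ width v f := by
  have hf : f ≠ 0 := by rintro rfl; simp at ha
  obtain ⟨a', -, ha', h1⟩ := exists_topDegree v hf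
  obtain ⟨b', -, hb', h2⟩ := exists_topDegree (-v) hf
  have e1 := h1 a ha
  have e2 := h2 b hb
  unfold width
  rw [ha', hb']
  simp only [WithBot.unbotD_coe, AddMonoidHom.neg_apply] at *
  linarith

theorem width_nonneg {d : ℕ} (v : (Fin d → ℤ) →+ ℤ) {f : Laurent d} (hf : f ≠ 0) :
    0 ≤ width v f := by
  obtain ⟨a, -, ha, -⟩ := exists_width v hf
  simpa using sub_le_width v ha ha

theorem width_le_of_dvd {d : ℕ} (v : (Fin d → ℤ) →+ ℤ) {f g : Laurent d} (hg : g ≠ 0)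
    (h : f ∣ g) : width v f ≤ width v g := by
  obtain ⟨r, rfl⟩ := h
  rw [width_mul v (left_ne_zero_of_mul hg) (right_ne_zero_of_mul hg)]
  linarith [width_nonneg v (right_ne_zero_of_mul hg)]

theorem width_one {d : ℕ} (v : (Fin d → ℤ) →+ ℤ) : width v (1 : Laurent d) = 0 := by
  have := width_mul v (one_ne_zero (α := Laurent d)) one_ne_zero
  rw [mul_one] at this
  linarith

theorem width_of_isUnit {d : ℕ} (v : (Fin d → ℤ) →+ ℤ) {f : Laurent d} (hf : IsUnit f) :
    width v f = 0 :=
  le_antisymm ((width_le_of_dvd v one_ne_zero hf.dvd).trans_eq (width_one v))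
    (width_nonneg v hf.ne_zero)

/-- A unit has width zero in every coordinate direction, so all its exponents coincide. -/
theorem exists_eq_single_of_isUnit {d : ℕ} {f : Laurent d} (hf : IsUnit f) :
    ∃ (e : Fin d → ℤ) (c : ℂ), c ≠ 0 ∧ f = AddMonoidAlgebra.single e c := by
  classical
  obtain ⟨e, he, -, -⟩ := exists_topDegree 0 hf.ne_zero
  refine ⟨e, f.coeff e, he, ?_⟩
  ext a
  rw [AddMonoidAlgebra.coeff_single, Finsupp.single_apply]
  split_ifs with h
  · rw [h]
  by_contra ha
  apply h
  ext l
  have h1 := sub_le_width (Pi.evalAddMonoidHom (fun _ : Fin d => ℤ) l) ha he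
  have h2 := sub_le_width (Pi.evalAddMonoidHom (fun _ : Fin d => ℤ) l) he ha
  rw [width_of_isUnit _ hf] at h1 h2
  simp only [Pi.evalAddMonoidHom_apply] at h1 h2
  linarith

/-! ### Directional derivatives -/

/-- The logarithmic derivative of Laurent polynomials in the direction `v`. -/
noncomputable def dirDeriv {d : ℕ} (v : (Fin d → ℤ) →+ ℤ) : Laurent d →+ Laurent d :=
  (Finsupp.liftAddHom fun e => (AddMonoidAlgebra.singleAddHom e).comp
    (AddMonoidHom.mulLeft ((v e : ℤ) : ℂ))).comp
    (AddMonoidAlgebra.coeffAddEquiv (R := ℂ) (M := Fin d → ℤ)).toAddMonoidHom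

theorem dirDeriv_single {d : ℕ} (v : (Fin d → ℤ) →+ ℤ) (e : Fin d → ℤ) (c : ℂ) :
    dirDeriv v (AddMonoidAlgebra.single e c) = AddMonoidAlgebra.single e ((v e : ℂ) * c) := by
  simp only [dirDeriv, AddMonoidHom.comp_apply]
  erw [Finsupp.liftAddHom_apply_single]
  rfl

theorem dirDeriv_mul {d : ℕ} (v : (Fin d → ℤ) →+ ℤ) (f g : Laurent d) :
    dirDeriv v (f * g) = dirDeriv v f * g + f * dirDeriv v g := by
  induction f using AddMonoidAlgebra.induction_linear with
  | zero => simp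
  | add f f' hf hf' => rw [add_mul, map_add, hf, hf', map_add]; ring
  | single e c =>
    induction g using AddMonoidAlgebra.induction_linear with
    | zero => simp
    | add f f' hf hf' => rw [mul_add, map_add, hf, hf', map_add]; ring
    | single e' c' =>
      simp only [single_mul_single', dirDeriv_single]
      rw [← AddMonoidAlgebra.single_add]
      congr 1
      push_cast [map_add]
      ring

/-! ### Discriminants of monomial triples -/

theorem bFun_rotate {S : Type*} [CommRing S] (x y z : S) : bFun x y z = bFun y z x := by
  unfold bFun; ring

theorem bFun_swap {S : Type*} [CommRing S] (x y z : S) : bFun x y z = bFun x z y := by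
  unfold bFun; ring

theorem coeff_bFun {d : ℕ} (e₀ e₁ e₂ : Fin d → ℤ) (c₀ c₁ c₂ : ℂ) (m : Fin d → ℤ) :
    (bFun (AddMonoidAlgebra.single e₀ c₀) (AddMonoidAlgebra.single e₁ c₁)
      (AddMonoidAlgebra.single e₂ c₂) : Laurent d).coeff m =
      (if e₀ + e₀ = m then c₀ ^ 2 else 0) + (if e₁ + e₁ = m then c₁ ^ 2 else 0) +
      (if e₂ + e₂ = m then c₂ ^ 2 else 0) + (if e₀ + e₁ = m then -2 * c₀ * c₁ else 0) +
      (if e₀ + e₂ = m then -2 * c₀ * c₂ else 0) + (if e₁ + e₂ = m then -2 * c₁ * c₂ else 0) := by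
  have : (bFun (AddMonoidAlgebra.single e₀ c₀) (AddMonoidAlgebra.single e₁ c₁)
      (AddMonoidAlgebra.single e₂ c₂) : Laurent d) =
      AddMonoidAlgebra.single (e₀ + e₀) (c₀ ^ 2) + AddMonoidAlgebra.single (e₁ + e₁) (c₁ ^ 2) +
      AddMonoidAlgebra.single (e₂ + e₂) (c₂ ^ 2) +
      AddMonoidAlgebra.single (e₀ + e₁) (-2 * c₀ * c₁) +
      AddMonoidAlgebra.single (e₀ + e₂) (-2 * c₀ * c₂) +
      AddMonoidAlgebra.single (e₁ + e₂) (-2 * c₁ * c₂) := by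
    simp only [neg_mul, AddMonoidAlgebra.single_neg, two_mul,
      AddMonoidAlgebra.single_add, pow_two, ← single_mul_single']
    unfold bFun
    ring
  rw [this]
  simp only [AddMonoidAlgebra.coeff_add, Finsupp.add_apply, AddMonoidAlgebra.coeff_single,
    Finsupp.single_apply]

theorem isUnit_natCast_laurent {d : ℕ} {m : ℕ} (hm : m ≠ 0) : IsUnit (m : Laurent d) := by
  rw [AddMonoidAlgebra.natCast_def]
  exact isUnit_single 0 (by exact_mod_cast hm)

/-- A square factor of the discriminant divides a linear combination of the three monomials. -/
theorem dvd_linear_of_sq_dvd {d : ℕ} (v : (Fin d → ℤ) →+ ℤ) {e₀ e₁ e₂ : Fin d → ℤ}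
    {c₀ c₁ c₂ : ℂ} (h₁ : c₁ ≠ 0) (h₂ : c₂ ≠ 0) {Q D : Laurent d}
    (h : bFun (AddMonoidAlgebra.single e₀ c₀) (AddMonoidAlgebra.single e₁ c₁)
      (AddMonoidAlgebra.single e₂ c₂) = Q ^ 2 * D) :
    Q ∣ ((2 * v e₀ - v e₁ - v e₂ : ℤ) : Laurent d) * AddMonoidAlgebra.single e₀ c₀ -
      ((v e₁ - v e₂ : ℤ) : Laurent d) *
        (AddMonoidAlgebra.single e₁ c₁ - AddMonoidAlgebra.single e₂ c₂) := by
  have hδ : ∀ (e : Fin d → ℤ) (c : ℂ), dirDeriv v (AddMonoidAlgebra.single e c) =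
      ((v e : ℤ) : Laurent d) * AddMonoidAlgebra.single e c := fun e c => by
    rw [dirDeriv_single, AddMonoidAlgebra.intCast_def, single_mul_single', zero_add]
  have hu : IsUnit (4 * AddMonoidAlgebra.single e₁ c₁ * AddMonoidAlgebra.single e₂ c₂ :
      Laurent d) := by
    have := isUnit_natCast_laurent (d := d) (m := 4) (by norm_num)
    push_cast at this
    exact (this.mul (isUnit_single e₁ h₁)).mul (isUnit_single e₂ h₂)
  have hd := congrArg (dirDeriv v) h
  rw [pow_two, mul_assoc, dirDeriv_mul, dirDeriv_mul v Q D,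
    show bFun (AddMonoidAlgebra.single e₀ c₀) (AddMonoidAlgebra.single e₁ c₁)
      (AddMonoidAlgebra.single e₂ c₂ : Laurent d) =
      (AddMonoidAlgebra.single e₀ c₀ - AddMonoidAlgebra.single e₁ c₁ -
        AddMonoidAlgebra.single e₂ c₂) * (AddMonoidAlgebra.single e₀ c₀ -
        AddMonoidAlgebra.single e₁ c₁ - AddMonoidAlgebra.single e₂ c₂) -
      (AddMonoidAlgebra.single e₁ c₁ * AddMonoidAlgebra.single e₂ c₂ +
        AddMonoidAlgebra.single e₁ c₁ * AddMonoidAlgebra.single e₂ c₂ +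
        AddMonoidAlgebra.single e₁ c₁ * AddMonoidAlgebra.single e₂ c₂ +
        AddMonoidAlgebra.single e₁ c₁ * AddMonoidAlgebra.single e₂ c₂) by unfold bFun; ring] at hd
  simp only [map_sub, map_add, dirDeriv_mul, hδ] at hd
  unfold bFun at h
  generalize (AddMonoidAlgebra.single e₀ c₀ : Laurent d) = x at *
  generalize (AddMonoidAlgebra.single e₁ c₁ : Laurent d) = y at *
  generalize (AddMonoidAlgebra.single e₂ c₂ : Laurent d) = z at *
  -- Modulo Q the square of x - y - z equals 4yz, which is a unit.
  have hcop : IsCoprime Q (x - y - z) := by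
    obtain ⟨w, hw⟩ := hu.exists_left_inv
    refine ⟨-w * (Q * D), w * (x - y - z), ?_⟩
    linear_combination hw + w * h
  -- Subtracting (v e₁ + v e₂) · B from the derivative of B cancels the terms in yz and leaves x - y
  -- - z times the linear form.
  refine hcop.dvd_of_dvd_mul_left ⟨dirDeriv v Q * D + (dirDeriv v Q * D + Q * dirDeriv v D) -
    ((v e₁ + v e₂ : ℤ) : Laurent d) * (Q * D), ?_⟩
  push_cast
  linear_combination hd - ((v e₁ : Laurent d) + v e₂) * h

/-- A square factor of the discriminant divides a binomial in any two of the three monomials. -/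
theorem dvd_binomial_of_sq_dvd {d : ℕ} (v : (Fin d → ℤ) →+ ℤ) {e₀ e₁ e₂ : Fin d → ℤ}
    {c₀ c₁ c₂ : ℂ} (h₀ : c₀ ≠ 0) (h₁ : c₁ ≠ 0) (h₂ : c₂ ≠ 0) {Q D : Laurent d}
    (h : bFun (AddMonoidAlgebra.single e₀ c₀) (AddMonoidAlgebra.single e₁ c₁)
      (AddMonoidAlgebra.single e₂ c₂) = Q ^ 2 * D) :
    Q ∣ AddMonoidAlgebra.single e₀ (((v e₂ - v e₀ : ℤ) : ℂ) ^ 2 * c₀) -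
      AddMonoidAlgebra.single e₁ (((v e₁ - v e₂ : ℤ) : ℂ) ^ 2 * c₁) := by
  have hA := dvd_linear_of_sq_dvd v h₁ h₂ h
  have hB := dvd_linear_of_sq_dvd v h₂ h₀ ((bFun_rotate _ _ _).symm.trans h)
  have hs : ∀ (n : ℤ) (e : Fin d → ℤ) (c : ℂ), (AddMonoidAlgebra.single e ((n : ℂ) ^ 2 * c) :
      Laurent d) = (n : Laurent d) ^ 2 * AddMonoidAlgebra.single e c := fun n e c => by
    rw [AddMonoidAlgebra.intCast_def, AddMonoidAlgebra.single_pow, single_mul_single', smul_zero,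
      zero_add]
  rw [hs, hs]
  have h2 : IsUnit (2 : Laurent d) := by
    simpa using isUnit_natCast_laurent (d := d) (m := 2) (by norm_num)
  rw [← h2.dvd_mul_left]
  -- These multipliers eliminate the third monomial from the linear form and its rotation.
  have := dvd_add (hA.mul_left ((v e₂ - v e₀ : ℤ) : Laurent d))
    (hB.mul_left ((v e₁ - v e₂ : ℤ) : Laurent d))
  rw [← dvd_neg]
  convert this using 1
  push_cast
  ring

/-! ### Triples whose discriminant has a non-invertible square factor -/

/-- With one term gone, the binomial is a monomial, and a non-unit divides a monomial only if its
coefficient is zero. -/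
theorem eq_zero_of_dvd_binomial {d : ℕ} {e₀ e₁ : Fin d → ℤ} {c₀ c₁ : ℂ} (h₀ : c₀ ≠ 0)
    {Q : Laurent d} (hQ : ¬ IsUnit Q) {a b : ℤ}
    (h : Q ∣ AddMonoidAlgebra.single e₀ ((b : ℂ) ^ 2 * c₀) -
      AddMonoidAlgebra.single e₁ ((a : ℂ) ^ 2 * c₁)) (ha : a = 0) : b = 0 := by
  subst ha
  by_contra hb
  apply hQ
  refine isUnit_of_dvd_unit ?_ (isUnit_single e₀ (c := (b : ℂ) ^ 2 * c₀) ?_)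
  · simpa using h
  · exact mul_ne_zero (pow_ne_zero _ (by exact_mod_cast hb)) h₀

theorem width_binomial_le {d : ℕ} (v : (Fin d → ℤ) →+ ℤ) {e₀ e₁ : Fin d → ℤ} {c₀ c₁ : ℂ}
    (h : (AddMonoidAlgebra.single e₀ c₀ - AddMonoidAlgebra.single e₁ c₁ : Laurent d) ≠ 0) :
    width v (AddMonoidAlgebra.single e₀ c₀ - AddMonoidAlgebra.single e₁ c₁) ≤ |v e₀ - v e₁| := by
  have key : ∀ a, (AddMonoidAlgebra.single e₀ c₀ - AddMonoidAlgebra.single e₁ c₁ :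
      Laurent d).coeff a ≠ 0 → a = e₀ ∨ a = e₁ := fun a ha => by
    rw [AddMonoidAlgebra.coeff_sub, Finsupp.sub_apply, AddMonoidAlgebra.coeff_single,
      AddMonoidAlgebra.coeff_single, Finsupp.single_apply, Finsupp.single_apply] at ha
    by_contra! hne
    rw [if_neg (Ne.symm hne.1), if_neg (Ne.symm hne.2), sub_zero] at ha
    exact ha rfl
  obtain ⟨a, b, ha, hb, hw⟩ := exists_width v h
  rw [hw]
  rcases key a ha with rfl | rfl <;> rcases key b hb with rfl | rfl
  · simp
  · exact le_abs_self _
  · exact (le_abs_self _).trans_eq (abs_sub_comm _ _)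
  · simp

theorem binomial_ne_zero {d : ℕ} {e₀ e₁ : Fin d → ℤ} {c₀ c₁ : ℂ} (h₀ : c₀ ≠ 0) (he : e₀ ≠ e₁) :
    (AddMonoidAlgebra.single e₀ c₀ - AddMonoidAlgebra.single e₁ c₁ : Laurent d) ≠ 0 := by
  intro h
  have := congrArg (fun f => f.coeff e₀) h
  simp only [AddMonoidAlgebra.coeff_sub, Finsupp.sub_apply, AddMonoidAlgebra.coeff_single,
    Finsupp.single_apply, if_pos, if_neg he.symm, sub_zero] at this
  exact h₀ this

/-- The extreme terms of B do not cancel, so its width is at least twice the total gap. Since Q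
divides binomials in consecutive monomials, its width is at most each of the two gaps, hence Q²
takes up at most the total gap and D must account for the rest. -/
theorem sub_le_width_of_sq_dvd {d : ℕ} (v : (Fin d → ℤ) →+ ℤ) {e₀ e₁ e₂ : Fin d → ℤ}
    {c₀ c₁ c₂ : ℂ} (h₀ : c₀ ≠ 0) (h₁ : c₁ ≠ 0) (h₂ : c₂ ≠ 0) {Q D : Laurent d}
    (h : bFun (AddMonoidAlgebra.single e₀ c₀) (AddMonoidAlgebra.single e₁ c₁)
      (AddMonoidAlgebra.single e₂ c₂) = Q ^ 2 * D) (h01 : v e₀ < v e₁) (h12 : v e₁ < v e₂) :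
    v e₂ - v e₀ ≤ width v D := by
  have hne : ∀ {a b : Fin d → ℤ}, v a < v b → a ≠ b := fun h h' => by simp [h'] at h
  have hc0 : (Q ^ 2 * D).coeff (e₀ + e₀) ≠ 0 := by
    rw [← h, coeff_bFun, if_pos rfl, if_neg, if_neg, if_neg, if_neg, if_neg]
    · simpa using h₀
    all_goals
      refine (hne ?_).symm
      simp only [map_add]
      linarith
  have hc2 : (Q ^ 2 * D).coeff (e₂ + e₂) ≠ 0 := by
    rw [← h, coeff_bFun, if_neg, if_neg, if_pos rfl, if_neg, if_neg, if_neg]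
    · simpa using h₂
    all_goals
      refine hne ?_
      simp only [map_add]
      linarith
  have hw := sub_le_width v hc2 hc0
  have hB : Q ^ 2 * D ≠ 0 := by
    intro h0
    rw [h0] at hc0
    exact hc0 rfl
  have hQ : Q ≠ 0 := fun h0 => by simp [h0] at hB
  have hD : D ≠ 0 := fun h0 => by simp [h0] at hB
  rw [width_mul v (pow_ne_zero _ hQ) hD, pow_two, width_mul v hQ hQ] at hw
  have hz : ∀ {a b : ℤ}, a ≠ b → ((a - b : ℤ) : ℂ) ^ 2 ≠ 0 := fun hab =>
    pow_ne_zero _ (by exact_mod_cast sub_ne_zero.2 hab)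
  have b1 := dvd_binomial_of_sq_dvd v h₀ h₁ h₂ h
  have n1 := binomial_ne_zero (e₁ := e₁) (c₁ := ((v e₁ - v e₂ : ℤ) : ℂ) ^ 2 * c₁)
    (mul_ne_zero (hz (h01.trans h12).ne') h₀) (hne h01)
  have w1 := (width_le_of_dvd v n1 b1).trans (width_binomial_le v n1)
  have b2 := dvd_binomial_of_sq_dvd v h₁ h₂ h₀ ((bFun_rotate _ _ _).symm.trans h)
  have n2 := binomial_ne_zero (e₁ := e₂) (c₁ := ((v e₂ - v e₀ : ℤ) : ℂ) ^ 2 * c₂)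
    (mul_ne_zero (hz h01.ne) h₁) (hne h12)
  have w2 := (width_le_of_dvd v n2 b2).trans (width_binomial_le v n2)
  rw [abs_sub_comm, abs_of_pos (by linarith)] at w1 w2
  simp only [map_add] at hw
  linarith

/-- In each of the three binomials, the vanishing of one degree difference forces that of another,
and the implications run in a cycle. -/
theorem eq_or_distinct_of_sq_dvd {d : ℕ} (v : (Fin d → ℤ) →+ ℤ) {e₀ e₁ e₂ : Fin d → ℤ}
    {c₀ c₁ c₂ : ℂ} (h₀ : c₀ ≠ 0) (h₁ : c₁ ≠ 0) (h₂ : c₂ ≠ 0) {Q D : Laurent d}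
    (hQ : ¬ IsUnit Q)
    (h : bFun (AddMonoidAlgebra.single e₀ c₀) (AddMonoidAlgebra.single e₁ c₁)
      (AddMonoidAlgebra.single e₂ c₂) = Q ^ 2 * D) :
    (v e₀ = v e₁ ∧ v e₁ = v e₂) ∨ (v e₀ ≠ v e₁ ∧ v e₁ ≠ v e₂ ∧ v e₂ ≠ v e₀) := by
  have t1 := eq_zero_of_dvd_binomial h₀ hQ (dvd_binomial_of_sq_dvd v h₀ h₁ h₂ h)
  have h' := (bFun_rotate _ _ _).symm.trans h
  have t2 := eq_zero_of_dvd_binomial h₁ hQ (dvd_binomial_of_sq_dvd v h₁ h₂ h₀ h')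
  have t3 := eq_zero_of_dvd_binomial h₂ hQ
    (dvd_binomial_of_sq_dvd v h₂ h₀ h₁ ((bFun_rotate _ _ _).symm.trans h'))
  simp only [sub_eq_zero] at t1 t2 t3
  by_cases c0 : v e₀ = v e₁
  · exact Or.inl ⟨c0, t3 c0⟩
  · refine Or.inr ⟨c0, fun c1 => c0 (t2 (t1 c1)), fun c2 => c0 (t2 c2)⟩

theorem abs_sub_le_width_of_sq_dvd {d : ℕ} (v : (Fin d → ℤ) →+ ℤ) {e₀ e₁ e₂ : Fin d → ℤ}
    {c₀ c₁ c₂ : ℂ} (h₀ : c₀ ≠ 0) (h₁ : c₁ ≠ 0) (h₂ : c₂ ≠ 0) {Q D : Laurent d}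
    (hQ : ¬ IsUnit Q) (hD : D ≠ 0)
    (h : bFun (AddMonoidAlgebra.single e₀ c₀) (AddMonoidAlgebra.single e₁ c₁)
      (AddMonoidAlgebra.single e₂ c₂) = Q ^ 2 * D) :
    |v e₁ - v e₀| ≤ width v D ∧ |v e₂ - v e₀| ≤ width v D := by
  have hsub : ∀ {e₀ e₁ e₂ : Fin d → ℤ} {c₀ c₁ c₂ : ℂ}, c₀ ≠ 0 → c₁ ≠ 0 → c₂ ≠ 0 →
      bFun (AddMonoidAlgebra.single e₀ c₀) (AddMonoidAlgebra.single e₁ c₁)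
      (AddMonoidAlgebra.single e₂ c₂) = Q ^ 2 * D → v e₀ < v e₁ → v e₁ < v e₂ →
      v e₂ - v e₀ ≤ width v D := fun h₀ h₁ h₂ h => sub_le_width_of_sq_dvd v h₀ h₁ h₂ h
  rcases eq_or_distinct_of_sq_dvd v h₀ h₁ h₂ hQ h with ⟨h01, h12⟩ | ⟨h01, h12, h20⟩
  · simpa [h01, h12] using width_nonneg v hD
  have g := (bFun_swap _ _ _).symm.trans h
  have h' := (bFun_rotate _ _ _).symm.trans h
  have g' := (bFun_rotate _ _ _).symm.trans g
  have h'' := (bFun_rotate _ _ _).symm.trans h'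
  have g'' := (bFun_rotate _ _ _).symm.trans g'
  have p1 := hsub h₀ h₁ h₂ h
  have p2 := hsub h₁ h₂ h₀ h'
  have p3 := hsub h₂ h₀ h₁ h''
  have p4 := hsub h₀ h₂ h₁ g
  have p5 := hsub h₂ h₁ h₀ g'
  have p6 := hsub h₁ h₀ h₂ g''
  rw [abs_le, abs_le]
  omega

/-- Clearing negative exponents turns the condition into a polynomial equation in r. Once q is made
positive, the polynomial does not vanish at 0, because μ ≠ 0. -/
theorem finite_setOf_zpow_eq {k : Type*} [Field k] {μ : k} (hμ : μ ≠ 0) (p : ℤ) {q : ℤ}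
    (hq : q ≠ 0) : {r : k | r ≠ 0 ∧ 1 - r ≠ 0 ∧ (r ^ 2) ^ q = μ * ((1 - r) ^ 2) ^ p}.Finite := by
  classical
  have pos : ∀ {μ : k} (p : ℤ) {q : ℤ}, μ ≠ 0 → 0 < q →
      {r : k | r ≠ 0 ∧ 1 - r ≠ 0 ∧ (r ^ 2) ^ q = μ * ((1 - r) ^ 2) ^ p}.Finite := by
    intro μ p q hμ hq
    obtain ⟨q, rfl⟩ := Int.eq_ofNat_of_zero_le hq.le
    have hq0 : q ≠ 0 := by rintro rfl; simp at hq
    rcases Int.eq_nat_or_neg p with ⟨p, rfl | rfl⟩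
    · let P : Polynomial k := (Polynomial.X ^ 2) ^ q -
        Polynomial.C μ * ((1 - Polynomial.X) ^ 2) ^ p
      have hP : P ≠ 0 := fun h => hμ (by
        have := congrArg (Polynomial.eval 0) h
        simpa [P, hq0] using this)
      refine (P.roots.toFinset.finite_toSet).subset fun r hr => ?_
      obtain ⟨-, -, h⟩ := hr
      rw [zpow_natCast, zpow_natCast] at h
      simp [hP, P, h]
    · let P : Polynomial k := (Polynomial.X ^ 2) ^ q * ((1 - Polynomial.X) ^ 2) ^ p -
        Polynomial.C μ
      have hP : P ≠ 0 := fun h => hμ (by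
        have := congrArg (Polynomial.eval 0) h
        simpa [P, hq0] using this)
      refine (P.roots.toFinset.finite_toSet).subset fun r hr => ?_
      obtain ⟨-, h1, h⟩ := hr
      rw [zpow_natCast, zpow_neg, zpow_natCast] at h
      have h1' : ((1 - r) ^ 2) ^ p ≠ 0 := pow_ne_zero _ (pow_ne_zero _ h1)
      simp [hP, P, h, inv_mul_cancel_right₀ h1']
  rcases lt_or_gt_of_ne hq with h | h
  · refine (pos (-p) (inv_ne_zero hμ) (neg_pos.2 h)).subset fun r hr => ?_
    obtain ⟨h0, h1, h2⟩ := hr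
    refine ⟨h0, h1, ?_⟩
    rw [zpow_neg, zpow_neg, h2, mul_inv]
  · exact pos p hμ h

/-- On squares a², b² the discriminant splits into the four factors 1 ± a ± b; the sign of a is then
absorbed into r. -/
theorem exists_eq_sq_of_bFun_eq_zero {k : Type*} [Field k] [IsAlgClosed k] {x y : k}
    (h : bFun 1 x y = 0) : ∃ r : k, x = r ^ 2 ∧ y = (1 - r) ^ 2 := by
  obtain ⟨a, ha⟩ := IsAlgClosed.exists_pow_nat_eq x (n := 2) (by norm_num)
  obtain ⟨b, hb⟩ := IsAlgClosed.exists_pow_nat_eq y (n := 2) (by norm_num)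
  subst ha hb
  have : (1 - a - b) * (1 - a + b) * ((1 + a - b) * (1 + a + b)) = 0 := by
    rw [← h]; unfold bFun; ring
  rcases mul_eq_zero.1 this with h | h <;> rcases mul_eq_zero.1 h with h | h
  · exact ⟨a, rfl, by rw [show 1 - a = b by linear_combination h]⟩
  · exact ⟨a, rfl, by rw [show 1 - a = -b by linear_combination h]; ring⟩
  · exact ⟨-a, by ring, by rw [show 1 - -a = b by linear_combination h]⟩
  · exact ⟨-a, by ring, by rw [show 1 - -a = -b by linear_combination h]; ring⟩

theorem map_single_zsmul {d : ℕ} {k : Type*} [Field k] (φ : Laurent d →+* k) (f : Fin d → ℤ)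
    (m : ℤ) : φ (AddMonoidAlgebra.single (m • f) 1) = φ (AddMonoidAlgebra.single f 1) ^ m := by
  let g : Multiplicative (Fin d → ℤ) →* k :=
    (φ : Laurent d →* k).comp (AddMonoidAlgebra.of ℂ (Fin d → ℤ))
  have hg : ∀ x, g x⁻¹ = (g x)⁻¹ := fun x => by
    refine eq_inv_of_mul_eq_one_left ?_
    rw [← map_mul, inv_mul_cancel, map_one]
  exact map_zpow' g hg (Multiplicative.ofAdd f) m

theorem map_single_eq_mul {d : ℕ} {k : Type*} [Field k] (φ : Laurent d →+* k) (f : Fin d → ℤ)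
    (c : ℂ) : φ (AddMonoidAlgebra.single f c) =
      φ (AddMonoidAlgebra.single 0 c) * φ (AddMonoidAlgebra.single f 1) := by
  rw [← map_mul, single_mul_single', zero_add, mul_one]

/-- The constants of the Laurent polynomial ring in a field. -/
noncomputable def constHom {d : ℕ} {k : Type*} [Field k] (φ : Laurent d →+* k) : ℂ →+* k :=
  φ.comp AddMonoidAlgebra.singleZeroRingHom

theorem constHom_apply {d : ℕ} {k : Type*} [Field k] (φ : Laurent d →+* k) (c : ℂ) :
    constHom φ c = φ (AddMonoidAlgebra.single 0 c) := rfl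

/-- In a residue field where Q vanishes, the binomials determine c₁t^f₁ and c₂t^f₂ as explicit
rationals. Collinearity of the exponents makes a power of t^f₁ equal a power of t^f₂, so the
monomials can be eliminated. The constants embed in the residue field, which brings the relation
back to ℂ. -/
theorem zpow_eq_of_sq_dvd {d : ℕ} (v : (Fin d → ℤ) →+ ℤ) {f₁ f₂ : Fin d → ℤ} {c₁ c₂ : ℂ}
    (h₁ : c₁ ≠ 0) (h₂ : c₂ ≠ 0) {Q D : Laurent d} (hQ : ¬ IsUnit Q)
    (h : bFun 1 (AddMonoidAlgebra.single f₁ c₁) (AddMonoidAlgebra.single f₂ c₂) = Q ^ 2 * D)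
    (hp : v f₁ ≠ 0) (hq : v f₂ ≠ 0) (hpq : v f₁ ≠ v f₂) (hcol : v f₂ • f₁ = v f₁ • f₂) :
    c₁ ^ v f₂ = (((v f₂ : ℂ) ^ 2 / ((v f₁ - v f₂ : ℤ) : ℂ) ^ 2) ^ v f₂ /
      (((v f₁ : ℂ)) ^ 2 / ((v f₁ - v f₂ : ℤ) : ℂ) ^ 2) ^ v f₁) * c₂ ^ v f₁ := by
  rw [AddMonoidAlgebra.one_def] at h
  have d1 := dvd_binomial_of_sq_dvd v one_ne_zero h₁ h₂ h
  have d2 := dvd_binomial_of_sq_dvd v h₂ one_ne_zero h₁ ((bFun_rotate _ _ _).trans h)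
  obtain ⟨m, hm, hQm⟩ := exists_max_ideal_of_mem_nonunits (mem_nonunits_iff.2 hQ)
  let _ := Ideal.Quotient.field m
  let φ : Laurent d →+* (Laurent d ⧸ m) := Ideal.Quotient.mk m
  have hφ : ∀ {x y}, Q ∣ x - y → φ x = φ y := fun {x y} hd => by
    rw [Ideal.Quotient.eq]
    exact Ideal.mem_of_dvd m hd hQm
  have e1 := hφ d1
  have e2 := hφ d2
  rw [map_single_eq_mul φ f₁, ← constHom_apply, ← constHom_apply, mul_one, map_zero, sub_zero]
    at e1
  rw [map_single_eq_mul φ f₂, ← constHom_apply, ← constHom_apply, mul_one, map_zero, zero_sub]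
    at e2
  have ht := congrArg (fun e => φ (AddMonoidAlgebra.single e 1)) hcol
  simp only [map_single_zsmul] at ht
  generalize φ (AddMonoidAlgebra.single f₁ 1) = t₁ at *
  generalize φ (AddMonoidAlgebra.single f₂ 1) = t₂ at *
  generalize v f₁ = p at *
  generalize v f₂ = q at *
  have hA : ((p - q : ℤ) : ℂ) ^ 2 ≠ 0 := pow_ne_zero _ (by exact_mod_cast sub_ne_zero.2 hpq)
  generalize ((p - q : ℤ) : ℂ) ^ 2 = A at *
  have hB : (q : ℂ) ^ 2 ≠ 0 := pow_ne_zero _ (by exact_mod_cast hq)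
  have hC : (p : ℂ) ^ 2 ≠ 0 := pow_ne_zero _ (by exact_mod_cast hp)
  rw [show ((-p : ℤ) : ℂ) ^ 2 = (p : ℂ) ^ 2 by push_cast; ring] at e2
  generalize (q : ℂ) ^ 2 = B at *
  generalize (p : ℂ) ^ 2 = C at *
  generalize constHom φ = g at *
  have g0 : ∀ {z : ℂ}, z ≠ 0 → g z ≠ 0 := fun hz => (map_ne_zero g).2 hz
  have ht1 : t₁ ≠ 0 := by
    rintro rfl
    rw [mul_zero] at e1
    exact g0 hB e1
  have ht2 : t₂ ≠ 0 := by
    rintro rfl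
    rw [mul_zero] at e2
    exact g0 hC e2.symm
  apply g.injective
  have k1 : g c₁ = g (B / A) / t₁ := by
    rw [map_div₀]
    rw [map_mul] at e1
    field_simp [g0 hA]
    linear_combination -e1
  have k2 : g c₂ = g (C / A) / t₂ := by
    rw [map_div₀]
    rw [map_mul] at e2
    field_simp [g0 hA]
    linear_combination e2
  rw [map_zpow₀, map_mul, map_zpow₀, k1, k2, map_div₀ g (_ ^ q), map_zpow₀, map_zpow₀,
    div_zpow _ t₁, div_zpow _ t₂, ht]
  have := zpow_ne_zero p (g0 (div_ne_zero hC hA))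
  have := zpow_ne_zero p ht2
  field_simp

/-- A single solution already forces the exponents onto a line and D to be a non-unit. At a point
where D vanishes, every solution is parametrized by some r with c₁t^f₁ = r² and c₂t^f₂ = (1 - r)²;
the relation coming from Q then restricts r to a finite set. -/
theorem finite_coeffs_of_not_isUnit {d : ℕ} {D : Laurent d} (hD : D ≠ 0)
    (hns : ∀ x y : Laurent d, y ≠ 0 → y ^ 2 * D ≠ x ^ 2) (f₁ f₂ : Fin d → ℤ) :
    {c : ℂ × ℂ | c.1 ≠ 0 ∧ c.2 ≠ 0 ∧ ∃ Q : Laurent d, ¬ IsUnit Q ∧ Q ≠ 0 ∧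
      bFun 1 (AddMonoidAlgebra.single f₁ c.1) (AddMonoidAlgebra.single f₂ c.2) =
        Q ^ 2 * D}.Finite := by
  set S := {c : ℂ × ℂ | c.1 ≠ 0 ∧ c.2 ≠ 0 ∧ ∃ Q : Laurent d, ¬ IsUnit Q ∧ Q ≠ 0 ∧
      bFun 1 (AddMonoidAlgebra.single f₁ c.1) (AddMonoidAlgebra.single f₂ c.2) = Q ^ 2 * D}
    with hS
  rcases S.eq_empty_or_nonempty with he | ⟨⟨a₁, a₂⟩, ha₁, ha₂, P, hP, hP0, hPD⟩
  · rw [he]; exact Set.finite_empty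
  dsimp only at ha₁ ha₂ hPD
  rw [AddMonoidAlgebra.one_def] at hPD
  have hdich := fun v => eq_or_distinct_of_sq_dvd v one_ne_zero ha₁ ha₂ hP hPD
  obtain ⟨l, hl⟩ : ∃ l, f₁ l ≠ 0 := by
    -- Otherwise all exponents vanish and the discriminant is a complex constant, hence a square.
    by_contra! hf
    have hf1 : f₁ = 0 := funext hf
    have hf2 : f₂ = 0 := by
      funext l
      have := hdich (Pi.evalAddMonoidHom (fun _ : Fin d => ℤ) l)
      simp only [Pi.evalAddMonoidHom_apply, Pi.zero_apply, hf] at this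
      simpa using this.elim (fun h => h.2.symm) (fun h => absurd rfl h.1)
    obtain ⟨z, hz⟩ := IsAlgClosed.exists_pow_nat_eq (bFun 1 a₁ a₂) (n := 2) (by norm_num)
    refine hns (AddMonoidAlgebra.single 0 z) P hP0 ?_
    rw [← hPD, hf1, hf2]
    change bFun (AddMonoidAlgebra.singleZeroRingHom 1) (AddMonoidAlgebra.singleZeroRingHom a₁)
      (AddMonoidAlgebra.singleZeroRingHom a₂) = (AddMonoidAlgebra.singleZeroRingHom z) ^ 2
    rw [← map_pow, hz]
    simp only [bFun, map_sub, map_mul, map_pow, map_one, map_ofNat]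
  let v := Pi.evalAddMonoidHom (fun _ : Fin d => ℤ) l
  have hp : v f₁ ≠ 0 := hl
  obtain ⟨hpq, hq⟩ : v f₁ ≠ v f₂ ∧ v f₂ ≠ 0 := by
    rcases hdich v with h | h
    · exact absurd (h.1.symm.trans (map_zero v)) hp
    · exact ⟨h.2.1, by simpa using h.2.2⟩
  have hcol : v f₂ • f₁ = v f₁ • f₂ := by
    funext l'
    -- This direction kills f₁, so by the dichotomy it kills f₂ too, which is the l'-th coordinate
    -- of collinearity.
    have := hdich (v f₁ • Pi.evalAddMonoidHom (fun _ : Fin d => ℤ) l' - f₁ l' • v)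
    simp only [AddMonoidHom.sub_apply, AddMonoidHom.smul_apply, Pi.evalAddMonoidHom_apply,
      smul_eq_mul, map_zero, Pi.smul_apply] at this ⊢
    rw [mul_comm (f₁ l'), sub_self] at this
    have h2 := this.elim (fun h => h.2) (fun h => absurd (by simp) h.1)
    linarith
  have hDu : ¬ IsUnit D := fun hu => by
    have := (abs_sub_le_width_of_sq_dvd v one_ne_zero ha₁ ha₂ hP hD hPD).1
    rw [width_of_isUnit v hu, map_zero, sub_zero] at this
    exact hp (abs_nonpos_iff.1 this)
  obtain ⟨m, hm, hDm⟩ := exists_max_ideal_of_mem_nonunits (mem_nonunits_iff.2 hDu)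
  let _ := Ideal.Quotient.field m
  let ψ : Laurent d →+* AlgebraicClosure (Laurent d ⧸ m) :=
    (algebraMap (Laurent d ⧸ m) _).comp (Ideal.Quotient.mk m)
  have hψ : ψ D = 0 := by
    change algebraMap (Laurent d ⧸ m) _ (Ideal.Quotient.mk m D) = 0
    rw [Ideal.Quotient.eq_zero_iff_mem.2 hDm, map_zero]
  have hψ0 : ∀ (f : Fin d → ℤ) {c : ℂ}, c ≠ 0 → ψ (AddMonoidAlgebra.single f c) ≠ 0 :=
    fun f c hc => ((isUnit_single f hc).map ψ).ne_zero
  set μ : ℂ := ((v f₂ : ℂ) ^ 2 / ((v f₁ - v f₂ : ℤ) : ℂ) ^ 2) ^ v f₂ /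
      (((v f₁ : ℂ)) ^ 2 / ((v f₁ - v f₂ : ℤ) : ℂ) ^ 2) ^ v f₁ with hμ
  have hμ0 : μ ≠ 0 := by
    have hA : ((v f₁ - v f₂ : ℤ) : ℂ) ≠ 0 := by exact_mod_cast sub_ne_zero.2 hpq
    have hB : (v f₁ : ℂ) ≠ 0 := by exact_mod_cast hp
    have hC : (v f₂ : ℂ) ≠ 0 := by exact_mod_cast hq
    exact div_ne_zero (zpow_ne_zero _ (div_ne_zero (pow_ne_zero _ hC) (pow_ne_zero _ hA)))
      (zpow_ne_zero _ (div_ne_zero (pow_ne_zero _ hB) (pow_ne_zero _ hA)))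
  have hfin := finite_setOf_zpow_eq ((map_ne_zero (constHom ψ)).2 hμ0) (v f₁) hq
  refine ((hfin.image fun r => (r ^ 2 / ψ (AddMonoidAlgebra.single f₁ 1),
    (1 - r) ^ 2 / ψ (AddMonoidAlgebra.single f₂ 1))).preimage
    (f := fun c : ℂ × ℂ => (constHom ψ c.1, constHom ψ c.2)) ?_).subset ?_
  · intro x _ y _ hxy
    simp only [Prod.mk.injEq] at hxy
    exact Prod.ext ((constHom ψ).injective hxy.1) ((constHom ψ).injective hxy.2)
  rintro ⟨c₁, c₂⟩ ⟨hc₁, hc₂, Q, hQ, hQ0, hQD⟩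
  dsimp only at hc₁ hc₂ hQD
  have hz := zpow_eq_of_sq_dvd v hc₁ hc₂ hQ hQD hp hq hpq hcol
  rw [← hμ] at hz
  have hB : bFun 1 (ψ (AddMonoidAlgebra.single f₁ c₁)) (ψ (AddMonoidAlgebra.single f₂ c₂)) = 0 := by
    have := congrArg ψ hQD
    rw [map_mul, hψ, mul_zero] at this
    simpa only [bFun, map_sub, map_mul, map_pow, map_one, map_ofNat] using this
  obtain ⟨r, hr1, hr2⟩ := exists_eq_sq_of_bFun_eq_zero hB
  refine ⟨r, ⟨?_, ?_, ?_⟩, ?_⟩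
  · rintro rfl
    exact hψ0 f₁ hc₁ (by simpa using hr1)
  · intro h
    rw [h] at hr2
    exact hψ0 f₂ hc₂ (by simpa using hr2)
  · have ht := congrArg (fun e => ψ (AddMonoidAlgebra.single e 1)) hcol
    simp only [map_single_zsmul] at ht
    rw [← hr1, ← hr2, map_single_eq_mul, map_single_eq_mul ψ f₂, mul_zpow, mul_zpow, ht,
      ← constHom_apply, ← constHom_apply, ← map_zpow₀ (constHom ψ),
      ← map_zpow₀ (constHom ψ), hz, map_mul, mul_assoc]
  · dsimp only
    rw [← hr1, ← hr2, map_single_eq_mul, map_single_eq_mul ψ f₂,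
      mul_div_cancel_right₀ _ (hψ0 f₁ one_ne_zero), mul_div_cancel_right₀ _ (hψ0 f₂ one_ne_zero)]
    rfl

/-! ### Triples whose discriminant is associated to a given Laurent polynomial -/

/-- The differences of exponents of `D`, and their halves. -/
def exponentDiffs {d : ℕ} (D : Laurent d) : Set (Fin d → ℤ) :=
  {f | ∃ a b, D.coeff a ≠ 0 ∧ D.coeff b ≠ 0 ∧ (f = a - b ∨ f + f = a - b)}

/-- The ratios of coefficients of `D`. -/
def coeffRatios {d : ℕ} (D : Laurent d) : Set ℂ :=
  {z | ∃ a b, z = D.coeff a / D.coeff b}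

/-- The possible ratios of the coefficients of the monomials in a triple with discriminant `D`. -/
def monomialRatios {d : ℕ} (D : Laurent d) : Set ℂ :=
  {x | ∃ s ∈ coeffRatios D, ∃ t ∈ coeffRatios D,
    x = -s / 2 ∨ x⁻¹ = -s / 2 ∨ (2 * x + s / 2) ^ 2 = t}

theorem finite_exponentDiffs {d : ℕ} (D : Laurent d) : (exponentDiffs D).Finite := by
  have hT : ((fun p : (Fin d → ℤ) × (Fin d → ℤ) => p.1 - p.2) ''
      ((D.coeff.support : Set (Fin d → ℤ)) ×ˢ (D.coeff.support : Set (Fin d → ℤ)))).Finite :=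
    ((Finset.finite_toSet _).prod (Finset.finite_toSet _)).image _
  refine (hT.union (hT.preimage (f := fun f => f + f) ?_)).subset ?_
  · intro x _ y _ h
    funext l
    have := congrFun h l
    simp only [Pi.add_apply] at this
    omega
  · rintro f ⟨a, b, ha, hb, h⟩
    have : (a, b) ∈ (D.coeff.support : Set (Fin d → ℤ)) ×ˢ (D.coeff.support : Set (Fin d → ℤ)) :=
      ⟨Finsupp.mem_support_iff.2 ha, Finsupp.mem_support_iff.2 hb⟩
    rcases h with h | h
    · exact Or.inl ⟨(a, b), this, h.symm⟩
    · exact Or.inr ⟨(a, b), this, h.symm⟩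

theorem finite_coeffRatios {d : ℕ} (D : Laurent d) : (coeffRatios D).Finite := by
  have hr : (Set.range D.coeff).Finite := by
    refine ((D.coeff.support.finite_toSet.image D.coeff).union (Set.finite_singleton 0)).subset ?_
    rintro _ ⟨a, rfl⟩
    by_cases h : D.coeff a = 0
    · exact Or.inr h
    · exact Or.inl ⟨a, Finsupp.mem_support_iff.2 h, rfl⟩
  refine ((hr.prod hr).image fun p => p.1 / p.2).subset ?_
  rintro _ ⟨a, b, rfl⟩
  exact ⟨(_, _), ⟨⟨a, rfl⟩, ⟨b, rfl⟩⟩, rfl⟩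

theorem finite_monomialRatios {d : ℕ} (D : Laurent d) : (monomialRatios D).Finite := by
  have : monomialRatios D = ⋃ s ∈ coeffRatios D, ⋃ t ∈ coeffRatios D,
      {x | x = -s / 2 ∨ x⁻¹ = -s / 2 ∨ (2 * x + s / 2) ^ 2 = t} := by
    ext x; simp [monomialRatios]
  rw [this]
  refine (finite_coeffRatios D).biUnion fun s _ => (finite_coeffRatios D).biUnion fun t _ => ?_
  obtain ⟨z, rfl⟩ := IsAlgClosed.exists_pow_nat_eq t (n := 2) (by norm_num)
  refine (Set.toFinite ({-s / 2, (-s / 2)⁻¹, (z - s / 2) / 2, (-z - s / 2) / 2} : Set ℂ)).subset ?_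
  rintro x (h | h | h)
  · simp [h]
  · simp [← h]
  · rcases sq_eq_sq_iff_eq_or_eq_neg.1 h with h | h
    · right; right; left; linear_combination h / 2
    · right; right; right; change x = _; linear_combination h / 2

/-- The monomial `c' t ^ e'` divided by `c t ^ e` is one of finitely many that `D` determines. -/
def MonomialRel {d : ℕ} (D : Laurent d) (e e' : Fin d → ℤ) (c c' : ℂ) : Prop :=
  e' - e ∈ exponentDiffs D ∧ c' / c ∈ monomialRatios D

theorem mem_exponentDiffs {d : ℕ} {D : Laurent d} {f : Fin d → ℤ} {s s' : Fin d → ℤ}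
    (h : D.coeff s ≠ 0) (h' : D.coeff s' ≠ 0) (hf : f = s - s' ∨ f + f = s - s') :
    f ∈ exponentDiffs D := ⟨s, s', h, h', hf⟩

theorem coeff_mul_of_isUnit {d : ℕ} {D U : Laurent d} (hU : IsUnit U) :
    ∃ m, ∃ c : ℂ, c ≠ 0 ∧ ∀ s, (U * D).coeff s = c * D.coeff (s - m) := by
  obtain ⟨m, c, hc, rfl⟩ := exists_eq_single_of_isUnit hU
  refine ⟨m, c, hc, fun s => ?_⟩
  rw [AddMonoidAlgebra.coeff_single_mul_apply, neg_add_eq_sub]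

section

variable {d : ℕ} {D U : Laurent d} {e₀ e₁ e₂ : Fin d → ℤ} {c₀ c₁ c₂ : ℂ}

/-- Under these conditions the terms c₀² and -2c₀c₁ of the discriminant meet no other term, so their
ratio and the difference of their exponents can be read off D. -/
theorem monomialRel_of_ne (h₀ : c₀ ≠ 0) (h₁ : c₁ ≠ 0) (hU : IsUnit U)
    (h : bFun (AddMonoidAlgebra.single e₀ c₀) (AddMonoidAlgebra.single e₁ c₁)
      (AddMonoidAlgebra.single e₂ c₂) = U * D)
    (h01 : e₀ ≠ e₁) (h02 : e₀ ≠ e₂) (h12 : e₁ ≠ e₂) (m₀ : e₁ + e₂ ≠ e₀ + e₀)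
    (m₂ : e₂ + e₂ ≠ e₀ + e₁) :
    MonomialRel D e₀ e₁ c₀ c₁ ∧ MonomialRel D e₁ e₀ c₁ c₀ := by
  obtain ⟨m, c, hc, hUD⟩ := coeff_mul_of_isUnit (D := D) hU
  rw [← h] at hUD
  have inj : ∀ {x y : Fin d → ℤ}, x ≠ y → x + x ≠ y + y := fun {x y} hxy hh => hxy (by
    funext l
    have := congrFun hh l
    simp only [Pi.add_apply] at this
    omega)
  have b1 := hUD (e₀ + e₀)
  rw [coeff_bFun, if_pos rfl, if_neg (inj h01.symm), if_neg (inj h02.symm),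
    if_neg (by simpa using h01.symm), if_neg (by simpa using h02.symm), if_neg m₀] at b1
  have b2 := hUD (e₀ + e₁)
  rw [coeff_bFun, if_neg (by simpa using h01), if_neg (by simpa using h01.symm), if_neg m₂,
    if_pos rfl, if_neg (by simpa using h12.symm),
    if_neg (by rw [add_comm e₀ e₁]; simpa using h02.symm)] at b2
  simp only [add_zero, zero_add] at b1 b2
  have n1 : D.coeff (e₀ + e₀ - m) ≠ 0 := fun h0 => by simp [h0, h₀] at b1
  have n2 : D.coeff (e₀ + e₁ - m) ≠ 0 := fun h0 => by simp [h0, h₀, h₁] at b2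
  have hs : D.coeff (e₀ + e₁ - m) / D.coeff (e₀ + e₀ - m) = -2 * c₁ / c₀ := by
    rw [div_eq_div_iff n1 h₀]
    apply mul_left_cancel₀ hc
    linear_combination -c₀ * b2 - 2 * c₁ * b1
  refine ⟨⟨mem_exponentDiffs n2 n1 (Or.inl (by abel)), _, ⟨_, _, hs.symm⟩, _, ⟨0, 0, rfl⟩,
    Or.inl ?_⟩, ⟨mem_exponentDiffs n1 n2 (Or.inl (by abel)), _, ⟨_, _, hs.symm⟩, _,
    ⟨0, 0, rfl⟩, Or.inr (Or.inl ?_)⟩⟩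
  · field_simp
  · field_simp

/-- With two equal exponents, the surviving coefficients are (c₀ - c₁)², -2(c₀ + c₁)c₂ and c₂². They
give the sum of c₀/c₂ and c₁/c₂ and the square of their difference, hence both ratios up to a choice
of root. -/
theorem monomialRel_of_eq (h₀ : c₀ ≠ 0) (h₂ : c₂ ≠ 0) (hU : IsUnit U)
    (h : bFun (AddMonoidAlgebra.single e₀ c₀) (AddMonoidAlgebra.single e₁ c₁)
      (AddMonoidAlgebra.single e₂ c₂) = U * D) (h01 : e₀ = e₁) (h02 : e₀ ≠ e₂) :
    MonomialRel D e₂ e₀ c₂ c₀ ∧ MonomialRel D e₂ e₁ c₂ c₁ := by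
  subst h01
  obtain ⟨m, c, hc, hUD⟩ := coeff_mul_of_isUnit (D := D) hU
  rw [← h] at hUD
  have inj : ∀ {x y : Fin d → ℤ}, x ≠ y → x + x ≠ y + y := fun {x y} hxy hh => hxy (by
    funext l
    have := congrFun hh l
    simp only [Pi.add_apply] at this
    omega)
  have b1 := hUD (e₂ + e₂)
  rw [coeff_bFun, if_neg (inj h02), if_neg (inj h02), if_pos rfl, if_neg (inj h02),
    if_neg (by simpa using h02), if_neg (by simpa using h02)] at b1
  have b2 := hUD (e₀ + e₂)
  rw [coeff_bFun, if_neg (by simpa using h02), if_neg (by simpa using h02),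
    if_neg (by simpa using h02.symm), if_neg (by simpa using h02), if_pos rfl, if_pos rfl] at b2
  have b3 := hUD (e₀ + e₀)
  rw [coeff_bFun, if_pos rfl, if_pos rfl, if_neg (inj h02.symm), if_pos rfl,
    if_neg (by simpa using h02.symm), if_neg (by simpa using h02.symm)] at b3
  simp only [add_zero, zero_add] at b1 b2 b3
  have n1 : D.coeff (e₂ + e₂ - m) ≠ 0 := fun h0 => by simp [h0, h₂] at b1
  have hs : D.coeff (e₀ + e₂ - m) / D.coeff (e₂ + e₂ - m) = -2 * (c₀ + c₁) / c₂ := by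
    rw [div_eq_div_iff n1 h₂]
    apply mul_left_cancel₀ hc
    linear_combination -c₂ * b2 - 2 * (c₀ + c₁) * b1
  have ht : D.coeff (e₀ + e₀ - m) / D.coeff (e₂ + e₂ - m) = (c₀ - c₁) ^ 2 / c₂ ^ 2 := by
    rw [div_eq_div_iff n1 (pow_ne_zero 2 h₂)]
    apply mul_left_cancel₀ hc
    linear_combination -c₂ ^ 2 * b3 + (c₀ - c₁) ^ 2 * b1
  have hd : e₀ - e₂ ∈ exponentDiffs D := by
    -- If c₀ + c₁ = 0 the mixed term cancels and only twice the exponent difference is visible; this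
    -- is why halves are admitted.
    by_cases n2 : D.coeff (e₀ + e₂ - m) = 0
    · refine mem_exponentDiffs (s := e₀ + e₀ - m) (fun n3 => ?_) n1 (Or.inr (by abel))
      rw [n2] at b2
      rw [n3] at b3
      have e1 : c₀ + c₁ = 0 := by
        have : (c₀ + c₁) * c₂ = 0 := by linear_combination -b2 / 2
        exact (mul_eq_zero.1 this).resolve_right h₂
      have : c₀ * c₀ = 0 := by linear_combination b3 / 4 + (3 * c₀ - c₁) / 4 * e1
      exact h₀ (mul_self_eq_zero.1 this)
    · exact mem_exponentDiffs n2 n1 (Or.inl (by abel))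
  refine ⟨⟨hd, _, ⟨_, _, hs.symm⟩, _, ⟨_, _, ht.symm⟩, Or.inr (Or.inr ?_)⟩,
    ⟨hd, _, ⟨_, _, hs.symm⟩, _, ⟨_, _, ht.symm⟩, Or.inr (Or.inr ?_)⟩⟩
  · field_simp
    ring
  · field_simp
    ring

end

theorem add_self_of_add_self {d : ℕ} {x y z : Fin d → ℤ} (h : x + z = y + y)
    (h' : y + z = x + x) : x = y := by
  funext l
  have := congrFun h l
  have := congrFun h' l
  simp only [Pi.add_apply] at *
  omega

/-- If e₀ is the midpoint of the other two exponents, neither of those is a midpoint, so each can be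
compared with e₀ starting from its own square term. -/
theorem monomialRel_of_midpoint {d : ℕ} {D U : Laurent d} {e₀ e₁ e₂ : Fin d → ℤ} {c₀ c₁ c₂ : ℂ}
    (h₀ : c₀ ≠ 0) (h₁ : c₁ ≠ 0) (h₂ : c₂ ≠ 0) (hU : IsUnit U)
    (h : bFun (AddMonoidAlgebra.single e₀ c₀) (AddMonoidAlgebra.single e₁ c₁)
      (AddMonoidAlgebra.single e₂ c₂) = U * D)
    (h01 : e₀ ≠ e₁) (h02 : e₀ ≠ e₂) (h12 : e₁ ≠ e₂) (m₀ : e₁ + e₂ = e₀ + e₀) :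
    MonomialRel D e₀ e₁ c₀ c₁ ∧ MonomialRel D e₀ e₂ c₀ c₂ := by
  have m1 : e₀ + e₂ ≠ e₁ + e₁ := fun m1 => h01 (add_self_of_add_self m1 m₀)
  have m2 : e₀ + e₁ ≠ e₂ + e₂ := fun m2 => h02 (add_self_of_add_self m2 (by rw [add_comm, m₀]))
  have k : bFun (AddMonoidAlgebra.single e₂ c₂) (AddMonoidAlgebra.single e₀ c₀)
      (AddMonoidAlgebra.single e₁ c₁) = U * D := (bFun_rotate _ _ _).trans h
  have k' : bFun (AddMonoidAlgebra.single e₁ c₁) (AddMonoidAlgebra.single e₀ c₀)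
      (AddMonoidAlgebra.single e₂ c₂) = U * D := by rw [bFun_rotate, bFun_swap]; exact h
  exact ⟨(monomialRel_of_ne h₁ h₀ hU k' h01.symm h12 h02 m1 (by rw [add_comm e₁]; exact m2.symm)).2,
    (monomialRel_of_ne h₂ h₀ hU k h02.symm h12.symm h01 m2 (by rw [add_comm e₂]; exact m1.symm)).2⟩

/-- If the discriminant of a triple of monomials, not all with the same exponent, is associated
to `D`, then `D` determines the triple up to a common factor and finitely many choices. -/
theorem exists_monomialRel {d : ℕ} {D U : Laurent d} {e₀ e₁ e₂ : Fin d → ℤ} {c₀ c₁ c₂ : ℂ}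
    (h₀ : c₀ ≠ 0) (h₁ : c₁ ≠ 0) (h₂ : c₂ ≠ 0) (hU : IsUnit U)
    (h : bFun (AddMonoidAlgebra.single e₀ c₀) (AddMonoidAlgebra.single e₁ c₁)
      (AddMonoidAlgebra.single e₂ c₂) = U * D) (hne : ¬ (e₀ = e₁ ∧ e₁ = e₂)) :
    (MonomialRel D e₀ e₁ c₀ c₁ ∧ MonomialRel D e₀ e₂ c₀ c₂) ∨
    (MonomialRel D e₁ e₀ c₁ c₀ ∧ MonomialRel D e₁ e₂ c₁ c₂) ∨
    (MonomialRel D e₂ e₀ c₂ c₀ ∧ MonomialRel D e₂ e₁ c₂ c₁) := by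
  have hr := (bFun_rotate _ _ _).symm.trans h
  have hrr := (bFun_rotate _ _ _).symm.trans hr
  by_cases h01 : e₀ = e₁
  · have h02 : e₀ ≠ e₂ := fun h02 => hne ⟨h01, h01.symm.trans h02⟩
    exact Or.inr (Or.inr (monomialRel_of_eq h₀ h₂ hU h h01 h02))
  by_cases h12 : e₁ = e₂
  · exact Or.inl (monomialRel_of_eq h₁ h₀ hU hr h12 (Ne.symm h01))
  by_cases h20 : e₂ = e₀
  · exact Or.inr (Or.inl (monomialRel_of_eq h₂ h₁ hU hrr h20 (Ne.symm h12)).symm)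
  have h02 : e₀ ≠ e₂ := Ne.symm h20
  by_cases m0 : e₁ + e₂ = e₀ + e₀
  · exact Or.inl (monomialRel_of_midpoint h₀ h₁ h₂ hU h h01 h02 h12 m0)
  by_cases m1 : e₂ + e₀ = e₁ + e₁
  · exact Or.inr (Or.inl (monomialRel_of_midpoint h₁ h₂ h₀ hU hr h12 (Ne.symm h01) h20 m1).symm)
  by_cases m2 : e₀ + e₁ = e₂ + e₂
  · exact Or.inr (Or.inr (monomialRel_of_midpoint h₂ h₀ h₁ hU hrr h20 (Ne.symm h12) h01 m2))
  have g : bFun (AddMonoidAlgebra.single e₀ c₀) (AddMonoidAlgebra.single e₂ c₂)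
      (AddMonoidAlgebra.single e₁ c₁) = U * D := (bFun_swap _ _ _).trans h
  exact Or.inl ⟨(monomialRel_of_ne h₀ h₁ hU h h01 h02 h12 m0 (Ne.symm m2)).1,
    (monomialRel_of_ne h₀ h₂ hU g h02 h01 (Ne.symm h12) (by rwa [add_comm])
      (by rw [add_comm e₀]; exact Ne.symm m1)).1⟩

/-! ### Configurations -/

theorem Configuration.mk_eq_mk_iff {d : ℕ} {E E' : Fin 3 → (Laurent d)ˣ} :
    Configuration.mk E = Configuration.mk E' ↔ ∃ u : (Laurent d)ˣ, ∀ s, E s = u * E' s := by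
  unfold Configuration.mk
  rw [Quotient.eq]
  constructor
  · rintro ⟨u, hu⟩
    exact ⟨u, fun s => (congrFun hu s).symm⟩
  · rintro ⟨u, hu⟩
    exact ⟨u, funext fun s => (hu s).symm⟩

theorem bFun_mul {S : Type*} [CommRing S] (u x y z : S) :
    bFun (u * x) (u * y) (u * z) = u ^ 2 * bFun x y z := by
  unfold bFun; ring

theorem mk_mem_configurations_iff {d : ℕ} {D : Laurent d} {E : Fin 3 → (Laurent d)ˣ} :
    Configuration.mk E ∈ configurations D ↔ ∃ Q : Laurent d, Q ≠ 0 ∧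
      bFun (E 0 : Laurent d) (E 1 : Laurent d) (E 2 : Laurent d) = Q ^ 2 * D := by
  constructor
  · rintro ⟨E', ⟨Q, hQ, h⟩, hE⟩
    obtain ⟨u, hu⟩ := Configuration.mk_eq_mk_iff.1 hE.symm
    refine ⟨u * Q, mul_ne_zero u.ne_zero hQ, ?_⟩
    rw [hu, hu, hu, Units.val_mul, Units.val_mul, Units.val_mul, bFun_mul, h]
    ring
  · exact fun h => ⟨E, h, rfl⟩

theorem exists_bFun_eq_sq {d : ℕ} (e : Fin d → ℤ) (c₀ c₁ c₂ : ℂ) :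
    ∃ x : Laurent d, bFun (AddMonoidAlgebra.single e c₀) (AddMonoidAlgebra.single e c₁)
      (AddMonoidAlgebra.single e c₂) = x ^ 2 := by
  obtain ⟨z, hz⟩ := IsAlgClosed.exists_pow_nat_eq (bFun c₀ c₁ c₂) (n := 2) (by norm_num)
  have hs : ∀ c : ℂ, (AddMonoidAlgebra.single e c : Laurent d) =
      AddMonoidAlgebra.single e 1 * AddMonoidAlgebra.singleZeroRingHom c := fun c => by
    change _ = _ * AddMonoidAlgebra.single 0 c
    rw [single_mul_single', add_zero, one_mul]
  refine ⟨AddMonoidAlgebra.single e z, ?_⟩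
  rw [hs c₀, hs c₁, hs c₂, hs z, bFun_mul, mul_pow, ← map_pow, hz]
  simp only [bFun, map_sub, map_mul, map_pow, map_ofNat]

/-- A non-unit Q confines the exponents to a box given by the widths of D. For a unit Q, the three
images below correspond to the monomial from which the ratios are measured. -/
theorem finite_normalized_triples {d : ℕ} {D : Laurent d} (hD : D ≠ 0)
    (hns : ∀ x y : Laurent d, y ≠ 0 → y ^ 2 * D ≠ x ^ 2) :
    {p : (Laurent d)ˣ × (Laurent d)ˣ | ∃ Q : Laurent d, Q ≠ 0 ∧
      bFun 1 (p.1 : Laurent d) (p.2 : Laurent d) = Q ^ 2 * D}.Finite := by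
  let w : Fin d → ℤ := fun l => width (Pi.evalAddMonoidHom (fun _ : Fin d => ℤ) l) D
  let box : Set (Fin d → ℤ) := Set.Icc (-w) w
  have hbox : box.Finite := Set.finite_Icc _ _
  have h1 : (⋃ f₁ ∈ box, ⋃ f₂ ∈ box,
      (fun c : ℂ × ℂ => ((AddMonoidAlgebra.single f₁ c.1 : Laurent d),
        (AddMonoidAlgebra.single f₂ c.2 : Laurent d))) ''
      {c : ℂ × ℂ | c.1 ≠ 0 ∧ c.2 ≠ 0 ∧ ∃ Q : Laurent d, ¬ IsUnit Q ∧ Q ≠ 0 ∧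
        bFun 1 (AddMonoidAlgebra.single f₁ c.1) (AddMonoidAlgebra.single f₂ c.2) =
          Q ^ 2 * D}).Finite :=
    hbox.biUnion fun f₁ _ => hbox.biUnion fun f₂ _ =>
      (finite_coeffs_of_not_isUnit hD hns f₁ f₂).image _
  have hP := ((finite_exponentDiffs D).prod (finite_exponentDiffs D)).prod
    ((finite_monomialRatios D).prod (finite_monomialRatios D))
  have h2 := hP.image fun q => ((AddMonoidAlgebra.single q.1.1 q.2.1 : Laurent d),
    (AddMonoidAlgebra.single q.1.2 q.2.2 : Laurent d))
  have h3 := hP.image fun q => ((AddMonoidAlgebra.single (-q.1.1) q.2.1⁻¹ : Laurent d),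
    (AddMonoidAlgebra.single (q.1.2 - q.1.1) (q.2.2 / q.2.1) : Laurent d))
  have h4 := hP.image fun q => ((AddMonoidAlgebra.single (q.1.2 - q.1.1) (q.2.2 / q.2.1) :
    Laurent d), (AddMonoidAlgebra.single (-q.1.1) q.2.1⁻¹ : Laurent d))
  refine (((h1.union (h2.union (h3.union h4))).preimage (f := fun p : (Laurent d)ˣ × (Laurent d)ˣ =>
    ((p.1 : Laurent d), (p.2 : Laurent d))) ?_)).subset ?_
  · intro x _ y _ hxy
    simp only [Prod.mk.injEq] at hxy
    exact Prod.ext (Units.ext hxy.1) (Units.ext hxy.2)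
  rintro ⟨u₁, u₂⟩ ⟨Q, hQ0, h⟩
  rw [Set.mem_preimage]
  dsimp only at h ⊢
  obtain ⟨e₁, c₁, hc₁, hu₁⟩ := exists_eq_single_of_isUnit u₁.isUnit
  obtain ⟨e₂, c₂, hc₂, hu₂⟩ := exists_eq_single_of_isUnit u₂.isUnit
  rw [hu₁, hu₂] at h ⊢
  have h' := h
  rw [AddMonoidAlgebra.one_def] at h'
  by_cases hQ : IsUnit Q
  · right
    have hne : ¬ ((0 : Fin d → ℤ) = e₁ ∧ e₁ = e₂) := by
      rintro ⟨rfl, rfl⟩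
      obtain ⟨x, hx⟩ := exists_bFun_eq_sq (0 : Fin d → ℤ) 1 c₁ c₂
      exact hns x Q hQ0 (h'.symm.trans hx)
    rcases exists_monomialRel one_ne_zero hc₁ hc₂ (hQ.pow 2) h' hne with
      ⟨⟨a1, a2⟩, ⟨b1, b2⟩⟩ | ⟨⟨a1, a2⟩, ⟨b1, b2⟩⟩ | ⟨⟨a1, a2⟩, ⟨b1, b2⟩⟩
    · exact Or.inl ⟨((_, _), (_, _)), ⟨⟨a1, b1⟩, ⟨a2, b2⟩⟩, by simp⟩
    · refine Or.inr (Or.inl ⟨((_, _), (_, _)), ⟨⟨a1, b1⟩, ⟨a2, b2⟩⟩, ?_⟩)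
      have : c₂ / c₁ * c₁ = c₂ := by field_simp
      simp [this]
    · refine Or.inr (Or.inr ⟨((_, _), (_, _)), ⟨⟨a1, b1⟩, ⟨a2, b2⟩⟩, ?_⟩)
      have : c₁ / c₂ * c₂ = c₁ := by field_simp
      simp [this]
  · left
    have hw := fun l => abs_sub_le_width_of_sq_dvd (Pi.evalAddMonoidHom (fun _ : Fin d => ℤ) l)
      one_ne_zero hc₁ hc₂ hQ hD h'
    simp only [Pi.evalAddMonoidHom_apply, Pi.zero_apply, sub_zero, abs_le] at hw
    have m1 : e₁ ∈ box := ⟨fun l => (hw l).1.1, fun l => (hw l).1.2⟩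
    have m2 : e₂ ∈ box := ⟨fun l => (hw l).2.1, fun l => (hw l).2.2⟩
    exact Set.mem_biUnion m1 (Set.mem_biUnion m2 ⟨(c₁, c₂), ⟨hc₁, hc₂, Q, hQ, hQ0, h⟩, rfl⟩)

theorem finite_configurations {d : ℕ} {D : Laurent d} (hD : D ≠ 0)
    (hns : ∀ x y : Laurent d, y ≠ 0 → y ^ 2 * D ≠ x ^ 2) : (configurations D).Finite := by
  refine ((finite_normalized_triples hD hns).image fun p =>
    Configuration.mk ![1, p.1, p.2]).subset ?_
  rintro _ ⟨E, hE, rfl⟩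
  have hmk : Configuration.mk E = Configuration.mk ![1, (E 0)⁻¹ * E 1, (E 0)⁻¹ * E 2] := by
    rw [Configuration.mk_eq_mk_iff]
    refine ⟨E 0, fun s => ?_⟩
    fin_cases s <;> simp
  have hE' : Configuration.mk E ∈ configurations D := ⟨E, hE, rfl⟩
  rw [hmk, mk_mem_configurations_iff] at hE'
  exact ⟨((E 0)⁻¹ * E 1, (E 0)⁻¹ * E 2), by simpa using hE', hmk.symm⟩

/-- The discriminant of a triple of monomials is a square if it is invertible. -/
theorem exists_bFun_eq_sq_of_isUnit {d : ℕ} {x y z : Laurent d} (hx : IsUnit x) (hy : IsUnit y)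
    (hz : IsUnit z) (h : IsUnit (bFun x y z)) : ∃ q, bFun x y z = q ^ 2 := by
  obtain ⟨e₀, c₀, h₀, rfl⟩ := exists_eq_single_of_isUnit hx
  obtain ⟨e₁, c₁, h₁, rfl⟩ := exists_eq_single_of_isUnit hy
  obtain ⟨e₂, c₂, h₂, rfl⟩ := exists_eq_single_of_isUnit hz
  by_cases hne : e₀ = e₁ ∧ e₁ = e₂
  · obtain ⟨rfl, rfl⟩ := hne
    exact exists_bFun_eq_sq _ _ _ _
  exfalso
  -- An invertible discriminant is associated to 1, which has only one exponent, so the three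
  -- exponents would have to agree.
  have h0 : ∀ f ∈ exponentDiffs (1 : Laurent d), f = 0 := by
    rintro f ⟨a, b, ha, hb, hf⟩
    have hz : ∀ {a : Fin d → ℤ}, (1 : Laurent d).coeff a ≠ 0 → a = 0 := fun {a} ha => by
      by_contra hne
      rw [AddMonoidAlgebra.one_def, AddMonoidAlgebra.coeff_single, Finsupp.single_apply,
        if_neg (Ne.symm hne)] at ha
      exact ha rfl
    rw [hz ha, hz hb, sub_zero] at hf
    refine hf.elim id fun h => ?_
    funext l
    have := congrFun h l
    simp only [Pi.add_apply, Pi.zero_apply] at this ⊢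
    omega
  apply hne
  rcases exists_monomialRel (D := 1) h₀ h₁ h₂ h (mul_one _).symm hne with
    ⟨a, b⟩ | ⟨a, b⟩ | ⟨a, b⟩
  all_goals
    have ha := sub_eq_zero.1 (h0 _ a.1)
    have hb := sub_eq_zero.1 (h0 _ b.1)
    simp [ha, hb]

/-! ### Monomials in an extension field -/

section Monomials

variable {d : ℕ} {K : Type*} [Field K] [Algebra (LaurentField d) K]

theorem toExt_injective : Function.Injective (toExt K : Laurent d →+* K) := by
  unfold toExt
  rw [RingHom.coe_comp]
  exact (algebraMap (LaurentField d) K).injective.comp (IsFractionRing.injective _ _)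

theorem toExt_mem_bot (f : Laurent d) : toExt K f ∈ (⊥ : IntermediateField (LaurentField d) K) :=
  IntermediateField.mem_bot.2 ⟨_, rfl⟩

/-- The monomials, including zero, in an extension of the field of fractions. -/
def IsMonomial (d : ℕ) {K : Type*} [Field K] [Algebra (LaurentField d) K] (y : K) : Prop :=
  ∃ (e : Fin d → ℤ) (g : ℂ), y = toExt K (AddMonoidAlgebra.single e g)

theorem IsMonomial.mem_bot {y : K} (h : IsMonomial d y) :
    y ∈ (⊥ : IntermediateField (LaurentField d) K) := by
  obtain ⟨e, g, rfl⟩ := h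
  exact toExt_mem_bot _

theorem IsMonomial.mul {y y' : K} (h : IsMonomial d y) (h' : IsMonomial d y') :
    IsMonomial d (y * y') := by
  obtain ⟨e, g, rfl⟩ := h
  obtain ⟨e', g', rfl⟩ := h'
  exact ⟨e + e', g * g', by rw [← map_mul, single_mul_single']⟩

theorem IsMonomial.inv {y : K} (h : IsMonomial d y) : IsMonomial d y⁻¹ := by
  obtain ⟨e, g, rfl⟩ := h
  by_cases hg : g = 0
  · exact ⟨0, 0, by simp [hg]⟩
  · refine ⟨-e, g⁻¹, inv_eq_of_mul_eq_one_left ?_⟩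
    rw [← map_mul, single_mul_single', neg_add_cancel, inv_mul_cancel₀ hg,
      ← AddMonoidAlgebra.one_def, map_one]

theorem IsMonomial.div {y y' : K} (h : IsMonomial d y) (h' : IsMonomial d y') :
    IsMonomial d (y / y') := div_eq_mul_inv y y' ▸ h.mul h'.inv

theorem IsMonomial.exists_unit {y : K} (h : IsMonomial d y) (hy : y ≠ 0) :
    ∃ u : (Laurent d)ˣ, toExt K (u : Laurent d) = y := by
  obtain ⟨e, g, rfl⟩ := h
  have hg : g ≠ 0 := by rintro rfl; simp at hy
  exact ⟨(isUnit_single e hg).unit, rfl⟩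

/-- An element with trace zero that is defined by monomials lies in the base field. -/
theorem mem_bot_of_trace_eq_zero {e a c y : K} (he : IsMonomial d e) (ha : IsMonomial d a)
    (hc : IsMonomial d c) (ha0 : a ≠ 0) (hc0 : c ≠ 0)
    (h : c * y ^ 2 - (e - a - c) * y + a = 0) (ht : e - a - c = 0) :
    y ∈ (⊥ : IntermediateField (LaurentField d) K) := by
  rw [ht] at h
  obtain ⟨ε, g, rfl⟩ := he
  obtain ⟨f, α, rfl⟩ := ha
  obtain ⟨f', γ, rfl⟩ := hc
  have hα : α ≠ 0 := by rintro rfl; simp at ha0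
  have hγ : γ ≠ 0 := by rintro rfl; simp at hc0
  -- If the exponents differed, the monomial e would have to cancel a term at each of them.
  have hff : f = f' := by
    by_contra hne
    rw [← map_sub, ← map_sub, map_eq_zero_iff _ (toExt_injective (d := d))] at ht
    have h1 := congrArg (fun p => p.coeff f) ht
    have h2 := congrArg (fun p => p.coeff f') ht
    simp only [AddMonoidAlgebra.coeff_sub, Finsupp.sub_apply, AddMonoidAlgebra.coeff_single,
      Finsupp.single_apply, if_pos, if_neg hne, if_neg (Ne.symm hne), AddMonoidAlgebra.coeff_zero,
      Finsupp.coe_zero, Pi.zero_apply, sub_zero] at h1 h2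
    have e1 : ε = f := by by_contra hh; simp [hh, hα] at h1
    have e2 : ε = f' := by by_contra hh; simp [hh, hγ] at h2
    exact hne (e1.symm.trans e2)
  subst hff
  -- The square of y is now a complex constant, so y itself is a constant.
  obtain ⟨z, hz⟩ := IsAlgClosed.exists_pow_nat_eq (-(α / γ)) (n := 2) (by norm_num)
  have hsq : y ^ 2 = (toExt K (AddMonoidAlgebra.single 0 z : Laurent d)) ^ 2 := by
    apply mul_left_cancel₀ hc0
    rw [← map_pow, ← map_mul, AddMonoidAlgebra.single_pow, single_mul_single', hz, smul_zero,
      add_zero, show γ * -(α / γ) = -α by field_simp, AddMonoidAlgebra.single_neg, map_neg]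
    linear_combination h
  rcases sq_eq_sq_iff_eq_or_eq_neg.1 hsq with h | h
  · rw [h]; exact toExt_mem_bot _
  · rw [h]; exact neg_mem (toExt_mem_bot _)

end Monomials

/-- Subtracting y₁² times the equation of y₂ from that of y₁y₂ removes the square of y₂. The
remaining coefficient y₁(y₁t₂ - t₃) is nonzero because y₁ is irrational and t₂ ≠ 0. -/
theorem mem_of_quadratic {F K : Type*} [Field F] [Field K] [Algebra F K]
    {M : IntermediateField F K} {y₁ y₂ t₂ n₂ t₃ n₃ : K} (h₁ : y₁ ∈ M)
    (h₁' : y₁ ∉ (⊥ : IntermediateField F K)) (ht₂ : t₂ ∈ (⊥ : IntermediateField F K))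
    (hn₂ : n₂ ∈ (⊥ : IntermediateField F K)) (ht₃ : t₃ ∈ (⊥ : IntermediateField F K))
    (hn₃ : n₃ ∈ (⊥ : IntermediateField F K)) (ht : t₂ ≠ 0) (h₂ : y₂ ^ 2 = t₂ * y₂ - n₂)
    (h₃ : (y₁ * y₂) ^ 2 = t₃ * (y₁ * y₂) - n₃) : y₂ ∈ M := by
  have hb : ∀ {y : K}, y ∈ (⊥ : IntermediateField F K) → y ∈ M := fun h => bot_le (a := M) h
  have key : (y₁ * (y₁ * t₂ - t₃)) * y₂ = y₁ ^ 2 * n₂ - n₃ := by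
    linear_combination h₃ - y₁ ^ 2 * h₂
  have hy : y₁ ≠ 0 := fun h => h₁' (h ▸ zero_mem _)
  have hne : y₁ * t₂ - t₃ ≠ 0 := fun h => h₁' (by
    rw [show y₁ = t₃ / t₂ by field_simp; linear_combination h]
    exact div_mem ht₃ ht₂)
  rw [mul_comm, ← eq_div_iff (mul_ne_zero hy hne)] at key
  rw [key]
  exact div_mem (sub_mem (mul_mem (pow_mem h₁ 2) (hb hn₂)) (hb hn₃))
    (mul_mem h₁ (sub_mem (mul_mem h₁ (hb ht₂)) (hb ht₃)))

/-! ### Pairs of matrices with monomial products of minors -/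

/-- The cross-ratio of two rows and two columns of a matrix. -/
def crossRatio {P Q K : Type*} [Field K] (x : P → Q → K) (p q : P) (a b : Q) : K :=
  x p a * x q b / (x p b * x q a)

/-- Matrices `x` and `z` for which the products of corresponding entries and of corresponding
`2 × 2` minors are monomials, and for which the entries and `2 × 2` minors of `x` do not vanish. -/
structure MonomialPair (d : ℕ) {P Q K : Type*} [Field K] [Algebra (LaurentField d) K]
    (x z : P → Q → K) : Prop where
  ne_zero : ∀ p a, x p a ≠ 0
  minor_ne_zero : ∀ p q a b, p ≠ q → a ≠ b → x p a * x q b - x p b * x q a ≠ 0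
  entry : ∀ p a, IsMonomial d (x p a * z p a)
  minor : ∀ p q a b, p ≠ q → a ≠ b →
    IsMonomial d ((x p a * x q b - x p b * x q a) * (z p a * z q b - z p b * z q a))

namespace MonomialPair

variable {d : ℕ} {P Q K : Type*} [Field K] [Algebra (LaurentField d) K] {x z : P → Q → K}

theorem transpose (h : MonomialPair d x z) :
    MonomialPair d (fun a p => x p a) (fun a p => z p a) where
  ne_zero a p := h.ne_zero p a
  minor_ne_zero a b p q hab hpq := by
    have := h.minor_ne_zero p q a b hpq hab
    rwa [mul_comm (x p b)] at this
  entry a p := h.entry p a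
  minor a b p q hab hpq := by
    have := h.minor p q a b hpq hab
    rwa [mul_comm (x p b), mul_comm (z p b)] at this

theorem crossRatio_transpose (p q : P) (a b : Q) :
    crossRatio (fun a p => x p a) a b p q = crossRatio x p q a b := by
  unfold crossRatio
  rw [mul_comm (x q a)]

theorem crossRatio_ne_zero (h : MonomialPair d x z) (p q : P) (a b : Q) :
    crossRatio x p q a b ≠ 0 :=
  div_ne_zero (mul_ne_zero (h.ne_zero _ _) (h.ne_zero _ _))
    (mul_ne_zero (h.ne_zero _ _) (h.ne_zero _ _))

theorem crossRatio_self_left (h : MonomialPair d x z) (p : P) (a b : Q) :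
    crossRatio x p p a b = 1 := by
  unfold crossRatio
  rw [mul_comm (x p b)]
  exact div_self (mul_ne_zero (h.ne_zero _ _) (h.ne_zero _ _))

theorem crossRatio_self_right (h : MonomialPair d x z) (p q : P) (a : Q) :
    crossRatio x p q a a = 1 :=
  div_self (mul_ne_zero (h.ne_zero _ _) (h.ne_zero _ _))

theorem crossRatio_mul_right (h : MonomialPair d x z) (p q : P) (a b c : Q) :
    crossRatio x p q a b * crossRatio x p q b c = crossRatio x p q a c := by
  unfold crossRatio
  have := h.ne_zero p a; have := h.ne_zero p b; have := h.ne_zero p c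
  have := h.ne_zero q a; have := h.ne_zero q b; have := h.ne_zero q c
  field_simp

theorem crossRatio_mul_left (h : MonomialPair d x z) (p q r : P) (a b : Q) :
    crossRatio x p q a b * crossRatio x q r a b = crossRatio x p r a b := by
  unfold crossRatio
  have := h.ne_zero p a; have := h.ne_zero p b; have := h.ne_zero r a
  have := h.ne_zero q a; have := h.ne_zero q b; have := h.ne_zero r b
  field_simp

theorem crossRatio_inv (p q : P) (a b : Q) :
    (crossRatio x p q a b)⁻¹ = crossRatio x p q b a := by
  unfold crossRatio
  rw [inv_div]

theorem crossRatio_inv' (p q : P) (a b : Q) :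
    (crossRatio x p q a b)⁻¹ = crossRatio x q p a b := by
  unfold crossRatio
  rw [inv_div, mul_comm, mul_comm (x p a)]

theorem ne_of_not_mem (h : MonomialPair d x z) {p q : P} {a b : Q}
    {M : IntermediateField (LaurentField d) K} (hc : crossRatio x p q a b ∉ M) :
    p ≠ q ∧ a ≠ b := by
  constructor
  · rintro rfl
    exact hc (h.crossRatio_self_left p a b ▸ one_mem _)
  · rintro rfl
    exact hc (h.crossRatio_self_right p q a ▸ one_mem _)

/-- One product in the 2 × 2 minor of z disappears, so the quadratic degenerates to a linear
equation with monomial coefficients. -/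
theorem crossRatio_mem_bot (h : MonomialPair d x z) {p q : P} {a b : Q} (hpa : z p a ≠ 0)
    (hqb : z q b ≠ 0) (h0 : z p b * z q a = 0) :
    crossRatio x p q a b ∈ (⊥ : IntermediateField (LaurentField d) K) := by
  by_contra hc
  obtain ⟨hpq, hab⟩ := h.ne_of_not_mem hc
  apply hc
  have hm := (h.minor p q a b hpq hab).div ((h.entry p a).mul (h.entry q b))
  have : crossRatio x q p a b = 1 - (x p a * x q b - x p b * x q a) *
      (z p a * z q b - z p b * z q a) / (x p a * z p a * (x q b * z q b)) := by
    rw [h0]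
    unfold crossRatio
    have := h.ne_zero p a; have := h.ne_zero q b
    field_simp
    ring
  rw [← inv_inv (crossRatio x p q a b), crossRatio_inv', this]
  exact inv_mem (sub_mem (one_mem _) hm.mem_bot)

/-- The quadratic equation of the negative of a cross-ratio. -/
theorem quadratic (h : MonomialPair d x z) (p q : P) (a b : Q) :
    (x p b * z p b * (x q a * z q a)) * (-crossRatio x p q a b) ^ 2 -
      ((x p a * x q b - x p b * x q a) * (z p a * z q b - z p b * z q a) -
        x p a * z p a * (x q b * z q b) - x p b * z p b * (x q a * z q a)) *
        (-crossRatio x p q a b) + x p a * z p a * (x q b * z q b) = 0 := by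
  unfold crossRatio
  have := h.ne_zero p a; have := h.ne_zero p b
  have := h.ne_zero q a; have := h.ne_zero q b
  field_simp
  ring

theorem exists_trace_norm (h : MonomialPair d x z) {p q : P} {a b : Q} (hpq : p ≠ q) (hab : a ≠ b)
    (hpa : z p a ≠ 0) (hpb : z p b ≠ 0) (hqa : z q a ≠ 0) (hqb : z q b ≠ 0) :
    ∃ t ∈ (⊥ : IntermediateField (LaurentField d) K),
      ∃ n ∈ (⊥ : IntermediateField (LaurentField d) K),
      crossRatio x p q a b ^ 2 = t * crossRatio x p q a b - n ∧
      (t = 0 → crossRatio x p q a b ∈ (⊥ : IntermediateField (LaurentField d) K)) := by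
  have hq := h.quadratic p q a b
  have he := h.minor p q a b hpq hab
  have ha := (h.entry p a).mul (h.entry q b)
  have hc := (h.entry p b).mul (h.entry q a)
  have ha0 : x p a * z p a * (x q b * z q b) ≠ 0 :=
    mul_ne_zero (mul_ne_zero (h.ne_zero _ _) hpa) (mul_ne_zero (h.ne_zero _ _) hqb)
  have hc0 : x p b * z p b * (x q a * z q a) ≠ 0 :=
    mul_ne_zero (mul_ne_zero (h.ne_zero _ _) hpb) (mul_ne_zero (h.ne_zero _ _) hqa)
  have hz := mem_bot_of_trace_eq_zero he ha hc ha0 hc0 hq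
  generalize (x p a * x q b - x p b * x q a) * (z p a * z q b - z p b * z q a) = e at *
  generalize x p a * z p a * (x q b * z q b) = A at *
  generalize x p b * z p b * (x q a * z q a) = C at *
  refine ⟨-((e - A - C) / C), neg_mem (div_mem (sub_mem (sub_mem he.mem_bot ha.mem_bot) hc.mem_bot)
    hc.mem_bot), A / C, div_mem ha.mem_bot hc.mem_bot, ?_, fun h0 => ?_⟩
  · field_simp
    linear_combination hq
  · have := hz ((div_eq_zero_iff.1 (neg_eq_zero.1 h0)).resolve_right hc0)
    exact neg_mem_iff.1 this

/-- The cross-ratio on b, c is that on b, a times that on a, c, so the elimination in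
`mem_of_quadratic` applies. If the trace is zero, the cross-ratio on a, c is already rational. -/
theorem crossRatio_mem_of_columns (h : MonomialPair d x z) {p q : P} {a b c : Q}
    (hp : ∀ s ∈ ({a, b, c} : Set Q), z p s ≠ 0) (hq : ∀ s ∈ ({a, b, c} : Set Q), z q s ≠ 0)
    {M : IntermediateField (LaurentField d) K} (hM : crossRatio x p q a b ∈ M)
    (hc : crossRatio x p q a b ∉ (⊥ : IntermediateField (LaurentField d) K)) :
    crossRatio x p q a c ∈ M := by
  have hb : ∀ {y : K}, y ∈ (⊥ : IntermediateField (LaurentField d) K) → y ∈ M :=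
    fun h => bot_le (a := M) h
  by_cases hac : crossRatio x p q a c ∈ (⊥ : IntermediateField (LaurentField d) K)
  · exact hb hac
  obtain ⟨hpq, hac'⟩ := h.ne_of_not_mem hac
  by_cases hbc : b = c
  · rwa [← hbc]
  simp only [Set.mem_insert_iff, Set.mem_singleton_iff, forall_eq_or_imp, forall_eq] at hp hq
  obtain ⟨t₂, ht₂, n₂, hn₂, e₂, hz⟩ := h.exists_trace_norm hpq hac' hp.1 hp.2.2 hq.1 hq.2.2
  obtain ⟨t₃, ht₃, n₃, hn₃, e₃, -⟩ := h.exists_trace_norm hpq hbc hp.2.1 hp.2.2 hq.2.1 hq.2.2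
  refine mem_of_quadratic (y₁ := crossRatio x p q b a) ?_ ?_ ht₂ hn₂ ht₃ hn₃ (fun h0 => hac (hz h0))
    e₂ (by rw [h.crossRatio_mul_right]; exact e₃)
  · rw [← crossRatio_inv]; exact inv_mem hM
  · rw [← crossRatio_inv, inv_mem_iff]; exact hc

theorem crossRatio_mem_of_rows (h : MonomialPair d x z) {p q r : P} {a b : Q}
    (ha : ∀ s ∈ ({p, q, r} : Set P), z s a ≠ 0) (hb : ∀ s ∈ ({p, q, r} : Set P), z s b ≠ 0)
    {M : IntermediateField (LaurentField d) K} (hM : crossRatio x p q a b ∈ M)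
    (hc : crossRatio x p q a b ∉ (⊥ : IntermediateField (LaurentField d) K)) :
    crossRatio x p r a b ∈ M := by
  rw [← crossRatio_transpose] at hM hc ⊢
  exact h.transpose.crossRatio_mem_of_columns ha hb hM hc

/-- If both entries vanish, the cross-ratio factors through row m; if only one does, it degenerates
directly. -/
theorem crossRatio_mem_bot_of_zero (h : MonomialPair d x z) {i j m : P} {δ γ : Q}
    (hi : z i δ ≠ 0) (hj : z j δ ≠ 0) (hm : z m γ ≠ 0) (h0 : z i γ = 0 ∨ z j γ = 0) :
    crossRatio x i j δ γ ∈ (⊥ : IntermediateField (LaurentField d) K) := by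
  by_cases hiγ : z i γ = 0
  · by_cases hjγ : z j γ = 0
    · rw [← h.crossRatio_mul_left i m j, ← crossRatio_inv' j m]
      exact mul_mem (h.crossRatio_mem_bot hi hm (by simp [hiγ]))
        (inv_mem (h.crossRatio_mem_bot hj hm (by simp [hjγ])))
    · exact h.crossRatio_mem_bot hi hjγ (by simp [hiγ])
  · have hjγ := h0.resolve_left hiγ
    rw [← crossRatio_inv]
    exact inv_mem (h.crossRatio_mem_bot hiγ hj (by simp [hjγ]))

/-- A zero in column γ would make the cross-ratios of γ with α and with β rational, hence also their
quotient, the given irrational one. -/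
theorem column_ne_zero (h : MonomialPair d x z) {i j m : P} {α β γ : Q}
    (hiα : z i α ≠ 0) (hiβ : z i β ≠ 0) (hjα : z j α ≠ 0) (hjβ : z j β ≠ 0)
    (hc : crossRatio x i j α β ∉ (⊥ : IntermediateField (LaurentField d) K)) (hm : z m γ ≠ 0) :
    z i γ ≠ 0 ∧ z j γ ≠ 0 := by
  rw [← not_or]
  intro h0
  apply hc
  rw [← h.crossRatio_mul_right i j α γ, ← crossRatio_inv i j β γ]
  exact mul_mem (h.crossRatio_mem_bot_of_zero hiα hjα hm h0)
    (inv_mem (h.crossRatio_mem_bot_of_zero hiβ hjβ hm h0))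

theorem row_ne_zero (h : MonomialPair d x z) {i j m : P} {α β γ : Q}
    (hiα : z i α ≠ 0) (hiβ : z i β ≠ 0) (hjα : z j α ≠ 0) (hjβ : z j β ≠ 0)
    (hc : crossRatio x i j α β ∉ (⊥ : IntermediateField (LaurentField d) K)) (hm : z m γ ≠ 0) :
    z m α ≠ 0 ∧ z m β ≠ 0 := by
  rw [← crossRatio_transpose] at hc
  exact h.transpose.column_ne_zero hiα hjα hiβ hjβ hc hm

/-- A row of `z` vanishes or has no zero entry, and in the second case its cross-ratios lie in any
field that contains a given irrational cross-ratio. -/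
theorem row_dichotomy (h : MonomialPair d x z) (hcol : ∀ γ, ∃ m, z m γ ≠ 0) {i j : P} {α β : Q}
    (hiα : z i α ≠ 0) (hiβ : z i β ≠ 0) (hjα : z j α ≠ 0) (hjβ : z j β ≠ 0)
    (hc : crossRatio x i j α β ∉ (⊥ : IntermediateField (LaurentField d) K))
    {M : IntermediateField (LaurentField d) K} (hM : crossRatio x i j α β ∈ M) (m : P) :
    (∀ γ, z m γ = 0) ∨ (∀ γ, z m γ ≠ 0 ∧ crossRatio x i m α γ ∈ M) := by
  have hij : ∀ γ, z i γ ≠ 0 ∧ z j γ ≠ 0 := fun γ => by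
    obtain ⟨m, hm⟩ := hcol γ
    exact h.column_ne_zero hiα hiβ hjα hjβ hc hm
  by_cases hm : ∀ γ, z m γ = 0
  · exact Or.inl hm
  right
  push Not at hm
  obtain ⟨δ, hδ⟩ := hm
  -- Column γ has an irrational cross-ratio with α or with β; in either case a nonzero entry of row
  -- m spreads to γ.
  have hmz : ∀ γ, z m γ ≠ 0 := fun γ => by
    by_cases hαγ : crossRatio x i j α γ ∈ (⊥ : IntermediateField (LaurentField d) K)
    · have hβγ : crossRatio x i j β γ ∉ (⊥ : IntermediateField (LaurentField d) K) := fun hβγ =>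
        hc (by
          rw [← h.crossRatio_mul_right i j α γ, ← crossRatio_inv i j β γ]
          exact mul_mem hαγ (inv_mem hβγ))
      exact (h.row_ne_zero hiβ (hij γ).1 hjβ (hij γ).2 hβγ hδ).2
    · exact (h.row_ne_zero hiα (hij γ).1 hjα (hij γ).2 hαγ hδ).2
  refine fun γ => ⟨hmz γ, ?_⟩
  have hijM : crossRatio x i j α γ ∈ M := h.crossRatio_mem_of_columns (fun s _ => (hij s).1)
    (fun s _ => (hij s).2) hM hc
  have himM : crossRatio x i m α β ∈ M := by
    refine h.crossRatio_mem_of_rows ?_ ?_ hM hc <;>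
      simp [hiα, hiβ, hjα, hjβ, hmz]
  -- If rows i, m give a rational cross-ratio, rows j, m give an irrational one, and the passage
  -- from row i to row m goes through j.
  by_cases him : crossRatio x i m α β ∈ (⊥ : IntermediateField (LaurentField d) K)
  · rw [← h.crossRatio_mul_left i j m]
    refine mul_mem hijM (h.crossRatio_mem_of_columns (b := β) (fun s _ => (hij s).2)
      (fun s _ => hmz s) ?_ fun hjm => hc ?_)
    · rw [← h.crossRatio_mul_left j i m, ← crossRatio_inv']
      exact mul_mem (inv_mem hM) himM
    · rw [← h.crossRatio_mul_left i m j, ← crossRatio_inv' j m]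
      exact mul_mem him (inv_mem hjm)
  · exact h.crossRatio_mem_of_columns (fun s _ => (hij s).1) (fun s _ => hmz s) himM him

end MonomialPair

/-! ### Minors on ordered sets of columns -/

/-- The determinant of the columns `g 0, g 1, …` of `A`, in this order. -/
def colMinor {K : Type*} [Field K] {k n : ℕ} (A : Matrix (Fin k) (Fin n) K)
    (g : Fin k → Fin n) : K :=
  (A.submatrix id g).det

/-- The Vandermonde determinant of a sequence of indices, whose sign is that of the permutation
that sorts the sequence. -/
def indexVandermonde {k n : ℕ} (g : Fin k → Fin n) : ℤ :=
  (Matrix.vandermonde fun a => ((g a : ℕ) : ℤ)).det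

theorem indexVandermonde_eq_prod {k n : ℕ} (g : Fin k → Fin n) :
    indexVandermonde g = ∏ a, ∏ b ∈ Finset.Ioi a, (((g b : ℕ) : ℤ) - ((g a : ℕ) : ℤ)) :=
  Matrix.det_vandermonde _

theorem indexVandermonde_pos {k n : ℕ} {g : Fin k → Fin n} (hg : StrictMono g) :
    0 < indexVandermonde g := by
  rw [indexVandermonde_eq_prod]
  refine Finset.prod_pos fun a _ => Finset.prod_pos fun b hb => ?_
  have : (g a : ℕ) < g b := hg (Finset.mem_Ioi.1 hb)
  omega

theorem indexVandermonde_ne_zero {k n : ℕ} {g : Fin k → Fin n} (hg : Function.Injective g) :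
    indexVandermonde g ≠ 0 := by
  rw [indexVandermonde, Matrix.det_vandermonde_ne_zero_iff]
  intro a b h
  exact hg (Fin.ext (by simpa using h))

theorem card_image_of_injective {k n : ℕ} {g : Fin k → Fin n} (hg : Function.Injective g) :
    (Finset.univ.image g).card = k := by
  rw [Finset.card_image_of_injective _ hg, Finset.card_univ, Fintype.card_fin]

/-- The sorting permutation multiplies the minor and the Vandermonde determinant by the same sign,
and the latter is positive on increasing sequences. -/
theorem colMinor_eq {K : Type*} [Field K] {k n : ℕ} (A : Matrix (Fin k) (Fin n) K)
    {g : Fin k → Fin n} (hg : Function.Injective g) :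
    colMinor A g = ((indexVandermonde g).sign : K) * minor A (Finset.univ.image g) := by
  have hI := card_image_of_injective hg
  set f := (Finset.univ.image g).orderEmbOfFin hI with hf
  have hrange : ∀ a, ∃ b, f b = g a := fun a => by
    have : g a ∈ Set.range f := by
      rw [hf, Finset.range_orderEmbOfFin]
      simp
    exact this
  choose π hπ using hrange
  have hinj : Function.Injective π := fun a b h => hg (by rw [← hπ, ← hπ, h])
  let σ : Equiv.Perm (Fin k) := Equiv.ofBijective π (Finite.injective_iff_bijective.1 hinj)
  have hgσ : g = fun a => f (σ a) := funext fun a => (hπ a).symm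
  have hm : minor A (Finset.univ.image g) = colMinor A f := by
    unfold minor colMinor
    rw [dif_pos hI]
  have h1 : colMinor A g = ((Equiv.Perm.sign σ : ℤ) : K) * colMinor A f := by
    unfold colMinor
    rw [← Matrix.det_permute' σ, hgσ]
    rfl
  have h2 : indexVandermonde g = (Equiv.Perm.sign σ : ℤ) * indexVandermonde f := by
    unfold indexVandermonde
    have := Matrix.det_permute σ (Matrix.vandermonde fun a => ((f a : ℕ) : ℤ))
    rw [Int.cast_id] at this
    rw [← this, hgσ]
    rfl
  have h3 : (indexVandermonde g).sign = (Equiv.Perm.sign σ : ℤ) := by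
    rw [h2, Int.sign_mul, Int.sign_eq_one_of_pos (indexVandermonde_pos f.strictMono), mul_one]
    rcases Int.units_eq_one_or (Equiv.Perm.sign σ) with h | h <;> rw [h] <;> rfl
  rw [hm, h3, h1]

theorem sign_mul_self {m : ℤ} (hm : m ≠ 0) : m.sign * m.sign = 1 := by
  rw [← Int.sign_mul]
  exact Int.sign_eq_one_of_pos (mul_self_pos.2 hm)

theorem term_image {K : Type*} [Field K] {k n : ℕ} (L : Matrix (Fin k) (Fin n) K)
    (R : Matrix (Fin n) (Fin k) K) {g : Fin k → Fin n} (hg : Function.Injective g) :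
    term L R (Finset.univ.image g) = colMinor L g * colMinor R.transpose g := by
  have hs : (((indexVandermonde g).sign : ℤ) : K) * ((indexVandermonde g).sign : ℤ) = 1 := by
    exact_mod_cast congrArg (Int.cast : ℤ → K) (sign_mul_self (indexVandermonde_ne_zero hg))
  rw [colMinor_eq L hg, colMinor_eq R.transpose hg]
  unfold term
  linear_combination -(minor L (Finset.univ.image g) * minor R.transpose (Finset.univ.image g)) * hs

/-- Only the factors that involve position p depend on α. Supplying the missing factor α - f p makes
the product over all positions, which no longer depends on p. -/
theorem exists_indexVandermonde_update {k n : ℕ} (f : Fin k → Fin n) (p : Fin k) :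
    ∃ c : ℤ, ∀ α : Fin n, indexVandermonde (Function.update f p α) *
      (((α : ℕ) : ℤ) - ((f p : ℕ) : ℤ)) = c * ∏ a, (((α : ℕ) : ℤ) - ((f a : ℕ) : ℤ)) := by
  refine ⟨(∏ a, ∏ b ∈ Finset.Ioi a, if a = p ∨ b = p then 1 else
    (((f b : ℕ) : ℤ) - ((f a : ℕ) : ℤ))) * (-1) ^ (Finset.Ioi p).card, fun α => ?_⟩
  have h1 : ∀ a, ∀ b ∈ Finset.Ioi a, (((Function.update f p α b : Fin n) : ℕ) : ℤ) -
      ((Function.update f p α a : Fin n) : ℕ) =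
      (if a = p ∨ b = p then 1 else (((f b : ℕ) : ℤ) - ((f a : ℕ) : ℤ))) *
      ((if a = p then -(((α : ℕ) : ℤ) - ((f b : ℕ) : ℤ)) else 1) *
      (if b = p then (((α : ℕ) : ℤ) - ((f a : ℕ) : ℤ)) else 1)) := by
    intro a b hb
    have hab : a ≠ b := (Finset.mem_Ioi.1 hb).ne
    by_cases ha : a = p
    · have hbp : b ≠ p := fun h => hab (ha.trans h.symm)
      subst ha
      simp [hbp]
    · by_cases hbp : b = p
      · subst hbp
        simp [ha]
      · simp [ha, hbp]
  rw [indexVandermonde_eq_prod,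
    Finset.prod_congr rfl fun a _ => Finset.prod_congr rfl (h1 a)]
  simp only [Finset.prod_mul_distrib]
  have h2 : (∏ a, ∏ b ∈ Finset.Ioi a, if a = p then -(((α : ℕ) : ℤ) - ((f b : ℕ) : ℤ)) else 1) =
      (-1) ^ (Finset.Ioi p).card * ∏ b ∈ Finset.Ioi p, (((α : ℕ) : ℤ) - ((f b : ℕ) : ℤ)) := by
    rw [Finset.prod_eq_single p (fun a _ ha => by simp [ha]) (by simp), ← Finset.prod_neg]
    simp
  have h3 : (∏ a, ∏ b ∈ Finset.Ioi a, if b = p then (((α : ℕ) : ℤ) - ((f a : ℕ) : ℤ)) else 1) =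
      ∏ a ∈ Finset.Iio p, (((α : ℕ) : ℤ) - ((f a : ℕ) : ℤ)) := by
    simp only [Finset.prod_ite_eq', Finset.mem_Ioi]
    rw [← Finset.prod_filter]
    congr 1
    ext a
    simp
  have h4 : (∏ b ∈ Finset.Ioi p, (((α : ℕ) : ℤ) - ((f b : ℕ) : ℤ))) *
      (∏ a ∈ Finset.Iio p, (((α : ℕ) : ℤ) - ((f a : ℕ) : ℤ))) *
      (((α : ℕ) : ℤ) - ((f p : ℕ) : ℤ)) = ∏ a, (((α : ℕ) : ℤ) - ((f a : ℕ) : ℤ)) := by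
    have hp : p ∉ Finset.Ioi p ∪ Finset.Iio p := by simp
    rw [← Finset.prod_union (Finset.disjoint_left.2 fun a ha hb =>
      lt_asymm (Finset.mem_Ioi.1 ha) (Finset.mem_Iio.1 hb)), mul_comm]
    refine (Finset.prod_insert (f := fun a => ((α : ℕ) : ℤ) - ((f a : ℕ) : ℤ)) hp).symm.trans ?_
    congr 1
    ext a
    simp only [Finset.mem_insert, Finset.mem_union, Finset.mem_Ioi, Finset.mem_Iio,
      Finset.mem_univ, iff_true]
    rcases lt_trichotomy a p with h | h | h <;> simp [h]
  rw [h2, h3, ← h4]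
  ring

theorem sign_indexVandermonde_update {k n : ℕ} {f : Fin k → Fin n} (p q : Fin k) {α β : Fin n}
    (hα : ∀ a, f a ≠ α) (hβ : ∀ a, f a ≠ β) (hf : Function.Injective f) (hpq : p ≠ q)
    (hαβ : α ≠ β) :
    signOne (f p) (f q) α β * signTwo (f p) (f q) α β =
      -((indexVandermonde (Function.update f p α)).sign *
        (indexVandermonde (Function.update f p β)).sign *
        (indexVandermonde (Function.update f q β)).sign *
        (indexVandermonde (Function.update f q α)).sign) := by
  have inj : ∀ {x y : Fin n}, x ≠ y → (((x : ℕ) : ℤ) - ((y : ℕ) : ℤ)) ≠ 0 := fun {x y} h h' =>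
    h (Fin.ext (by omega))
  have hup : ∀ {γ : Fin n} (p : Fin k), (∀ a, f a ≠ γ) →
      indexVandermonde (Function.update f p γ) ≠ 0 := fun {γ} p hγ => by
    refine indexVandermonde_ne_zero fun a b h => ?_
    by_cases ha : a = p <;> by_cases hb : b = p
    · rw [ha, hb]
    · subst ha
      rw [Function.update_self, Function.update_of_ne hb] at h
      exact absurd h.symm (hγ b)
    · subst hb
      rw [Function.update_self, Function.update_of_ne ha] at h
      exact absurd h (hγ a)
    · rw [Function.update_of_ne ha, Function.update_of_ne hb] at h
      exact hf h
  obtain ⟨c, hc⟩ := exists_indexVandermonde_update f p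
  obtain ⟨c', hc'⟩ := exists_indexVandermonde_update f q
  unfold signOne signTwo
  simp only [← Int.sign_mul]
  have a1 := hc α; have a2 := hc β; have b1 := hc' α; have b2 := hc' β
  have n1 := hup p hα; have n2 := hup p hβ; have n3 := hup q hα; have n4 := hup q hβ
  have d1 := inj (hα p).symm; have d2 := inj (hα q).symm
  have d3 := inj (hβ p).symm; have d4 := inj (hβ q).symm
  have d5 := inj (hf.ne hpq); have d6 := inj hαβ
  generalize indexVandermonde (Function.update f p α) = w1 at *
  generalize indexVandermonde (Function.update f p β) = w2 at *
  generalize indexVandermonde (Function.update f q α) = w3 at *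
  generalize indexVandermonde (Function.update f q β) = w4 at *
  generalize (∏ a, (((α : ℕ) : ℤ) - ((f a : ℕ) : ℤ))) = A at *
  generalize (∏ a, (((β : ℕ) : ℤ) - ((f a : ℕ) : ℤ))) = B at *
  generalize ((α : ℕ) : ℤ) = x at *
  generalize ((β : ℕ) : ℤ) = y at *
  generalize ((f p : ℕ) : ℤ) = u at *
  generalize ((f q : ℕ) : ℤ) = v at *
  -- Each of A and B occurs once for p and once for q, so the whole product is a nonzero square.
  have hpos : 0 < w1 * w2 * w4 * w3 * ((x - u) * (x - v) * (y - u) * (y - v)) := by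
    have : w1 * w2 * w4 * w3 * ((x - u) * (x - v) * (y - u) * (y - v)) =
        (c * c' * A * B) * (c * c' * A * B) := by
      calc _ = (w1 * (x - u)) * (w2 * (y - u)) * (w3 * (x - v)) * (w4 * (y - v)) := by ring
        _ = _ := by rw [a1, a2, b1, b2]; ring
    have hne : w1 * w2 * w4 * w3 * ((x - u) * (x - v) * (y - u) * (y - v)) ≠ 0 := by
      simp only [ne_eq, mul_eq_zero, not_or]
      exact ⟨⟨⟨⟨n1, n2⟩, n4⟩, n3⟩, ⟨⟨d1, d2⟩, d3⟩, d4⟩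
    rw [this] at hne ⊢
    exact lt_of_le_of_ne (mul_self_nonneg _) (Ne.symm hne)
  have e1 : (u - v) * (x - y) * (u - y) * (x - v) * ((u - v) * (x - y) * (u - x) * (v - y)) =
      -(((u - v) * (x - y)) * ((u - v) * (x - y)) * ((x - u) * (x - v) * (y - u) * (y - v))) := by
    ring
  rw [e1, Int.sign_neg, Int.sign_mul, Int.sign_mul ((u - v) * (x - y)),
    sign_mul_self (mul_ne_zero d5 d6), one_mul]
  congr 1
  have hs := Int.sign_eq_one_of_pos hpos
  rw [Int.sign_mul] at hs
  have h0 : (w1 * w2 * w4 * w3) ≠ 0 := by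
    simp only [ne_eq, mul_eq_zero, not_or]
    exact ⟨⟨⟨n1, n2⟩, n4⟩, n3⟩
  calc _ = ((w1 * w2 * w4 * w3).sign * (w1 * w2 * w4 * w3).sign) *
        ((x - u) * (x - v) * (y - u) * (y - v)).sign := by rw [sign_mul_self h0, one_mul]
    _ = _ := by rw [mul_assoc, hs, mul_one]

/-! ### Charts -/

section Charts

variable {K : Type*} [Field K] {k n : ℕ}

theorem colMinor_mul (M : Matrix (Fin k) (Fin k) K) (A : Matrix (Fin k) (Fin n) K)
    (g : Fin k → Fin n) : colMinor (M * A) g = M.det * colMinor A g := by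
  unfold colMinor
  rw [← Matrix.det_mul]
  rfl

/-- The matrix with the row space of `A` whose columns `f 0, f 1, …` form the identity matrix. -/
noncomputable def chart (A : Matrix (Fin k) (Fin n) K) (f : Fin k → Fin n) :
    Matrix (Fin k) (Fin n) K :=
  (A.submatrix id f)⁻¹ * A

theorem submatrix_chart {A : Matrix (Fin k) (Fin n) K} {f : Fin k → Fin n}
    (h : colMinor A f ≠ 0) : (chart A f).submatrix id f = 1 :=
  Matrix.nonsing_inv_mul (A.submatrix id f) (isUnit_iff_ne_zero.2 h)

theorem mul_chart {A : Matrix (Fin k) (Fin n) K} {f : Fin k → Fin n}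
    (h : colMinor A f ≠ 0) : A.submatrix id f * chart A f = A := by
  unfold chart
  rw [← Matrix.mul_assoc, Matrix.mul_nonsing_inv _ (isUnit_iff_ne_zero.2 h), Matrix.one_mul]

theorem colMinor_eq_mul_chart {A : Matrix (Fin k) (Fin n) K} {f : Fin k → Fin n}
    (h : colMinor A f ≠ 0) (g : Fin k → Fin n) :
    colMinor A g = colMinor A f * colMinor (chart A f) g := by
  conv_lhs => rw [← mul_chart h]
  exact colMinor_mul _ _ _

theorem submatrix_update {K : Type*} (X : Matrix (Fin k) (Fin n) K) (f : Fin k → Fin n) (p : Fin k)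
    (α : Fin n) : X.submatrix id (Function.update f p α) =
      (X.submatrix id f).updateCol p fun a => X a α := by
  ext a b
  by_cases hb : b = p
  · subst hb
    simp
  · simp [hb]

theorem colMinor_update {X : Matrix (Fin k) (Fin n) K} {f : Fin k → Fin n}
    (h : X.submatrix id f = 1) (p : Fin k) (α : Fin n) :
    colMinor X (Function.update f p α) = X p α := by
  unfold colMinor
  rw [submatrix_update, h, ← Matrix.cramer_apply, Matrix.cramer_one]
  rfl

/-- This is row q of Cramer's identity for the matrix with one exchanged column: only the unknowns
at p and q enter that row. -/
theorem colMinor_update_update {X : Matrix (Fin k) (Fin n) K} {f : Fin k → Fin n}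
    (h : X.submatrix id f = 1) {p q : Fin k} (hpq : p ≠ q) (α β : Fin n) :
    colMinor X (Function.update (Function.update f p α) q β) =
      X p α * X q β - X p β * X q α := by
  have h1 := congrFun (Matrix.mulVec_cramer (X.submatrix id (Function.update f p α))
    fun a => X a β) q
  have h2 : Matrix.cramer (X.submatrix id (Function.update f p α)) (fun a => X a β) p = X p β := by
    rw [Matrix.cramer_apply, ← submatrix_update, Function.update_idem]
    exact colMinor_update h p β
  have h3 : Matrix.cramer (X.submatrix id (Function.update f p α)) (fun a => X a β) q =
      colMinor X (Function.update (Function.update f p α) q β) := by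
    rw [Matrix.cramer_apply, ← submatrix_update]
    rfl
  have h4 : (X.submatrix id (Function.update f p α)).det = X p α := colMinor_update h p α
  rw [h4, Matrix.mulVec, dotProduct, Finset.sum_congr rfl (g := fun b =>
    (if b = p then X q α * X p β else 0) + if b = q then
      colMinor X (Function.update (Function.update f p α) q β) else 0), Finset.sum_add_distrib,
    Finset.sum_ite_eq', Finset.sum_ite_eq', if_pos (Finset.mem_univ _),
    if_pos (Finset.mem_univ _), Pi.smul_apply, smul_eq_mul] at h1
  · linear_combination h1
  · intro b _
    have h5 : X.submatrix id (Function.update f p α) q b =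
        (1 : Matrix (Fin k) (Fin k) K).updateCol p (fun a => X a α) q b := by
      rw [submatrix_update, h]
    rw [h5]
    by_cases hb : b = p
    · subst hb
      simp [hpq, h2]
    · by_cases hb' : b = q
      · subst hb'
        simp [hb, h3]
      · simp [hb, hb', Ne.symm hb']

theorem injective_update {f : Fin k → Fin n} (hf : Function.Injective f) (p : Fin k)
    {α : Fin n} (hα : ∀ a, f a ≠ α) : Function.Injective (Function.update f p α) := by
  intro a b h
  by_cases ha : a = p <;> by_cases hb : b = p
  · rw [ha, hb]
  · subst ha
    rw [Function.update_self, Function.update_of_ne hb] at h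
    exact absurd h.symm (hα b)
  · subst hb
    rw [Function.update_self, Function.update_of_ne ha] at h
    exact absurd h (hα a)
  · rw [Function.update_of_ne ha, Function.update_of_ne hb] at h
    exact hf h

theorem update_ne {f : Fin k → Fin n} {p : Fin k} {α β : Fin n} (hβ : ∀ a, f a ≠ β)
    (hαβ : α ≠ β) (a : Fin k) : Function.update f p α a ≠ β := by
  by_cases ha : a = p
  · subst ha
    rwa [Function.update_self]
  · rw [Function.update_of_ne ha]
    exact hβ a

theorem image_update {f : Fin k → Fin n} (hf : Function.Injective f) (p : Fin k) (α : Fin n) :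
    Finset.univ.image (Function.update f p α) = exch (Finset.univ.image f) (f p) α := by
  unfold exch
  ext γ
  simp only [Finset.mem_image, Finset.mem_univ, true_and, Finset.mem_insert, Finset.mem_erase]
  constructor
  · rintro ⟨a, rfl⟩
    by_cases ha : a = p
    · subst ha
      simp
    · rw [Function.update_of_ne ha]
      exact Or.inr ⟨hf.ne ha, a, rfl⟩
  · rintro (rfl | ⟨h, a, rfl⟩)
    · exact ⟨p, by simp⟩
    · exact ⟨a, Function.update_of_ne (fun ha => h (by rw [ha])) _ _⟩

theorem image_update_update {f : Fin k → Fin n} (hf : Function.Injective f) {p q : Fin k}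
    (hpq : p ≠ q) {α : Fin n} (hα : ∀ a, f a ≠ α) (β : Fin n) :
    Finset.univ.image (Function.update (Function.update f p α) q β) =
      exchTwo (Finset.univ.image f) (f p) (f q) α β := by
  have h := image_update (injective_update hf p hα) q β
  rw [Function.update_of_ne hpq.symm, image_update hf] at h
  rw [h]
  unfold exch exchTwo
  rw [Finset.erase_insert_of_ne (hα q).symm, Finset.insert_comm]

end Charts

/-! ### Matrices with monomial products of maximal minors -/

/-- The matrices `L` and `A` have monomial products of maximal minors, `L` has no null column and
the maximal minors of `A` do not vanish. -/
structure MonomialTerms (d : ℕ) {K : Type*} [Field K] [Algebra (LaurentField d) K] {k n : ℕ}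
    (L A : Matrix (Fin k) (Fin n) K) : Prop where
  colMinor_ne_zero : ∀ g : Fin k → Fin n, Function.Injective g → colMinor A g ≠ 0
  column_ne_zero : ∀ ω, ∃ a, L a ω ≠ 0
  isMonomial : ∀ g : Fin k → Fin n, Function.Injective g →
    IsMonomial d (colMinor L g * colMinor A g)

/-- The columns that are not indexed by `f`. -/
abbrev OffRange {k n : ℕ} (f : Fin k → Fin n) : Type := {γ : Fin n // ∀ a, f a ≠ γ}

section

variable {d k n : ℕ} {K : Type*} [Field K] [Algebra (LaurentField d) K]
  {L A : Matrix (Fin k) (Fin n) K} {f : Fin k → Fin n}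

theorem MonomialTerms.isMonomial_chart (h : MonomialTerms d L A) (hf : Function.Injective f)
    (hLf : colMinor L f ≠ 0) {g : Fin k → Fin n} (hg : Function.Injective g) :
    IsMonomial d (colMinor (chart A f) g * colMinor (chart L f) g) := by
  have hAf := h.colMinor_ne_zero f hf
  have hm := (h.isMonomial g hg).div (h.isMonomial f hf)
  rw [colMinor_eq_mul_chart hLf g, colMinor_eq_mul_chart hAf g] at hm
  convert hm using 1
  field_simp

theorem MonomialTerms.chart_ne_zero (h : MonomialTerms d L A) (hf : Function.Injective f)
    {g : Fin k → Fin n} (hg : Function.Injective g) : colMinor (chart A f) g ≠ 0 := by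
  have := h.colMinor_ne_zero g hg
  rw [colMinor_eq_mul_chart (h.colMinor_ne_zero f hf) g] at this
  exact right_ne_zero_of_mul this

/-- Relative to the identity block, entries and 2 × 2 minors are maximal minors with one or two
columns exchanged, so the hypotheses on maximal minors carry over. -/
theorem MonomialTerms.monomialPair (h : MonomialTerms d L A) (hf : Function.Injective f)
    (hLf : colMinor L f ≠ 0) :
    MonomialPair d (fun p (γ : OffRange f) => chart A f p γ) (fun p γ => chart L f p γ) where
  ne_zero p α := by
    rw [← colMinor_update (submatrix_chart (h.colMinor_ne_zero f hf))]
    exact h.chart_ne_zero hf (injective_update hf p α.2)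
  minor_ne_zero p q α β hpq hαβ := by
    rw [← colMinor_update_update (submatrix_chart (h.colMinor_ne_zero f hf)) hpq]
    exact h.chart_ne_zero hf (injective_update (injective_update hf p α.2) q
      (update_ne β.2 (Subtype.coe_ne_coe.2 hαβ)))
  entry p α := by
    rw [← colMinor_update (submatrix_chart (h.colMinor_ne_zero f hf)),
      ← colMinor_update (submatrix_chart hLf)]
    exact h.isMonomial_chart hf hLf (injective_update hf p α.2)
  minor p q α β hpq hαβ := by
    rw [← colMinor_update_update (submatrix_chart (h.colMinor_ne_zero f hf)) hpq,
      ← colMinor_update_update (submatrix_chart hLf) hpq]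
    exact h.isMonomial_chart hf hLf (injective_update (injective_update hf p α.2) q
      (update_ne β.2 (Subtype.coe_ne_coe.2 hαβ)))

theorem MonomialTerms.exists_chart_ne_zero (h : MonomialTerms d L A) (hLf : colMinor L f ≠ 0)
    (γ : Fin n) : ∃ m, chart L f m γ ≠ 0 := by
  by_contra! h0
  obtain ⟨a, ha⟩ := h.column_ne_zero γ
  apply ha
  rw [← mul_chart hLf, Matrix.mul_apply]
  exact Finset.sum_eq_zero fun m _ => by rw [h0, mul_zero]

/-- The rows in C are unconstrained off the identity block, but g contains their identity columns,
so they contribute only a unit vector. What remains is a matrix over M with rescaled rows and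
columns, whose determinant is the product of the scalings and an element of M. -/
theorem exists_colMinor_eq_of_rank_one {F : Type*} [Field F] [Algebra F K]
    {M : IntermediateField F K} {X : Matrix (Fin k) (Fin n) K} (hX : X.submatrix id f = 1)
    {C : Set (Fin k)} {r : Fin k → K} {s : Fin n → K} (hr : ∀ m, r m ≠ 0)
    (hs : ∀ a, s (f a) = (r a)⁻¹)
    (hM : ∀ m ∉ C, ∀ γ, (∀ a, f a ≠ γ) → ∃ w ∈ M, X m γ = r m * w * s γ)
    {g : Fin k → Fin n} (hg : ∀ c ∈ C, ∃ a, g a = f c) :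
    ∃ w ∈ M, colMinor X g = (∏ m, r m) * (∏ a, s (g a)) * w := by
  classical
  have hXf : ∀ m a, X m (f a) = if m = a then 1 else 0 := fun m a => by
    have := congrFun (congrFun hX m) a
    rwa [Matrix.one_apply] at this
  let X' : Matrix (Fin k) (Fin n) K := fun m γ => if m ∈ C ∧ ∀ a, f a ≠ γ then 0 else X m γ
  have hX'f : ∀ m a, X' m (f a) = X m (f a) := fun m a => if_neg fun h => h.2 a rfl
  have hdet : colMinor X g = colMinor X' g := by
    unfold colMinor
    rw [Matrix.det_apply, Matrix.det_apply]
    refine Finset.sum_congr rfl fun σ _ => ?_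
    congr 1
    simp only [Matrix.submatrix_apply, id]
    -- A Leibniz term that uses an off-block entry of a row in C must pair that row's identity
    -- column with another row, where the entry is zero.
    by_cases hσ : ∃ a, σ a ∈ C ∧ ∀ b, f b ≠ g a
    · obtain ⟨a, ha, hoff⟩ := hσ
      obtain ⟨b, hb⟩ := hg _ ha
      have hba : b ≠ a := fun h => hoff (σ a) (by rw [← hb, h])
      have hz : X (σ b) (g b) = 0 := by
        rw [hb, hXf, if_neg fun h => hba (σ.injective h)]
      rw [Finset.prod_eq_zero (Finset.mem_univ b) hz, Finset.prod_eq_zero (Finset.mem_univ b)]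
      rw [hb, hX'f, ← hb, hz]
    · push Not at hσ
      refine Finset.prod_congr rfl fun a _ => (if_neg fun h => ?_).symm
      obtain ⟨b, hb⟩ := hσ a h.1
      exact h.2 b hb
  have hW : ∀ m γ, ∃ w ∈ M, X' m γ = r m * w * s γ := by
    intro m γ
    by_cases hγ : ∃ a, f a = γ
    · obtain ⟨a, rfl⟩ := hγ
      rw [hX'f, hXf, hs]
      by_cases hm : m = a
      · subst hm
        exact ⟨1, one_mem _, by rw [if_pos rfl, mul_one, mul_inv_cancel₀ (hr m)]⟩
      · exact ⟨0, zero_mem _, by rw [if_neg hm, mul_zero, zero_mul]⟩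
    · push Not at hγ
      by_cases hm : m ∈ C
      · exact ⟨0, zero_mem _, by rw [mul_zero, zero_mul]; exact if_pos ⟨hm, hγ⟩⟩
      · obtain ⟨w, hw, e⟩ := hM m hm γ hγ
        exact ⟨w, hw, by rw [← e]; exact if_neg fun h => hm h.1⟩
  choose W hWM hW using hW
  refine ⟨(Matrix.of fun m a => W m (g a)).det, ?_, ?_⟩
  · rw [Matrix.det_apply']
    exact sum_mem fun σ _ => mul_mem (intCast_mem _ _) (prod_mem fun a _ => hWM _ _)
  · rw [hdet]
    have : X'.submatrix id g = Matrix.diagonal r * (Matrix.of fun m a => W m (g a)) *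
        Matrix.diagonal fun a => s (g a) := by
      ext m a
      rw [Matrix.mul_diagonal, Matrix.diagonal_mul, Matrix.submatrix_apply, id, hW]
      rfl
    unfold colMinor
    rw [this, Matrix.det_mul, Matrix.det_mul, Matrix.det_diagonal, Matrix.det_diagonal]
    ring

theorem exists_eq_of_colMinor_ne_zero {Z : Matrix (Fin k) (Fin n) K} (hZ : Z.submatrix id f = 1)
    {c : Fin k} (hc : ∀ γ, (∀ a, f a ≠ γ) → Z c γ = 0) {g : Fin k → Fin n}
    (hg : colMinor Z g ≠ 0) : ∃ a, g a = f c := by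
  by_contra! h
  apply hg
  unfold colMinor
  refine Matrix.det_eq_zero_of_row_eq_zero c fun a => ?_
  rw [Matrix.submatrix_apply, id]
  by_cases ha : ∃ b, f b = g a
  · obtain ⟨b, hb⟩ := ha
    have hbc : c ≠ b := by
      rintro rfl
      exact h a hb.symm
    rw [← hb]
    have := congrFun (congrFun hZ c) b
    rwa [Matrix.one_apply_ne hbc] at this
  · push Not at ha
    exact hc _ ha

theorem prod_update_mul {s : Fin n → K} (g : Fin k → Fin n) (p : Fin k) (α : Fin n) :
    (∏ a, s (Function.update g p α a)) * s (g p) = s α * ∏ a, s (g a) := by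
  rw [← Finset.mul_prod_erase _ _ (Finset.mem_univ p),
    ← Finset.mul_prod_erase Finset.univ (fun a => s (g a)) (Finset.mem_univ p),
    Function.update_self, Finset.prod_congr rfl fun a ha => by
      rw [Function.update_of_ne (Finset.ne_of_mem_erase ha)]]
  ring

/-- The ratio of four maximal minors whose value is a cross-ratio of the chart at `g`. -/
noncomputable def minorRatio (A : Matrix (Fin k) (Fin n) K) (g : Fin k → Fin n) (p q : Fin k)
    (α β : Fin n) : K :=
  colMinor A (Function.update g p α) * colMinor A (Function.update g q β) /
    (colMinor A (Function.update g p β) * colMinor A (Function.update g q α))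

theorem minorRatio_eq_crossRatio (hA : colMinor A f ≠ 0) (p q : Fin k) (α β : OffRange f) :
    minorRatio A f p q α β = crossRatio (fun p (γ : OffRange f) => chart A f p γ) p q α β := by
  unfold minorRatio crossRatio
  simp only [fun p γ => colMinor_eq_mul_chart hA (Function.update f p γ),
    colMinor_update (submatrix_chart hA)]
  rw [mul_mul_mul_comm, mul_mul_mul_comm (colMinor A f) (chart A f p β)]
  exact mul_div_mul_left _ _ (mul_ne_zero hA hA)

/-- Each of the four minors is a product of scalings times an element of M; the row scalings and the
minor at f cancel, and so do the column scalings. -/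
theorem MonomialTerms.minorRatio_mem (h : MonomialTerms d L A) (hf : Function.Injective f)
    (hLf : colMinor L f ≠ 0) {i j : Fin k} {α β : OffRange f} (hiα : chart L f i α ≠ 0)
    (hiβ : chart L f i β ≠ 0) (hjα : chart L f j α ≠ 0) (hjβ : chart L f j β ≠ 0)
    (hc : minorRatio A f i j α β ∉ (⊥ : IntermediateField (LaurentField d) K))
    {M : IntermediateField (LaurentField d) K} (hM : minorRatio A f i j α β ∈ M)
    {g : Fin k → Fin n} {p q : Fin k} {γ δ : Fin n} (hg : Function.Injective g)
    (hγ : ∀ a, g a ≠ γ) (hδ : ∀ a, g a ≠ δ)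
    (h₁ : colMinor L (Function.update g p γ) ≠ 0) (h₂ : colMinor L (Function.update g q δ) ≠ 0)
    (h₃ : colMinor L (Function.update g p δ) ≠ 0) (h₄ : colMinor L (Function.update g q γ) ≠ 0) :
    minorRatio A g p q γ δ ∈ M := by
  have hAf := h.colMinor_ne_zero f hf
  have hpair := h.monomialPair hf hLf
  rw [minorRatio_eq_crossRatio hAf] at hc hM
  have hdich := hpair.row_dichotomy (fun γ => h.exists_chart_ne_zero hLf γ) hiα hiβ hjα hjβ hc hM
  -- With these scalings an off-block entry is r · w · s, where w is its cross-ratio with row i and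
  -- column α. On the block, s inverts r so that the identity matrix has the same shape.
  let r : Fin k → K := fun m => chart A f m α / chart A f i α
  let s : Fin n → K := Function.extend f (fun a => (r a)⁻¹) (fun γ => chart A f i γ)
  have hr : ∀ m, r m ≠ 0 := fun m => div_ne_zero (hpair.ne_zero m α) (hpair.ne_zero i α)
  have hsf : ∀ a, s (f a) = (r a)⁻¹ := fun a => hf.extend_apply _ _ a
  have hsn : ∀ γ, (∀ a, f a ≠ γ) → s γ = chart A f i γ := fun γ hγ =>
    Function.extend_apply' _ _ _ (by push Not; exact hγ)
  have hs : ∀ γ, s γ ≠ 0 := fun γ => by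
    by_cases hγ : ∃ a, f a = γ
    · obtain ⟨a, rfl⟩ := hγ
      rw [hsf]
      exact inv_ne_zero (hr a)
    · push Not at hγ
      rw [hsn γ hγ]
      exact hpair.ne_zero i ⟨γ, hγ⟩
  -- A nonzero minor of L must use the identity columns of all zero rows of its chart, which is the
  -- condition needed to ignore these rows.
  have key : ∀ g' : Fin k → Fin n, colMinor L g' ≠ 0 →
      ∃ w ∈ M, colMinor A g' = colMinor A f * ((∏ m, r m) * (∏ a, s (g' a)) * w) := by
    intro g' hg'
    rw [colMinor_eq_mul_chart hLf] at hg'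
    obtain ⟨w, hw, e⟩ := exists_colMinor_eq_of_rank_one (M := M) (g := g')
      (C := {m | ∀ γ : OffRange f, chart L f m γ = 0}) (submatrix_chart hAf) hr hsf
      (fun m hm γ hγ => by
        have := ((hdich m).resolve_left hm ⟨γ, hγ⟩).2
        refine ⟨_, this, ?_⟩
        rw [hsn γ hγ]
        have := hpair.ne_zero i α
        have := hpair.ne_zero m α
        have := hpair.ne_zero i ⟨γ, hγ⟩
        simp only [crossRatio, r]
        field_simp)
      (fun c hc => exists_eq_of_colMinor_ne_zero (submatrix_chart hLf)
        (fun γ hγ => hc ⟨γ, hγ⟩) (right_ne_zero_of_mul hg'))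
    exact ⟨w, hw, by rw [← e, ← colMinor_eq_mul_chart hAf]⟩
  obtain ⟨w₁, m₁, e₁⟩ := key _ h₁
  obtain ⟨w₂, m₂, e₂⟩ := key _ h₂
  obtain ⟨w₃, m₃, e₃⟩ := key _ h₃
  obtain ⟨w₄, m₄, e₄⟩ := key _ h₄
  have u₁ := prod_update_mul (s := s) g p γ
  have u₂ := prod_update_mul (s := s) g q δ
  have u₃ := prod_update_mul (s := s) g p δ
  have u₄ := prod_update_mul (s := s) g q γ
  have n₃ := h.colMinor_ne_zero _ (injective_update hg p hδ)
  have n₄ := h.colMinor_ne_zero _ (injective_update hg q hγ)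
  have : minorRatio A g p q γ δ = w₁ * w₂ / (w₃ * w₄) := by
    have hp := hs (g p); have hq := hs (g q)
    unfold minorRatio
    rw [e₃] at n₃
    rw [e₄] at n₄
    have hw₃ := right_ne_zero_of_mul (right_ne_zero_of_mul n₃)
    have hw₄ := right_ne_zero_of_mul (right_ne_zero_of_mul n₄)
    rw [e₁, e₂, e₃, e₄, div_eq_div_iff (mul_ne_zero n₃ n₄) (mul_ne_zero hw₃ hw₄)]
    -- Both sides run over the same columns with multiplicity.
    have hprod : (∏ a, s (Function.update g p γ a)) * (∏ a, s (Function.update g q δ a)) =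
        (∏ a, s (Function.update g p δ a)) * ∏ a, s (Function.update g q γ a) := by
      apply mul_right_cancel₀ (mul_ne_zero hp hq)
      calc _ = (s γ * ∏ a, s (g a)) * (s δ * ∏ a, s (g a)) := by rw [← u₁, ← u₂]; ring
        _ = (s δ * ∏ a, s (g a)) * (s γ * ∏ a, s (g a)) := by ring
        _ = _ := by rw [← u₃, ← u₄]; ring
    linear_combination (colMinor A f ^ 2 * (∏ m, r m) ^ 2 * w₁ * w₂ * w₃ * w₄) * hprod
  rw [this]
  exact div_mem (mul_mem m₁ m₂) (mul_mem m₃ m₄)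

end

/-! ### The terms of a basis in a chart -/

section

variable {d k n : ℕ} {K : Type*} [Field K] {L : Matrix (Fin k) (Fin n) K}
  {R : Matrix (Fin n) (Fin k) K} {f : Fin k → Fin n}

theorem cast_sign_mul_self {g : Fin k → Fin n} (hg : Function.Injective g) :
    (((indexVandermonde g).sign : ℤ) : K) * ((indexVandermonde g).sign : ℤ) = 1 := by
  exact_mod_cast congrArg (Int.cast : ℤ → K) (sign_mul_self (indexVandermonde_ne_zero hg))

/-- The sign in the Y-term is exactly what the sorting of the four exchanged column sequences
produces, except for a factor -1. -/
theorem yTerm_image (hf : Function.Injective f) {p q : Fin k} (hpq : p ≠ q) {α β : Fin n}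
    (hα : ∀ a, f a ≠ α) (hβ : ∀ a, f a ≠ β) (hαβ : α ≠ β) :
    yTerm R (Finset.univ.image f) (f p) (f q) α β = -minorRatio R.transpose f p q α β := by
  have i₁ := injective_update hf p hα
  have i₂ := injective_update hf q hβ
  have i₃ := injective_update hf p hβ
  have i₄ := injective_update hf q hα
  unfold yTerm minorRatio
  rw [sign_indexVandermonde_update p q hα hβ hf hpq hαβ, ← image_update hf, ← image_update hf,
    ← image_update hf, ← image_update hf, colMinor_eq _ i₁, colMinor_eq _ i₂, colMinor_eq _ i₃,
    colMinor_eq _ i₄]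
  have w₃ := inv_eq_of_mul_eq_one_left (cast_sign_mul_self (K := K) i₃)
  have w₄ := inv_eq_of_mul_eq_one_left (cast_sign_mul_self (K := K) i₄)
  simp only [div_eq_mul_inv, mul_inv]
  rw [w₃, w₄]
  push_cast
  ring

theorem chi_image (hf : Function.Injective f) {p q : Fin k} (hpq : p ≠ q) {α β : Fin n}
    (hα : ∀ a, f a ≠ α) (hβ : ∀ a, f a ≠ β) (hαβ : α ≠ β) (hLf : colMinor L f ≠ 0)
    (hRf : colMinor R.transpose f ≠ 0) :
    chi L R (Finset.univ.image f) (f p) (f q) α β = fun s =>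
      (colMinor L f * colMinor R.transpose f) ^ 2 *
      (![(chart R.transpose f p α * chart R.transpose f q β -
          chart R.transpose f p β * chart R.transpose f q α) *
          (chart L f p α * chart L f q β - chart L f p β * chart L f q α),
        chart R.transpose f p α * chart L f p α * (chart R.transpose f q β * chart L f q β),
        chart R.transpose f p β * chart L f p β *
          (chart R.transpose f q α * chart L f q α)] : Fin 3 → K) s := by
  have i₁ := injective_update hf p hα
  have i₂ := injective_update hf q hβ
  have i₃ := injective_update hf p hβ
  have i₄ := injective_update hf q hα
  have i₅ := injective_update i₁ q (update_ne (p := p) hβ hαβ)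
  have sL := submatrix_chart hLf
  have sR := submatrix_chart hRf
  unfold chi
  rw [← image_update_update hf hpq hα, ← image_update hf, ← image_update hf, ← image_update hf,
    ← image_update hf, term_image L R hf, term_image L R i₁, term_image L R i₂, term_image L R i₃,
    term_image L R i₄, term_image L R i₅]
  simp only [fun g => colMinor_eq_mul_chart hLf (Function.update f p g),
    fun g => colMinor_eq_mul_chart hLf (Function.update f q g),
    fun g => colMinor_eq_mul_chart hRf (Function.update f p g),
    fun g => colMinor_eq_mul_chart hRf (Function.update f q g),
    colMinor_eq_mul_chart hLf (Function.update (Function.update f p α) q β),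
    colMinor_eq_mul_chart hRf (Function.update (Function.update f p α) q β),
    colMinor_update sL, colMinor_update sR, colMinor_update_update sL hpq,
    colMinor_update_update sR hpq]
  funext s
  fin_cases s <;> simp <;> ring

variable [Algebra (LaurentField d) K]

theorem monomialTerms (hR : ∀ I : Finset (Fin n), I.card = k → minor R.transpose I ≠ 0)
    (hL : ∀ ω : Fin n, ∃ a : Fin k, L a ω ≠ 0)
    (hmon : ∀ I : Finset (Fin n), I.card = k →
      ∃ (e : Fin d → ℤ) (g : ℂ), term L R I = toExt K (AddMonoidAlgebra.single e g)) :
    MonomialTerms d L R.transpose where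
  colMinor_ne_zero g hg := by
    rw [colMinor_eq _ hg]
    exact mul_ne_zero (left_ne_zero_of_mul_eq_one (cast_sign_mul_self hg))
      (hR _ (card_image_of_injective hg))
  column_ne_zero := hL
  isMonomial g hg := by
    rw [← term_image L R hg]
    exact hmon _ (card_image_of_injective hg)

theorem IsRadicalTerm.exists_fn {J : Finset (Fin n)} {m l γ δ : Fin n}
    (h : IsRadicalTerm d L R J m l γ δ) : ∃ (f : Fin k → Fin n) (p q : Fin k),
      Function.Injective f ∧ Finset.univ.image f = J ∧ f p = m ∧ f q = l ∧ p ≠ q ∧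
      (∀ a, f a ≠ γ) ∧ ∀ a, f a ≠ δ := by
  have himg : Finset.univ.image (J.orderEmbOfFin h.card_eq) = J := by
    apply Finset.coe_injective
    rw [Finset.coe_image, Finset.coe_univ, Set.image_univ, Finset.range_orderEmbOfFin]
  obtain ⟨p, -, hp⟩ := Finset.mem_image.1 (himg.symm ▸ h.mem_i)
  obtain ⟨q, -, hq⟩ := Finset.mem_image.1 (himg.symm ▸ h.mem_j)
  refine ⟨_, p, q, (J.orderEmbOfFin h.card_eq).injective, himg, hp, hq, ?_, ?_, ?_⟩
  · rintro rfl
    exact h.ne_ij (hp.symm.trans hq)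
  · exact fun a ha => h.not_mem_α (ha ▸ J.orderEmbOfFin_mem h.card_eq a)
  · exact fun a ha => h.not_mem_β (ha ▸ J.orderEmbOfFin_mem h.card_eq a)

/-- A radical term in the chart of its basis. -/
theorem IsRadicalTerm.chart_data (hLR : MonomialTerms d L R.transpose) {p q : Fin k} {α β : Fin n}
    (hf : Function.Injective f) (hpq : p ≠ q) (hα : ∀ a, f a ≠ α) (hβ : ∀ a, f a ≠ β)
    (h : IsRadicalTerm d L R (Finset.univ.image f) (f p) (f q) α β) :
    colMinor L f ≠ 0 ∧ (chart L f p α ≠ 0 ∧ chart L f p β ≠ 0 ∧ chart L f q α ≠ 0 ∧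
      chart L f q β ≠ 0) ∧
      minorRatio R.transpose f p q α β ∉ (⊥ : IntermediateField (LaurentField d) K) ∧
      ∃ E : Fin 3 → (Laurent d)ˣ,
        (∀ s, toExt K (E s : Laurent d) = chi L R (Finset.univ.image f) (f p) (f q) α β s) ∧
        Defines E (yTerm R (Finset.univ.image f) (f p) (f q) α β) := by
  have hRf := hLR.colMinor_ne_zero f hf
  have h0 := h.chi_ne_zero 0
  have h1 := h.chi_ne_zero 1
  have h2 := h.chi_ne_zero 2
  have hLf : colMinor L f ≠ 0 := by
    have h3 : term L R (Finset.univ.image f) ≠ 0 := left_ne_zero_of_mul h0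
    rw [term_image L R hf] at h3
    exact left_ne_zero_of_mul h3
  have hchi := chi_image (L := L) hf hpq hα hβ h.ne_αβ hLf hRf
  have hY := yTerm_image (R := R) hf hpq hα hβ h.ne_αβ
  have hpair := hLR.monomialPair hf hLf
  have hne := hchi ▸ h.chi_ne_zero
  refine ⟨hLf, ?_, ?_, ?_⟩
  · have h1 := hne 1
    have h2 := hne 2
    simp only [Matrix.cons_val, ne_eq, mul_eq_zero, not_or] at h1 h2
    exact ⟨h1.2.1.2, h2.2.1.2, h2.2.2.2, h1.2.2.2⟩
  · have := h.not_mem_field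
    rw [hY] at this
    intro hm
    exact this (IntermediateField.mem_bot.1 (neg_mem hm))
  · have hmono : ∀ s, IsMonomial d (chi L R (Finset.univ.image f) (f p) (f q) α β s) := by
      rw [hchi]
      have hh := hLR.isMonomial f hf
      intro s
      dsimp only
      rw [pow_two]
      refine (hh.mul hh).mul ?_
      fin_cases s
      · exact hpair.minor p q ⟨α, hα⟩ ⟨β, hβ⟩ hpq (fun e => h.ne_αβ (congrArg Subtype.val e))
      · exact (hpair.entry p ⟨α, hα⟩).mul (hpair.entry q ⟨β, hβ⟩)
      · exact (hpair.entry p ⟨β, hβ⟩).mul (hpair.entry q ⟨α, hα⟩)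
    choose E hE using fun s => (hmono s).exists_unit (h.chi_ne_zero s)
    refine ⟨E, hE, ?_⟩
    have hq := hpair.quadratic p q ⟨α, hα⟩ ⟨β, hβ⟩
    unfold Defines
    rw [map_sub, map_sub, hE, hE, hE, hchi, hY,
      minorRatio_eq_crossRatio hRf p q ⟨α, hα⟩ ⟨β, hβ⟩]
    simp only [Matrix.cons_val]
    linear_combination (colMinor L f * colMinor R.transpose f) ^ 2 * hq

end

/-! ### Squarefree parts -/

theorem exists_eq_sq_mul_squarefree {S : Type*} [CommRing S] [IsDomain S]
    [UniqueFactorizationMonoid S] {b : S} (hb : b ≠ 0) :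
    ∃ Q D : S, Squarefree D ∧ b = Q ^ 2 * D := by
  induction b using WfDvdMonoid.induction_on_irreducible with
  | zero => exact absurd rfl hb
  | unit u hu => exact ⟨1, u, hu.squarefree, by rw [one_pow, one_mul]⟩
  | mul a p ha hp ih =>
    obtain ⟨Q, D, hD, rfl⟩ := ih ha
    by_cases hpD : p ∣ D
    · obtain ⟨D', rfl⟩ := hpD
      exact ⟨p * Q, D', hD.squarefree_of_dvd (dvd_mul_left _ _), by ring⟩
    · exact ⟨Q, p * D, squarefree_mul_iff.2 ⟨hp.isRelPrime_iff_not_dvd.2 hpD, hp.squarefree, hD⟩,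
        by ring⟩

/-- For c = u/v in lowest terms, v² divides D, so squarefreeness makes v a unit. -/
theorem exists_algebraMap_eq_of_sq_mul {S F : Type*} [CommRing S] [IsDomain S]
    [UniqueFactorizationMonoid S] [Field F] [Algebra S F] [IsFractionRing S F] {B D : S}
    (hD : Squarefree D) {c : F} (h : algebraMap S F B = c ^ 2 * algebraMap S F D) :
    ∃ Q : S, algebraMap S F Q = c ∧ B = Q ^ 2 * D := by
  have hinj := IsFractionRing.injective S F
  obtain ⟨u, v, huv, rfl⟩ := IsFractionRing.exists_reduced_fraction (A := S) c
  have hv : algebraMap S F v ≠ 0 := IsFractionRing.to_map_ne_zero_of_mem_nonZeroDivisors v.2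
  have h' : (v : S) ^ 2 * B = u ^ 2 * D := by
    apply hinj
    rw [map_mul, map_mul, map_pow, map_pow, h, IsFractionRing.mk'_eq_div]
    field_simp
  have hvu : IsUnit (v : S) := by
    apply hD
    rw [← pow_two]
    exact (huv.symm.pow_left.pow_right : IsRelPrime ((v : S) ^ 2) (u ^ 2)).dvd_of_dvd_mul_left
      ⟨B, h'.symm⟩
  obtain ⟨w, hw⟩ := hvu.exists_right_inv
  refine ⟨u * w, ?_, ?_⟩
  · have := congrArg (algebraMap S F) hw
    rw [map_mul, map_one] at this
    rw [map_mul, IsFractionRing.mk'_eq_div, eq_div_iff hv]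
    linear_combination (algebraMap S F u) * this
  · linear_combination w ^ 2 * h' - (B * ((v : S) * w + 1)) * hw

/-! ### Quadratic extensions -/

theorem exists_eq_add_mul_of_mem_adjoin {F K : Type*} [Field F] [Field K] [Algebra F K] {Y s : K}
    (hs : s ∉ (⊥ : IntermediateField F K)) (hs2 : s ^ 2 ∈ (⊥ : IntermediateField F K))
    (hY : ∃ a ∈ (⊥ : IntermediateField F K), ∃ b ∈ (⊥ : IntermediateField F K), Y = a + b * s)
    {y : K} (hy : y ∈ IntermediateField.adjoin F {Y}) :
    ∃ a ∈ (⊥ : IntermediateField F K), ∃ b ∈ (⊥ : IntermediateField F K), y = a + b * s := by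
  induction hy using IntermediateField.adjoin_induction with
  | mem x hx => rwa [Set.mem_singleton_iff.1 hx]
  | algebraMap x =>
    exact ⟨_, IntermediateField.algebraMap_mem _ x, 0, zero_mem _, by rw [zero_mul, add_zero]⟩
  | add x y _ _ hx hy =>
    obtain ⟨a, ha, b, hb, rfl⟩ := hx
    obtain ⟨a', ha', b', hb', rfl⟩ := hy
    exact ⟨a + a', add_mem ha ha', b + b', add_mem hb hb', by ring⟩
  | mul x y _ _ hx hy =>
    obtain ⟨a, ha, b, hb, rfl⟩ := hx
    obtain ⟨a', ha', b', hb', rfl⟩ := hy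
    exact ⟨a * a' + b * b' * s ^ 2, add_mem (mul_mem ha ha') (mul_mem (mul_mem hb hb') hs2),
      a * b' + a' * b, add_mem (mul_mem ha hb') (mul_mem ha' hb), by ring⟩
  | inv x _ hx =>
    obtain ⟨a, ha, b, hb, rfl⟩ := hx
    by_cases h0 : a + b * s = 0
    · exact ⟨0, zero_mem _, 0, zero_mem _, by rw [h0, inv_zero, zero_mul, add_zero]⟩
    have h1 : a - b * s ≠ 0 := fun h1 => by
      by_cases hb0 : b = 0
      · subst hb0
        exact h0 (by linear_combination h1)
      · apply hs
        rw [show s = a / b by field_simp; linear_combination -h1]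
        exact div_mem ha hb
    have hN : a ^ 2 - b ^ 2 * s ^ 2 ≠ 0 := by
      rw [show a ^ 2 - b ^ 2 * s ^ 2 = (a + b * s) * (a - b * s) by ring]
      exact mul_ne_zero h0 h1
    have hNm := sub_mem (pow_mem ha 2) (mul_mem (pow_mem hb 2) hs2)
    refine ⟨_, div_mem ha hNm, _, div_mem (neg_mem hb) hNm, ?_⟩
    rw [inv_eq_iff_eq_inv, eq_comm]
    refine inv_eq_of_mul_eq_one_left ?_
    field_simp
    ring

/-- The square of a + bs contains 2abs, which is rational only if ab = 0; and b = 0 would make a +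
bs rational. -/
theorem eq_mul_of_sq_mem_bot {F K : Type*} [Field F] [Field K] [Algebra F K] [CharZero F]
    {a b s : K} (hs : s ∉ (⊥ : IntermediateField F K)) (hs2 : s ^ 2 ∈ (⊥ : IntermediateField F K))
    (ha : a ∈ (⊥ : IntermediateField F K)) (hb : b ∈ (⊥ : IntermediateField F K))
    (ht2 : (a + b * s) ^ 2 ∈ (⊥ : IntermediateField F K))
    (ht : a + b * s ∉ (⊥ : IntermediateField F K)) : a = 0 := by
  by_contra ha0
  have : CharZero K := charZero_of_injective_algebraMap (algebraMap F K).injective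
  by_cases hb0 : b = 0
  · subst hb0
    apply ht
    rwa [zero_mul, add_zero]
  apply hs
  rw [show s = ((a + b * s) ^ 2 - a ^ 2 - b ^ 2 * s ^ 2) / (2 * a * b) by field_simp; ring]
  exact div_mem (sub_mem (sub_mem ht2 (pow_mem ha 2)) (mul_mem (pow_mem hb 2) hs2))
    (mul_mem (mul_mem (ofNat_mem _ 2) ha) hb)

/-! ### Triples that define elements -/

section

variable {d : ℕ} {K : Type*} [Field K] [Algebra (LaurentField d) K]

theorem charZero_extension (d : ℕ) (K : Type*) [Field K] [Algebra (LaurentField d) K] :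
    CharZero K :=
  have : CharZero (Laurent d) := charZero_of_injective_algebraMap (algebraMap ℂ _).injective
  charZero_of_injective_ringHom (toExt_injective (d := d) (K := K))

theorem Defines.sq_eq {E : Fin 3 → (Laurent d)ˣ} {y : K} (h : Defines E y) :
    (2 * toExt K (E 2 : Laurent d) * y -
      toExt K ((E 0 : Laurent d) - (E 1 : Laurent d) - (E 2 : Laurent d))) ^ 2 =
      toExt K (bFun (E 0 : Laurent d) (E 1 : Laurent d) (E 2 : Laurent d)) := by
  unfold Defines at h
  unfold bFun
  simp only [map_sub, map_mul, map_pow, map_ofNat] at h ⊢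
  linear_combination 4 * toExt K (E 2 : Laurent d) * h

theorem toExt_unit_ne_zero (u : (Laurent d)ˣ) : toExt K (u : Laurent d) ≠ 0 :=
  (u.isUnit.map (toExt K)).ne_zero

theorem two_mul_sub_mem_bot_iff (E : Fin 3 → (Laurent d)ˣ) (y : K) (A : Laurent d) :
    2 * toExt K (E 2 : Laurent d) * y - toExt K A ∈ (⊥ : IntermediateField (LaurentField d) K) ↔
      y ∈ (⊥ : IntermediateField (LaurentField d) K) := by
  have := charZero_extension d K
  have h2 := toExt_unit_ne_zero (K := K) (E 2)
  have hm : 2 * toExt K (E 2 : Laurent d) ∈ (⊥ : IntermediateField (LaurentField d) K) :=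
    mul_mem (ofNat_mem _ 2) (toExt_mem_bot _)
  constructor
  · intro h
    rw [show y = (2 * toExt K (E 2 : Laurent d) * y - toExt K A + toExt K A) /
      (2 * toExt K (E 2 : Laurent d)) by field_simp; ring]
    exact div_mem (add_mem h (toExt_mem_bot _)) hm
  · exact fun h => sub_mem (mul_mem hm h) (toExt_mem_bot _)

theorem Defines.mem_bot_of_eq_sq {E : Fin 3 → (Laurent d)ˣ} {y : K} (h : Defines E y)
    {q : Laurent d} (hq : bFun (E 0 : Laurent d) (E 1 : Laurent d) (E 2 : Laurent d) = q ^ 2) :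
    y ∈ (⊥ : IntermediateField (LaurentField d) K) := by
  have hs := h.sq_eq
  rw [hq, map_pow] at hs
  rw [← two_mul_sub_mem_bot_iff E]
  rcases sq_eq_sq_iff_eq_or_eq_neg.1 hs with h | h
  · rw [h]; exact toExt_mem_bot _
  · rw [h]; exact neg_mem (toExt_mem_bot _)

theorem Defines.discriminant_ne_sq {E : Fin 3 → (Laurent d)ˣ} {Y : K} (h : Defines E Y)
    (hY : Y ∉ (⊥ : IntermediateField (LaurentField d) K)) {D Q : Laurent d}
    (hB : bFun (E 0 : Laurent d) (E 1 : Laurent d) (E 2 : Laurent d) = Q ^ 2 * D)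
    (x y : Laurent d) (hy : y ≠ 0) : y ^ 2 * D ≠ x ^ 2 := by
  intro hxy
  apply hY
  have hy' : toExt K y ≠ 0 := fun h0 => hy (toExt_injective (d := d) (by rw [h0, map_zero]))
  have hs := h.sq_eq
  have hD : toExt K y ^ 2 * toExt K D = toExt K x ^ 2 := by
    rw [← map_pow, ← map_mul, hxy, map_pow]
  have hs' : (2 * toExt K (E 2 : Laurent d) * Y -
      toExt K ((E 0 : Laurent d) - (E 1 : Laurent d) - (E 2 : Laurent d))) ^ 2 =
      (toExt K Q * toExt K x / toExt K y) ^ 2 := by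
    rw [hs, hB, map_mul, map_pow, div_pow, mul_pow, ← hD]
    field_simp
  have hm : toExt K Q * toExt K x / toExt K y ∈ (⊥ : IntermediateField (LaurentField d) K) :=
    div_mem (mul_mem (toExt_mem_bot _) (toExt_mem_bot _)) (toExt_mem_bot _)
  rw [← two_mul_sub_mem_bot_iff E]
  rcases sq_eq_sq_iff_eq_or_eq_neg.1 hs' with h | h
  · rw [h]; exact hm
  · rw [h]; exact neg_mem hm

theorem Defines.exists_eq_add_mul {E : Fin 3 → (Laurent d)ˣ} {Y : K} (h : Defines E Y)
    (hY : Y ∉ (⊥ : IntermediateField (LaurentField d) K)) {y : K}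
    (hy : y ∈ IntermediateField.adjoin (LaurentField d) {Y}) :
    ∃ a ∈ (⊥ : IntermediateField (LaurentField d) K),
      ∃ b ∈ (⊥ : IntermediateField (LaurentField d) K),
      y = a + b * (2 * toExt K (E 2 : Laurent d) * Y -
        toExt K ((E 0 : Laurent d) - (E 1 : Laurent d) - (E 2 : Laurent d))) := by
  have := charZero_extension d K
  have h2 := toExt_unit_ne_zero (K := K) (E 2)
  have hm : 2 * toExt K (E 2 : Laurent d) ∈ (⊥ : IntermediateField (LaurentField d) K) :=
    mul_mem (ofNat_mem _ 2) (toExt_mem_bot _)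
  refine exists_eq_add_mul_of_mem_adjoin ((two_mul_sub_mem_bot_iff E _ _).not.2 hY)
    (by rw [h.sq_eq]; exact toExt_mem_bot _) ⟨_, div_mem (toExt_mem_bot
    ((E 0 : Laurent d) - (E 1 : Laurent d) - (E 2 : Laurent d))) hm, _, inv_mem hm, ?_⟩ hy
  field_simp
  ring

/-- A triple that defines an irrational element of the field generated by `Y` belongs to the
configurations of the squarefree part of the discriminant of `Y`. -/
theorem Defines.mk_mem_configurations {E E' : Fin 3 → (Laurent d)ˣ} {Y y : K} (h : Defines E Y)
    (hY : Y ∉ (⊥ : IntermediateField (LaurentField d) K)) {D Q : Laurent d} (hD : Squarefree D)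
    (hB : bFun (E 0 : Laurent d) (E 1 : Laurent d) (E 2 : Laurent d) = Q ^ 2 * D)
    (hy : y ∈ IntermediateField.adjoin (LaurentField d) {Y})
    (hy' : y ∉ (⊥ : IntermediateField (LaurentField d) K)) (h' : Defines E' y) :
    Configuration.mk E' ∈ configurations D := by
  have hs2 := h.sq_eq
  have ht2 := h'.sq_eq
  obtain ⟨a, ha, b, hb, e⟩ := h.exists_eq_add_mul hY hy
  have hs := (two_mul_sub_mem_bot_iff E Y
    ((E 0 : Laurent d) - (E 1 : Laurent d) - (E 2 : Laurent d))).not.2 hY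
  have ht := (two_mul_sub_mem_bot_iff E' y
    ((E' 0 : Laurent d) - (E' 1 : Laurent d) - (E' 2 : Laurent d))).not.2 hy'
  generalize 2 * toExt K (E 2 : Laurent d) * Y -
    toExt K ((E 0 : Laurent d) - (E 1 : Laurent d) - (E 2 : Laurent d)) = s at *
  subst e
  have hrw : 2 * toExt K (E' 2 : Laurent d) * (a + b * s) -
      toExt K ((E' 0 : Laurent d) - (E' 1 : Laurent d) - (E' 2 : Laurent d)) =
      (2 * toExt K (E' 2 : Laurent d) * a -
      toExt K ((E' 0 : Laurent d) - (E' 1 : Laurent d) - (E' 2 : Laurent d))) +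
      (2 * toExt K (E' 2 : Laurent d) * b) * s := by ring
  rw [hrw] at ht ht2
  have hm : 2 * toExt K (E' 2 : Laurent d) ∈ (⊥ : IntermediateField (LaurentField d) K) :=
    mul_mem (ofNat_mem _ 2) (toExt_mem_bot _)
  have hbm := mul_mem hm hb
  have : CharZero (LaurentField d) := charZero_extension d _
  have h0 := eq_mul_of_sq_mem_bot hs (by rw [hs2]; exact toExt_mem_bot _)
    (sub_mem (mul_mem hm ha) (toExt_mem_bot _)) hbm
    (by rw [ht2]; exact toExt_mem_bot _) ht
  rw [h0, zero_add] at ht ht2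
  generalize 2 * toExt K (E' 2 : Laurent d) * b = b' at *
  obtain ⟨c, rfl⟩ := IntermediateField.mem_bot.1 hbm
  have hc : algebraMap (Laurent d) (LaurentField d)
      (bFun (E' 0 : Laurent d) (E' 1 : Laurent d) (E' 2 : Laurent d)) =
      (c * algebraMap (Laurent d) (LaurentField d) Q) ^ 2 *
        algebraMap (Laurent d) (LaurentField d) D := by
    apply (algebraMap (LaurentField d) K).injective
    rw [hB] at hs2
    change toExt K _ = _
    rw [← ht2, mul_pow, hs2]
    simp only [map_mul, map_pow, toExt, RingHom.comp_apply]
    ring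
  obtain ⟨Q', hQ', e⟩ := exists_algebraMap_eq_of_sq_mul hD hc
  refine mk_mem_configurations_iff.2 ⟨Q', ?_, e⟩
  rintro rfl
  rw [e, zero_pow two_ne_zero, zero_mul, map_zero] at ht2
  apply ht
  rw [pow_eq_zero_iff two_ne_zero |>.1 ht2]
  exact zero_mem _

/-- Every configuration of the squarefree part of the discriminant of `Y` defines an irrational
element of the field generated by `Y`. -/
theorem Defines.exists_mem_adjoin {E E' : Fin 3 → (Laurent d)ˣ} {Y : K} (h : Defines E Y)
    (hY : Y ∉ (⊥ : IntermediateField (LaurentField d) K)) {D Q : Laurent d}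
    (hB : bFun (E 0 : Laurent d) (E 1 : Laurent d) (E 2 : Laurent d) = Q ^ 2 * D)
    (hE' : Configuration.mk E' ∈ configurations D) :
    ∃ y ∈ IntermediateField.adjoin (LaurentField d) {Y},
      y ∉ (⊥ : IntermediateField (LaurentField d) K) ∧ Defines E' y := by
  have := charZero_extension d K
  obtain ⟨Q', hQ', hB'⟩ := mk_mem_configurations_iff.1 hE'
  have hs2 := h.sq_eq
  have hs := (two_mul_sub_mem_bot_iff E Y
    ((E 0 : Laurent d) - (E 1 : Laurent d) - (E 2 : Laurent d))).not.2 hY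
  have hbot : ∀ {y : K}, y ∈ (⊥ : IntermediateField (LaurentField d) K) →
      y ∈ IntermediateField.adjoin (LaurentField d) {Y} :=
    fun h => bot_le (a := IntermediateField.adjoin (LaurentField d) {Y}) h
  have hsM : 2 * toExt K (E 2 : Laurent d) * Y -
      toExt K ((E 0 : Laurent d) - (E 1 : Laurent d) - (E 2 : Laurent d)) ∈
      IntermediateField.adjoin (LaurentField d) {Y} :=
    sub_mem (mul_mem (mul_mem (ofNat_mem _ 2) (hbot (toExt_mem_bot _)))
      (IntermediateField.mem_adjoin_simple_self _ _)) (hbot (toExt_mem_bot _))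
  generalize 2 * toExt K (E 2 : Laurent d) * Y -
    toExt K ((E 0 : Laurent d) - (E 1 : Laurent d) - (E 2 : Laurent d)) = s at *
  have hQ : toExt K Q ≠ 0 := fun h0 => hs (by
    rw [hB, map_mul, map_pow, h0, zero_pow two_ne_zero, zero_mul] at hs2
    rw [pow_eq_zero_iff two_ne_zero |>.1 hs2]
    exact zero_mem _)
  have hQ'K : toExt K Q' ≠ 0 := fun h0 => hQ' (toExt_injective (d := d) (by rw [h0, map_zero]))
  have h2 := toExt_unit_ne_zero (K := K) (E' 2)
  set A := (E' 0 : Laurent d) - (E' 1 : Laurent d) - (E' 2 : Laurent d) with hA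
  -- The two discriminants differ by the square of Q'/Q, so t is a root of the second one and the
  -- quadratic formula gives the element.
  set t := toExt K Q' / toExt K Q * s with ht
  have hy : 2 * toExt K (E' 2 : Laurent d) * ((toExt K A + t) / (2 * toExt K (E' 2 : Laurent d))) -
      toExt K A = t := by field_simp; ring
  refine ⟨(toExt K A + t) / (2 * toExt K (E' 2 : Laurent d)), ?_, ?_, ?_⟩
  · exact div_mem (add_mem (hbot (toExt_mem_bot _)) (mul_mem (div_mem (hbot (toExt_mem_bot _))
      (hbot (toExt_mem_bot _))) hsM)) (mul_mem (ofNat_mem _ 2) (hbot (toExt_mem_bot _)))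
  · rw [← two_mul_sub_mem_bot_iff E' _ A, hy]
    intro h0
    apply hs
    rw [show s = t / (toExt K Q' / toExt K Q) by rw [ht]; field_simp]
    exact div_mem h0 (div_mem (toExt_mem_bot _) (toExt_mem_bot _))
  · have hsD : s ^ 2 = toExt K Q ^ 2 * toExt K D := by rw [hs2, hB, map_mul, map_pow]
    have ht2 : t ^ 2 =
        toExt K A ^ 2 - 4 * toExt K (E' 1 : Laurent d) * toExt K (E' 2 : Laurent d) :=
      calc t ^ 2 = toExt K (Q' ^ 2 * D) := by
            rw [ht, mul_pow, div_pow, hsD, map_mul, map_pow]; field_simp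
        _ = _ := by rw [← hB', hA]; unfold bFun; simp only [map_sub, map_mul, map_pow, map_ofNat]
    unfold Defines
    rw [← hA]
    field_simp
    linear_combination ht2

end

/-! ### Counting columns -/

theorem isMonomial_of_isUnit {d : ℕ} {K : Type*} [Field K] [Algebra (LaurentField d) K]
    {f : Laurent d} (h : IsUnit f) : IsMonomial d (toExt K f) := by
  obtain ⟨e, c, -, rfl⟩ := exists_eq_single_of_isUnit h
  exact ⟨e, c, rfl⟩

namespace MonomialPair

variable {d : ℕ} {P Q K : Type*} [Field K] [Algebra (LaurentField d) K] {x z : P → Q → K}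

/-- The only monomial not obviously nonzero is the product of 2 × 2 minors; if it vanished, the
quadratic would split over F. -/
theorem exists_defines (h : MonomialPair d x z) {p q : P} {a b : Q} (hp : ∀ c, z p c ≠ 0)
    (hq : ∀ c, z q c ≠ 0) (hc : crossRatio x p q a b ∉ (⊥ : IntermediateField (LaurentField d) K)) :
    ∃ E : Fin 3 → (Laurent d)ˣ, Defines E (-crossRatio x p q a b) := by
  obtain ⟨hpq, hab⟩ := h.ne_of_not_mem hc
  have hquad := h.quadratic p q a b
  have hA := (h.entry p a).mul (h.entry q b)
  have hC := (h.entry p b).mul (h.entry q a)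
  have hE := h.minor p q a b hpq hab
  have hA0 := mul_ne_zero (mul_ne_zero (h.ne_zero p a) (hp a)) (mul_ne_zero (h.ne_zero q b) (hq b))
  have hC0 := mul_ne_zero (mul_ne_zero (h.ne_zero p b) (hp b)) (mul_ne_zero (h.ne_zero q a) (hq a))
  have hE0 : (x p a * x q b - x p b * x q a) * (z p a * z q b - z p b * z q a) ≠ 0 := by
    intro h0
    rw [h0] at hquad
    have h1 : (-crossRatio x p q a b + 1) * (x p b * z p b * (x q a * z q a) *
        -crossRatio x p q a b + x p a * z p a * (x q b * z q b)) = 0 := by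
      linear_combination hquad
    apply hc
    rcases mul_eq_zero.1 h1 with h2 | h2
    · rw [show crossRatio x p q a b = 1 by linear_combination -h2]
      exact one_mem _
    · rw [show crossRatio x p q a b = x p a * z p a * (x q b * z q b) /
        (x p b * z p b * (x q a * z q a)) by rw [eq_div_iff hC0]; linear_combination -h2]
      exact div_mem hA.mem_bot hC.mem_bot
  obtain ⟨e₀, h₀⟩ := hE.exists_unit hE0
  obtain ⟨e₁, h₁⟩ := hA.exists_unit hA0
  obtain ⟨e₂, h₂⟩ := hC.exists_unit hC0
  refine ⟨![e₀, e₁, e₂], ?_⟩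
  unfold Defines
  simp only [Matrix.cons_val, map_sub, h₀, h₁, h₂]
  exact hquad

/-- The triples that define the cross-ratios with a fixed column determine the other column. -/
theorem column_eq_of_mk_eq (h : MonomialPair d x z) {p q : P} {a b c : Q} (hp : ∀ c, z p c ≠ 0)
    (hq : ∀ c, z q c ≠ 0) (hb : crossRatio x p q a b ∉ (⊥ : IntermediateField (LaurentField d) K))
    {E E' : Fin 3 → (Laurent d)ˣ} (hE : Defines E (-crossRatio x p q a b))
    (hE' : Defines E' (-crossRatio x p q a c)) (hmk : Configuration.mk E = Configuration.mk E') :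
    b = c := by
  by_contra hbc
  have hpq := (h.ne_of_not_mem hb).1
  obtain ⟨u, hu⟩ := Configuration.mk_eq_mk_iff.1 hmk
  have hmul := h.crossRatio_mul_right p q a b c
  have hb0 := h.crossRatio_ne_zero p q a b
  have hm := h.minor p q b c hpq hbc
  have hquad := h.quadratic p q b c
  have hone : crossRatio x p q b c ≠ 1 := fun h1 => by
    apply h.minor_ne_zero p q b c hpq hbc
    have := h.ne_zero p c; have := h.ne_zero q b
    unfold crossRatio at h1
    rw [div_eq_one_iff_eq (by positivity)] at h1
    rw [h1, sub_self]
  have hχ := (h.entry p c).mul (h.entry q b)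
  have hχ' := (h.entry p b).mul (h.entry q c)
  have hχ0 := mul_ne_zero (mul_ne_zero (h.ne_zero p c) (hp c)) (mul_ne_zero (h.ne_zero q b) (hq b))
  generalize (x p b * x q c - x p c * x q b) * (z p b * z q c - z p c * z q b) = e at *
  generalize x p c * z p c * (x q b * z q b) = χ at *
  generalize x p b * z p b * (x q c * z q c) = χ' at *
  generalize crossRatio x p q b c = w at *
  generalize crossRatio x p q a b = y at *
  rw [← hmul] at hE'
  have hy : -y ∉ (⊥ : IntermediateField (LaurentField d) K) := neg_mem_iff.not.2 hb
  have hB : ∀ r, bFun (E 0 : Laurent d) (E 1 : Laurent d) (E 2 : Laurent d) ≠ r ^ 2 :=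
    fun r hr => hy (hE.mem_bot_of_eq_sq hr)
  have m₀ := isMonomial_of_isUnit (K := K) (E 0).isUnit
  have m₁ := isMonomial_of_isUnit (K := K) (E 1).isUnit
  have m₂ := isMonomial_of_isUnit (K := K) (E 2).isUnit
  have n₁ := toExt_unit_ne_zero (K := K) (E 1)
  have n₂ := toExt_unit_ne_zero (K := K) (E 2)
  have hBK : toExt K (bFun (E 0 : Laurent d) (E 1 : Laurent d) (E 2 : Laurent d)) =
      bFun (toExt K (E 0 : Laurent d)) (toExt K (E 1 : Laurent d)) (toExt K (E 2 : Laurent d)) := by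
    unfold bFun
    simp only [map_sub, map_mul, map_pow, map_ofNat]
  have hEw : toExt K (E 2 : Laurent d) * (-(y * w)) ^ 2 - (toExt K (E 0 : Laurent d) -
      toExt K (E 1 : Laurent d) - toExt K (E 2 : Laurent d)) * -(y * w) +
      toExt K (E 1 : Laurent d) = 0 := by
    unfold Defines at hE'
    simp only [hu, Units.val_mul, map_sub, map_mul] at hE' ⊢
    linear_combination toExt K (u : Laurent d) * hE'
  unfold Defines at hE
  rw [map_sub, map_sub] at hE
  have htrace := mem_bot_of_trace_eq_zero m₀ m₁ m₂ n₁ n₂ hE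
  unfold bFun at hBK
  generalize toExt K (E 0 : Laurent d) = e₀ at *
  generalize toExt K (E 1 : Laurent d) = e₁ at *
  generalize toExt K (E 2 : Laurent d) = e₂ at *
  -- As w ≠ 1, -y and -yw are the two roots of one quadratic; this and the next identity are its sum
  -- and product of roots.
  have hsum : e₂ * (y * (1 + w)) + (e₀ - e₁ - e₂) = 0 := by
    have : y * (w - 1) ≠ 0 := mul_ne_zero hb0 (sub_ne_zero.2 hone)
    apply mul_left_cancel₀ this
    linear_combination hEw - hE
  have hnorm : e₂ * (y ^ 2 * w) = e₁ := by
    linear_combination y * hsum - hE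
  have hA : e₀ - e₁ - e₂ ∈ (⊥ : IntermediateField (LaurentField d) K) :=
    sub_mem (sub_mem m₀.mem_bot m₁.mem_bot) m₂.mem_bot
  by_cases hw : w ∈ (⊥ : IntermediateField (LaurentField d) K)
  · by_cases hw1 : 1 + w = 0
    · rw [hw1, mul_zero, mul_zero, zero_add] at hsum
      exact hy (htrace hsum)
    · apply hb
      rw [show y = -(e₀ - e₁ - e₂) / (e₂ * (1 + w)) by field_simp; linear_combination hsum]
      exact div_mem (neg_mem hA) (mul_mem m₂.mem_bot (add_mem (one_mem _) hw))
  -- The quotient w of conjugate roots has norm 1.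
  have hw2 : e₁ * e₂ * w ^ 2 = ((e₀ - e₁ - e₂) ^ 2 - 2 * e₁ * e₂) * w - e₁ * e₂ := by
    have : e₀ - e₁ - e₂ = -(e₂ * (y * (1 + w))) := by linear_combination hsum
    rw [this, ← hnorm]
    ring
  -- Columns b, c give w a second quadratic. Eliminating w² leaves a linear relation over F, both of
  -- whose coefficients vanish because w is irrational.
  have hlin : (χ * ((e₀ - e₁ - e₂) ^ 2 - 2 * e₁ * e₂) + e₁ * e₂ * (e - χ' - χ)) * w =
      e₁ * e₂ * (χ - χ') := by
    linear_combination e₁ * e₂ * hquad - χ * hw2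
  have hcoeff : χ * ((e₀ - e₁ - e₂) ^ 2 - 2 * e₁ * e₂) + e₁ * e₂ * (e - χ' - χ) = 0 := by
    by_contra hne
    apply hw
    rw [mul_comm, ← eq_div_iff hne] at hlin
    have m₁₂ := mul_mem m₁.mem_bot m₂.mem_bot
    rw [hlin]
    exact div_mem (mul_mem m₁₂ (sub_mem hχ.mem_bot hχ'.mem_bot))
      (add_mem (mul_mem hχ.mem_bot (sub_mem (pow_mem hA 2)
        (mul_mem (mul_mem (ofNat_mem _ 2) m₁.mem_bot) m₂.mem_bot)))
        (mul_mem m₁₂ (sub_mem (sub_mem hm.mem_bot hχ'.mem_bot) hχ.mem_bot)))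
  rw [hcoeff, zero_mul] at hlin
  have hχχ : χ' = χ := by
    have := (mul_eq_zero.1 hlin.symm).resolve_left (mul_ne_zero n₁ n₂)
    linear_combination -this
  rw [hχχ] at hcoeff
  -- The discriminant is therefore a monomial, hence a square, and y would be rational.
  have hneg : toExt K (-bFun (E 0 : Laurent d) (E 1 : Laurent d) (E 2 : Laurent d)) =
      e * (e₁ * e₂) / χ := by
    rw [map_neg]
    unfold bFun
    rw [hBK, eq_div_iff hχ0]
    linear_combination -hcoeff
  have hne : toExt K (-bFun (E 0 : Laurent d) (E 1 : Laurent d) (E 2 : Laurent d)) ≠ 0 := by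
    rw [Ne, map_eq_zero_iff _ (toExt_injective (d := d)), neg_eq_zero]
    exact fun h0 => hB 0 (by rw [h0, zero_pow two_ne_zero])
  rw [hneg] at hne
  obtain ⟨v, hv⟩ := ((hm.mul (m₁.mul m₂)).div hχ).exists_unit hne
  rw [← hneg] at hv
  have hunit : IsUnit (bFun (E 0 : Laurent d) (E 1 : Laurent d) (E 2 : Laurent d)) := by
    rw [← IsUnit.neg_iff, ← toExt_injective (d := d) hv]
    exact v.isUnit
  obtain ⟨r, hr⟩ := exists_bFun_eq_sq_of_isUnit (E 0).isUnit (E 1).isUnit (E 2).isUnit hunit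
  exact hB r hr

/-- Every column has an irrational cross-ratio with α or with β, since their quotient is irrational.
Each of the two sets of columns injects into S, whence the factor 2. -/
theorem card_columns_le (h : MonomialPair d x z) [Finite Q] {p q : P} {α β : Q}
    (hp : ∀ c, z p c ≠ 0) (hq : ∀ c, z q c ≠ 0)
    (hc : crossRatio x p q α β ∉ (⊥ : IntermediateField (LaurentField d) K))
    {M : IntermediateField (LaurentField d) K} (hM : crossRatio x p q α β ∈ M)
    {S : Set (Configuration d)} (hS : S.Finite)
    (hmem : ∀ (E : Fin 3 → (Laurent d)ˣ) (y : K), y ∈ M →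
      y ∉ (⊥ : IntermediateField (LaurentField d) K) → Defines E y → Configuration.mk E ∈ S) :
    Nat.card Q ≤ 2 * S.ncard := by
  have key : ∀ a b, crossRatio x p q a b ∈ M →
      crossRatio x p q a b ∉ (⊥ : IntermediateField (LaurentField d) K) →
      {c | crossRatio x p q a c ∉ (⊥ : IntermediateField (LaurentField d) K)}.ncard ≤ S.ncard := by
    intro a b hM hc
    have hex : ∀ c, ∃ E : Fin 3 → (Laurent d)ˣ,
        crossRatio x p q a c ∉ (⊥ : IntermediateField (LaurentField d) K) →
        Defines E (-crossRatio x p q a c) := fun c => by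
      by_cases hac : crossRatio x p q a c ∈ (⊥ : IntermediateField (LaurentField d) K)
      · exact ⟨1, fun h => absurd hac h⟩
      · obtain ⟨E, hE⟩ := h.exists_defines hp hq hac
        exact ⟨E, fun _ => hE⟩
    choose E hE using hex
    refine Set.ncard_le_ncard_of_injOn (fun c => Configuration.mk (E c)) ?_ ?_ hS
    · intro c hac
      exact hmem _ _ (neg_mem (h.crossRatio_mem_of_columns (fun s _ => hp s) (fun s _ => hq s) hM
        hc)) (neg_mem_iff.not.2 hac) (hE c hac)
    · intro c hac c' hac' hmk
      exact h.column_eq_of_mk_eq hp hq hac (hE c hac) (hE c' hac') hmk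
  have hβα := crossRatio_inv (x := x) p q α β
  have h1 := key α β hM hc
  have h2 := key β α (by rw [← hβα]; exact inv_mem hM) (by rwa [← hβα, inv_mem_iff])
  have hcover : (Set.univ : Set Q) ⊆
      {c | crossRatio x p q α c ∉ (⊥ : IntermediateField (LaurentField d) K)} ∪
      {c | crossRatio x p q β c ∉ (⊥ : IntermediateField (LaurentField d) K)} := by
    intro c _
    by_contra hcc
    simp only [Set.mem_union, Set.mem_ofPred_eq, not_or, not_not] at hcc
    apply hc
    rw [← h.crossRatio_mul_right p q α c, ← crossRatio_inv p q β c]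
    exact mul_mem hcc.1 (inv_mem hcc.2)
  have h3 := (Set.ncard_le_ncard hcover (Set.toFinite _)).trans (Set.ncard_union_le _ _)
  rw [Set.ncard_univ] at h3
  omega

end MonomialPair

theorem card_offRange {k n : ℕ} {f : Fin k → Fin n} (hf : Function.Injective f) :
    k + Nat.card (OffRange f) = n := by
  have h1 := Set.ncard_add_ncard_compl (Set.range f)
  rw [← Set.image_univ, Set.ncard_image_of_injective _ hf, Set.ncard_univ, Nat.card_fin,
    Nat.card_fin] at h1
  have h2 : (f '' Set.univ)ᶜ = {γ | ∀ a, f a ≠ γ} := by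
    ext γ
    simp
  rw [h2] at h1
  exact h1

end RadicalTerms

theorem mainTheorem6 (d k n : ℕ) (K : Type*) [Field K] [Algebra (LaurentField d) K]
    (L : Matrix (Fin k) (Fin n) K) (R : Matrix (Fin n) (Fin k) K)
    (hR : ∀ I : Finset (Fin n), I.card = k → minor R.transpose I ≠ 0)
    (hL : ∀ ω : Fin n, ∃ a : Fin k, L a ω ≠ 0)
    (hmon : ∀ I : Finset (Fin n), I.card = k →
      ∃ (e : Fin d → ℤ) (g : ℂ), term L R I = toExt K (AddMonoidAlgebra.single e g))
    (I : Finset (Fin n)) (i j α β : Fin n) (hrad : IsRadicalTerm d L R I i j α β) :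
    (∃ D : Laurent d, IsSquarefreePart D (bTerm L R I i j α β)) ∧
    ∀ D : Laurent d, IsSquarefreePart D (bTerm L R I i j α β) →
      (configurations D).Finite ∧
      (∀ E : Fin 3 → (Laurent d)ˣ, Configuration.mk E ∈ configurations D ↔
        ∃ y ∈ IntermediateField.adjoin (LaurentField d) {yTerm R I i j α β},
          y ∉ Set.range (algebraMap (LaurentField d) K) ∧ Defines E y) ∧
      (∀ (J : Finset (Fin n)) (m l γ δ : Fin n), IsRadicalTerm d L R J m l γ δ →
        ∃ E : Fin 3 → (Laurent d)ˣ,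
          (∀ s, toExt K (E s : Laurent d) = chi L R J m l γ δ s) ∧
          Configuration.mk E ∈ configurations D ∧ Defines E (yTerm R J m l γ δ)) ∧
      (n : ℤ) - k ≤ 2 * (configurations D).ncard + 2 := by
  have hLR := monomialTerms hR hL hmon
  obtain ⟨f, p, q, hf, rfl, rfl, rfl, hpq, hα, hβ⟩ := hrad.exists_fn
  have hαβ := hrad.ne_αβ
  obtain ⟨hLf, ⟨hpα, hpβ, hqα, hqβ⟩, hbot, E, hE, hdef⟩ := hrad.chart_data hLR hf hpq hα hβ
  have hY := yTerm_image (R := R) hf hpq hα hβ hαβ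
  set Y := yTerm R (Finset.univ.image f) (f p) (f q) α β with hYdef
  have hYbot : Y ∉ (⊥ : IntermediateField (LaurentField d) K) := by
    rw [hY]
    exact neg_mem_iff.not.2 hbot
  have hYM : minorRatio R.transpose f p q α β ∈ IntermediateField.adjoin (LaurentField d) {Y} := by
    rw [← neg_mem_iff, ← hY]
    exact IntermediateField.mem_adjoin_simple_self _ _
  have hB : bTerm L R (Finset.univ.image f) (f p) (f q) α β =
      toExt K (bFun (E 0 : Laurent d) (E 1 : Laurent d) (E 2 : Laurent d)) := by
    unfold bTerm bFun
    rw [← hE, ← hE, ← hE]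
    simp only [map_sub, map_mul, map_pow, map_ofNat]
  have hB0 : bFun (E 0 : Laurent d) (E 1 : Laurent d) (E 2 : Laurent d) ≠ 0 := fun h0 =>
    hYbot (hdef.mem_bot_of_eq_sq (q := 0) (by rw [h0, zero_pow two_ne_zero]))
  refine ⟨?_, fun D hDB => ?_⟩
  · obtain ⟨Q, D, hD, e⟩ := exists_eq_sq_mul_squarefree hB0
    exact ⟨D, hD, Q, by rw [hB, e]⟩
  obtain ⟨hD, Q, hQ⟩ := hDB
  have hBD := toExt_injective (d := d) (hB.symm.trans hQ)
  have hfin := finite_configurations hD.ne_zero (hdef.discriminant_ne_sq hYbot hBD)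
  have hmem : ∀ (E' : Fin 3 → (Laurent d)ˣ) (y : K),
      y ∈ IntermediateField.adjoin (LaurentField d) {Y} →
      y ∉ (⊥ : IntermediateField (LaurentField d) K) → Defines E' y →
      Configuration.mk E' ∈ configurations D := fun E' y hy hy' h' =>
    hdef.mk_mem_configurations hYbot hD hBD hy hy' h'
  refine ⟨hfin, fun E' => ⟨fun hE' => ?_, ?_⟩, ?_, ?_⟩
  · obtain ⟨y, hy, hy', h⟩ := hdef.exists_mem_adjoin hYbot hBD hE'
    exact ⟨y, hy, fun hr => hy' (IntermediateField.mem_bot.2 hr), h⟩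
  · rintro ⟨y, hy, hy', h⟩
    exact hmem E' y hy (fun hr => hy' (IntermediateField.mem_bot.1 hr)) h
  · intro J m l γ δ hJ
    obtain ⟨g, p', q', hg, rfl, rfl, rfl, hpq', hγ, hδ⟩ := hJ.exists_fn
    obtain ⟨hLg, ⟨h₁, h₃, h₄, h₂⟩, hbot', E', hE', hdef'⟩ := hJ.chart_data hLR hg hpq' hγ hδ
    refine ⟨E', hE', hmem E' _ ?_ (fun hr => hJ.not_mem_field (IntermediateField.mem_bot.1 hr))
      hdef', hdef'⟩
    rw [yTerm_image hg hpq' hγ hδ hJ.ne_αβ]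
    have hup : ∀ (a : Fin k) (ε : Fin n), chart L g a ε ≠ 0 →
        colMinor L (Function.update g a ε) ≠ 0 := fun a ε h => by
      rw [colMinor_eq_mul_chart hLg, colMinor_update (submatrix_chart hLg)]
      exact mul_ne_zero hLg h
    exact neg_mem (hLR.minorRatio_mem hf hLf (α := ⟨α, hα⟩) (β := ⟨β, hβ⟩) hpα hpβ hqα hqβ hbot
      hYM hg hγ hδ (hup _ _ h₁) (hup _ _ h₂) (hup _ _ h₃) (hup _ _ h₄))
  · have hpair := hLR.monomialPair hf hLf
    rw [minorRatio_eq_crossRatio (hLR.colMinor_ne_zero f hf) p q ⟨α, hα⟩ ⟨β, hβ⟩] at hbot hYM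
    have hrow : ∀ γ : OffRange f, chart L f p γ ≠ 0 ∧ chart L f q γ ≠ 0 := fun γ => by
      obtain ⟨m, hm⟩ := hLR.exists_chart_ne_zero hLf γ
      exact hpair.column_ne_zero hpα hpβ hqα hqβ hbot hm
    have hcard := hpair.card_columns_le (fun γ => (hrow γ).1) (fun γ => (hrow γ).2) hbot hYM hfin
      hmem
    -- The count yields n - k ≤ 2N_D, which is stronger than required.
    have := card_offRange hf
    omega
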